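/- **Conventions.** All functions are complex valued. Let $\mathscr F f(\xi)=\int e^{-ix\xi}f(x)\,dx$ on $L^2(\mathbb R)$, $\Delta=\partial_x^2$, $\langle x\rangle=(1+x^2)^{1/2}$, and $\Box_k=\mathscr F^{-1}\chi_{[k-1/2,k+1/2]}\mathscr F$ for $k\in\mathbb Z$. For a bounded interval $I\subset\mathbb R$ of length $|I|$ and $u:\mathbb R\to L^2(\mathbb R)$ put $u_I=\sum_{k\in I\cap\mathbb Z}\Box_k u$. A partition is a finite sequence $-\infty=t_0<t_1<\dots<t_K=\infty$. A $U^p$-atom is a function $a=\sum_{k=1}^K\chi_{[t_{k-1},t_k)}\phi_{k-1}:\mathbb R\to L^2$ with $\phi_k\in L^2$, $\phi_0=0$ and $\sum_{k=0}^{K-1}\|\phi_k\|_2^p=1$; $\|u\|_{U^p}$ is the infimum of $\sum_j|c_j|$ over all representations $u=\sum_{j\ge1}c_ja_j$ with $U^p$-atoms $a_j$, $c_j\in\mathbb C$, $\sum_j|c_j|<\infty$ ($\infty$ if there is none). If $\lim_{t\to\pm\infty}v(t)$ exist, then $\|v\|_{V^p}=\sup\big(\sum_{k=1}^K\|v(t_k)-v(t_{k-1})\|_2^p\big)^{1/p}$,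 the supremum being over all partitions, with $v(-\infty)=\lim_{t\to-\infty}v(t)$ and $v(\infty)=0$; otherwise $\|v\|_{V^p}=\infty$. Put $\|v\|_{V^p_\Delta}=\|e^{-it\Delta}v\|_{V^p}$ and $$\|u\|_{X^{s}_{q,\Delta}(I)}=\Big(\sum_{k\in I\cap\mathbb Z}\langle k\rangle^{sq}\,\|\Box_k e^{-it\Delta}u\|_{U^2}^q\Big)^{1/q}.$$ The norm of $L^\infty_tL^2_x\cap V^2_\Delta$ is the maximum of the two norms. $L^4_{x,t\in[0,T]}$ is $L^4$ over $x\in\mathbb R$, $t\in[0,T]$; in the other norms $t$ ranges over $\mathbb R$. **Theorem.** There is $\varepsilon_0>0$ such that for all $0<\varepsilon<\varepsilon_0$ the following hold for all $4\le q<\infty$, all $0<T<1$ and all $u:\mathbb R\to L^2(\mathbb R)$. (1) Let $c_0>0$. There is $C=C(c_0,\varepsilon)$ such that for every interval $I$ with $c_0\le|I|<\infty$ $$\|u_I\|_{L^4_{x,t\in[0,T]}}\le C\,T^{\varepsilon/3}|I|^{1/4-1/q+\varepsilon}\sup_{\lambda\in I}\langle\lambda\rangle^{-1/2}\|u\|_{X^{1/2}_{q,\Delta}(I)},$$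 $$\|u_I\|_{L^\infty_tL^2_x\cap V^2_\Delta}\le C\,|I|^{1/2-1/q}\sup_{\lambda\in I}\langle\lambda\rangle^{-1/2}\|u\|_{X^{1/2}_{q,\Delta}(I)},$$ $$\|u_I\|_{L^\infty_{x,t}}\le C\,|I|^{1-1/q}\sup_{\lambda\in I}\langle\lambda\rangle^{-1/2}\|u\|_{X^{1/2}_{q,\Delta}(I)}.$$ (2) Let $0<a<b$. There is $C=C(a,b,\varepsilon)$ such that for $I_j=[a2^j,b2^j]$, $j\in\mathbb Z$, $$\|u_{I_j}\|_{L^4_{x,t\in[0,T]}}\le C\,T^{\varepsilon/3}2^{j(-1/4-1/q+\varepsilon)}\|u\|_{X^{1/2}_{q,\Delta}(I_j)},$$ $$\|u_{I_j}\|_{L^\infty_tL^2_x\cap V^2_\Delta}\le C\,2^{-j/q}\|u\|_{X^{1/2}_{q,\Delta}(I_j)},\qquad \|u_{I_j}\|_{L^\infty_{x,t}}\le C\,2^{j(1/2-1/q)}\|u\|_{X^{1/2}_{q,\Delta}(I_j)}.$$ (3) Let $0<a<b$ and $0<c<1$. There is $C=C(a,b,c,\varepsilon)$ such that for all real $\lambda_0\ge1$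 and integers $j\ge0$ with $I_j=\lambda_0-[a2^j,b2^j]\subset[c\lambda_0,\lambda_0]$ $$\|u_{I_j}\|_{L^4_{x,t\in[0,T]}}\le C\,T^{\varepsilon/3}\langle\lambda_0\rangle^{-1/2}2^{j(1/4-1/q+\varepsilon)}\|u\|_{X^{1/2}_{q,\Delta}(I_j)},$$ $$\|u_{I_j}\|_{L^\infty_tL^2_x}\le C\,\langle\lambda_0\rangle^{-1/2}2^{j(1/2-1/q)}\|u\|_{X^{1/2}_{q,\Delta}(I_j)},\qquad \|u_{I_j}\|_{L^\infty_{x,t}}\le C\,\langle\lambda_0\rangle^{-1/2}2^{j(1-1/q)}\|u\|_{X^{1/2}_{q,\Delta}(I_j)}.$$ (4) Let $0<c<1$. There is $C=C(c,\varepsilon)$ such that for all real $\lambda_0\ge1$ and all intervals $I\subset[c\lambda_0,\lambda_0]$ or $I\subset[-\lambda_0,-c\lambda_0]$ $$\|u_I\|_{L^4_{x,t\in[0,T]}}\le C\,T^{\varepsilon/3}\langle\lambda_0\rangle^{-1/4-1/q+\varepsilon}\|u\|_{X^{1/2}_{q,\Delta}(I)},$$ $$\|u_I\|_{L^\infty_tL^2_x\cap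 V^2_\Delta}\le C\,\langle\lambda_0\rangle^{-1/q}\|u\|_{X^{1/2}_{q,\Delta}(I)},\qquad \|u_I\|_{L^\infty_{x,t}}\le C\,\langle\lambda_0\rangle^{1/2-1/q}\|u\|_{X^{1/2}_{q,\Delta}(I)}.$$ -/

import Mathlib

open MeasureTheory Filter Topology
open scoped ENNReal FourierTransform

noncomputable section

namespace DNLS

/-- The Hilbert space `L²(ℝ; ℂ)`. -/
abbrev L2 : Type := Lp ℂ 2 (volume : Measure ℝ)

/-- The bracket `⟨x⟩ = (1 + |x|²)^{1/2}`. -/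
def bracket (x : ℝ) : ℝ := Real.sqrt (1 + x ^ 2)

theorem memLp_mul (m : ℝ → ℂ) (hm : Measurable m) (hb : ∀ ξ, ‖m ξ‖ ≤ 1) (f : L2) :
    MemLp (fun ξ => m ξ * f ξ) 2 (volume : Measure ℝ) := by
  refine (Lp.memLp f).of_le (hm.aestronglyMeasurable.mul (Lp.aestronglyMeasurable f)) ?_
  refine Eventually.of_forall fun ξ => ?_
  rw [norm_mul]
  exact mul_le_of_le_one_left (norm_nonneg _) (hb ξ)

/-- The Fourier multiplier operator `ℱ⁻¹ m ℱ` on `L²(ℝ)`, for a measurable symbol `m` bounded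
by `1`. Here `ℱ f (ξ) = ∫ e^{-2π i x ξ} f(x) dx`, so a symbol `σ` in the angular frequency
(the convention `∫ e^{-i x ξ} f(x) dx`) has to be inserted as `m ξ = σ (2 π ξ)`. -/
def fourierMultiplier (m : ℝ → ℂ) (hm : Measurable m) (hb : ∀ ξ, ‖m ξ‖ ≤ 1) (f : L2) : L2 :=
  𝓕⁻ (memLp_mul m hm hb (𝓕 f)).toLp

/-- The symbol of `□_k`: the characteristic function of `[k - 1/2, k + 1/2]` in the angular
frequency `2 π ξ`. -/
def boxSymbol (k : ℤ) (ξ : ℝ) : ℂ :=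
  (Set.Icc ((k : ℝ) - 1 / 2) ((k : ℝ) + 1 / 2)).indicator (fun _ => (1 : ℂ)) (2 * Real.pi * ξ)

theorem measurable_boxSymbol (k : ℤ) : Measurable (boxSymbol k) :=
  (measurable_const.indicator measurableSet_Icc).comp (measurable_const.mul measurable_id)

theorem norm_boxSymbol_le (k : ℤ) (ξ : ℝ) : ‖boxSymbol k ξ‖ ≤ 1 := by
  refine (norm_indicator_le_norm_self (fun _ => (1 : ℂ)) (2 * Real.pi * ξ)).trans ?_
  simp

/-- The frequency-uniform projection `□_k = ℱ⁻¹ χ_{[k-1/2, k+1/2]} ℱ`. -/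
def box (k : ℤ) : L2 → L2 :=
  fourierMultiplier (boxSymbol k) (measurable_boxSymbol k) (norm_boxSymbol_le k)

/-- The symbol `e^{-i t η²}` of `e^{i t Δ}`, at the angular frequency `η = 2 π ξ`. -/
def schrodingerSymbol (t : ℝ) (ξ : ℝ) : ℂ :=
  Complex.exp ((-(t * (2 * Real.pi * ξ) ^ 2) : ℝ) * Complex.I)

theorem measurable_schrodingerSymbol (t : ℝ) : Measurable (schrodingerSymbol t) := by
  have h : Continuous (schrodingerSymbol t) := by
    unfold schrodingerSymbol
    fun_prop
  exact h.measurable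

theorem norm_schrodingerSymbol_le (t ξ : ℝ) : ‖schrodingerSymbol t ξ‖ ≤ 1 :=
  (Complex.norm_exp_ofReal_mul_I _).le

/-- The Schrödinger group `e^{i t Δ}` on `L²(ℝ)`, `Δ = ∂²_{xx}`. -/
def schrodinger (t : ℝ) : L2 → L2 :=
  fourierMultiplier (schrodingerSymbol t) (measurable_schrodingerSymbol t)
    (norm_schrodingerSymbol_le t)

/-- The function `t ↦ e^{-i t Δ} u(t)`. -/
def pullBack (u : ℝ → L2) (t : ℝ) : L2 := schrodinger (-t) (u t)

/-- A finite partition `-∞ = t_0 < t_1 < ⋯ < t_K = ∞`. -/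
structure TimePartition where
  /-- the number `K` of intervals -/
  K : ℕ
  /-- the points of the partition -/
  t : Fin (K + 1) → EReal
  strictMono : StrictMono t
  first : t 0 = ⊥
  last : t (Fin.last K) = ⊤

/-- `a` is a `U^p`-atom: `a = ∑_{k=1}^K χ_{[t_{k-1}, t_k)} φ_{k-1}` with `φ_0 = 0` and
`∑_{k=0}^{K-1} ‖φ_k‖^p = 1`. -/
def IsAtom (p : ℝ) (a : ℝ → L2) : Prop :=
  ∃ (P : TimePartition) (φ : Fin P.K → L2),
    (∀ k : Fin P.K, (k : ℕ) = 0 → φ k = 0) ∧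
    ∑ k, ‖φ k‖ ^ p = 1 ∧
    ∀ s : ℝ, a s = ∑ k : Fin P.K,
      (Set.Ico (P.t k.castSucc) (P.t k.succ)).indicator (fun _ => φ k) (s : EReal)

/-- The `U^p` norm, with value `∞` outside `U^p`: the infimum of `∑ |c_j|` over all
representations `u = ∑ c_j a_j` with `U^p`-atoms `a_j` and `c_j ∈ ℂ`. -/
def uNorm (p : ℝ) (u : ℝ → L2) : ℝ≥0∞ :=
  ⨅ (c : ℕ → ℂ) (a : ℕ → ℝ → L2) (_ : ∀ j, IsAtom p (a j)) (_ : Summable fun j => ‖c j‖)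
    (_ : ∀ t, HasSum (fun j => c j • a j t) (u t)), ∑' j, ‖c j‖ₑ

/-- The extension of `v` to `[-∞, ∞]` by the value `l` at `-∞` and `0` at `∞`. -/
def extend (l : L2) (v : ℝ → L2) (s : EReal) : L2 :=
  if s = ⊥ then l else if s = ⊤ then 0 else v s.toReal

/-- The `V^p` norm, with value `∞` outside `V^p`: if both limits `lim_{t → ±∞} v(t)` exist, it is
the supremum over all partitions of `(∑_{k=1}^K ‖v(t_k) - v(t_{k-1})‖^p)^{1/p}`, where
`v(-∞) = lim_{t → -∞} v(t)` and `v(∞) = 0`. -/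
def vNorm (p : ℝ) (v : ℝ → L2) : ℝ≥0∞ :=
  ⨅ (l : L2) (_ : Tendsto v atBot (𝓝 l)) (_ : ∃ r : L2, Tendsto v atTop (𝓝 r)),
    ⨆ P : TimePartition,
      (∑ k : Fin P.K, ‖extend l v (P.t k.succ) - extend l v (P.t k.castSucc)‖ₑ ^ p) ^ (1 / p)

/-- The `V^p_Δ` norm `‖e^{-i t Δ} v‖_{V^p}`. -/
def vNormΔ (p : ℝ) (v : ℝ → L2) : ℝ≥0∞ := vNorm p (pullBack v)

/-- The norm of `X^s_q(I)`: `(∑_{k ∈ I ∩ ℤ} ⟨k⟩^{s q} ‖□_k u‖_{U²}^q)^{1/q}`. -/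
def xNorm (s q : ℝ) (I : Set ℝ) (u : ℝ → L2) : ℝ≥0∞ :=
  (∑' k : {k : ℤ // (k : ℝ) ∈ I},
    ENNReal.ofReal (bracket (k : ℤ) ^ (s * q)) * uNorm 2 (fun t => box k (u t)) ^ q) ^ (1 / q)

/-- The norm of `X^s_{q,Δ}(I)`: `‖e^{-i t Δ} u‖_{X^s_q(I)}`. -/
def xNormΔ (s q : ℝ) (I : Set ℝ) (u : ℝ → L2) : ℝ≥0∞ := xNorm s q I (pullBack u)

/-- `u_I = ∑_{k ∈ I ∩ ℤ} □_k u`, for a bounded set `I` (so that the sum is finite). -/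
def proj (I : Set ℝ) (u : ℝ → L2) (t : ℝ) : L2 :=
  ∑ᶠ k : {k : ℤ // (k : ℝ) ∈ I}, box k (u t)

/-- The norm of `L^p_t L^r_x` over `t ∈ J`, `x ∈ ℝ`. For `p = r` this is the norm of `L^p` in
both variables, `t ∈ J` and `x ∈ ℝ`. -/
def mixedNorm (p r : ℝ≥0∞) (J : Set ℝ) (u : ℝ → L2) : ℝ≥0∞ :=
  eLpNorm (fun t : ℝ => eLpNorm (u t : ℝ → ℂ) r volume) p (volume.restrict J)

/-- `max_{x ∈ I} ⟨x⟩^{-1/2}`, as a supremum. -/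
def maxWeight (I : Set ℝ) : ℝ≥0∞ :=
  ⨆ x ∈ I, ENNReal.ofReal (bracket x ^ (-(1 / 2) : ℝ))

end DNLS

end

/-! Everything reduces to the finite set `S` of integers in `I`: only its cardinality and the size
of `⟨k⟩^{-1/2}` on it matter, and the four families of intervals differ only in how these two
numbers are bounded.

The analytic core is an `L⁴` bound for free waves that keeps the orthogonality of the cells: `∫_0^T
‖e^{itΔ}f‖_4^4 dt ≤ C T^δ |S|^{5δ/2} ∑_{k∈S} ‖□_k f‖_2^4` (`exists_schrodinger_estimate`). The
square of a free wave has the self-convolution of the evolved Fourier transform as its Fourier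
transform. At fixed total frequency only the half-difference `η` of the two frequencies oscillates
in time, with phase proportional to `tη²`. Plancherel in `x` and a `TT*` argument in `t` with a
Gaussian cutoff produce a kernel concentrated near `η' = ±η`, of mass at most a multiple of `min(√T,
1/|η|)`. Two cells at distance `m ≥ 1` therefore interact with strength `T^δ m^{-(1-2δ)}`, and
Schur's test sums over the pairs.

The components `□_k e^{-itΔ}u` depend on time and their atoms jump at unrelated times, so this bound
is transferred by chaining instead of atom by atom. A component of `U²` norm below `M` has squared
increments bounded by those of a monotone function with values in `[0, 4M²]`
(`exists_controlled_of_uNorm_lt`). For `2 ≤ p < 4` these functions merge into a single monotone `A`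
such that the `ℓ⁴` sum of the increments is at most `|A(s') - A(s)|^{4/p}`. Chaining over the dyadic
levels of `A` needs `2^n + 1` free waves at scale `n`, each of size about `2^{-4n/p}`; since `4/p >
1` the scales sum geometrically (`mixedNorm_four_le_of_increments`). No measurability of `u` in time
is used.

Hölder passes from `ℓ^p` to `ℓ^q` over `S`. The `L^∞L²` bound is orthogonality, the `V²` bound is
orthogonality and telescoping of the monotone controls, and the `L^∞` bound is Bernstein's
inequality. -/

noncomputable section

namespace DNLS

/-! ### Fourier multipliers, `□_k` and the Schrödinger group on `L²` -/

/-- On `L¹ ∩ L²` the inverse Fourier transform on `L²` is given by the Fourier integral. -/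
theorem coeFn_fourierInv (g : L2) (hg : Integrable (g : ℝ → ℂ)) :
    (𝓕⁻ g : L2) =ᵐ[volume] 𝓕⁻ (g : ℝ → ℂ) := by
  have hcont : Continuous (𝓕⁻ (g : ℝ → ℂ)) := by
    have := VectorFourier.fourierIntegral_continuous (μ := (volume : Measure ℝ))
      (L := -(innerₗ ℝ)) Real.continuous_fourierChar (by fun_prop) hg
    exact this
  -- Both sides are tested against smooth compactly supported functions: on `L²` the transform acts
  -- by duality on Schwartz functions, and `key` is the same duality for the Fourier integral.
  refine ae_eq_of_integral_contDiff_smul_eq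
    ((Lp.memLp (𝓕⁻ g)).locallyIntegrable (by norm_num)) hcont.locallyIntegrable ?_
  intro φ φ_smooth φ_cpt
  have hφ₁ : HasCompactSupport (Complex.ofRealCLM ∘ φ) := φ_cpt.comp_left rfl
  have hφ₂ : ContDiff ℝ ((⊤ : ℕ∞) : WithTop ℕ∞) (Complex.ofRealCLM ∘ φ) :=
    Complex.ofRealCLM.contDiff.comp φ_smooth
  set ψ := hφ₁.toSchwartzMap hφ₂ with hψ
  have hψv : ∀ x, ψ x = (φ x : ℂ) := fun x => rfl
  have key := VectorFourier.integral_fourierIntegral_smul_eq_flip (μ := (volume : Measure ℝ))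
    (ν := (volume : Measure ℝ)) (L := -(innerₗ ℝ)) Real.continuous_fourierChar (by fun_prop)
    ψ.integrable hg
  have h1 := DFunLike.congr_fun (Lp.fourierInv_toTemperedDistribution_eq g) ψ
  rw [TemperedDistribution.fourierInv_apply, Lp.toTemperedDistribution_apply,
    Lp.toTemperedDistribution_apply] at h1
  have h2 : ∀ x, (φ x : ℝ) • (𝓕⁻ g : L2) x = ψ x • (𝓕⁻ g : L2) x := fun x => by
    rw [hψv]; simp
  have h3 : ∀ x, (φ x : ℝ) • 𝓕⁻ (g : ℝ → ℂ) x = ψ x • 𝓕⁻ (g : ℝ → ℂ) x := fun x => by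
    rw [hψv]; simp
  simp_rw [h2, h3]
  rw [← h1]
  convert key using 1
  · simp only [SchwartzMap.fourierInv_coe]
    rfl
  · refine integral_congr_ae (Eventually.of_forall fun x => ?_)
    have : (-(innerₗ ℝ) : ℝ →ₗ[ℝ] ℝ →ₗ[ℝ] ℝ).flip = -(innerₗ ℝ) := by
      ext; simp
    simp only [this]
    rfl

theorem coeFn_fourier_fourierMultiplier (m : ℝ → ℂ) (hm : Measurable m) (hb : ∀ ξ, ‖m ξ‖ ≤ 1)
    (f : L2) : (𝓕 (fourierMultiplier m hm hb f) : L2) =ᵐ[volume] fun ξ => m ξ * (𝓕 f : L2) ξ := by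
  rw [fourierMultiplier, FourierTransform.fourier_fourierInv_eq]
  exact MemLp.coeFn_toLp _

theorem fourier_injective {f g : L2} (h : (𝓕 f : L2) =ᵐ[volume] (𝓕 g : L2)) : f = g :=
  (Lp.fourierTransformₗᵢ ℝ ℂ).injective (Lp.ext h)

theorem fourierMultiplier_add (m : ℝ → ℂ) (hm : Measurable m) (hb : ∀ ξ, ‖m ξ‖ ≤ 1) (f g : L2) :
    fourierMultiplier m hm hb (f + g) = fourierMultiplier m hm hb f + fourierMultiplier m hm hb g := by
  apply fourier_injective
  rw [FourierTransform.fourier_add]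
  have h0 : (𝓕 (f + g) : L2) =ᵐ[volume] ((𝓕 f : L2) + (𝓕 g : L2) : ℝ → ℂ) := by
    rw [FourierTransform.fourier_add]; exact Lp.coeFn_add _ _
  filter_upwards [coeFn_fourier_fourierMultiplier m hm hb (f + g),
    coeFn_fourier_fourierMultiplier m hm hb f, coeFn_fourier_fourierMultiplier m hm hb g,
    Lp.coeFn_add (𝓕 (fourierMultiplier m hm hb f)) (𝓕 (fourierMultiplier m hm hb g)), h0]
    with ξ h1 h2 h3 h4 h5
  rw [h1, h4, h5, Pi.add_apply, Pi.add_apply, h2, h3, mul_add]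

theorem fourierMultiplier_smul (m : ℝ → ℂ) (hm : Measurable m) (hb : ∀ ξ, ‖m ξ‖ ≤ 1) (c : ℂ)
    (f : L2) : fourierMultiplier m hm hb (c • f) = c • fourierMultiplier m hm hb f := by
  apply fourier_injective
  rw [FourierTransform.fourier_smul]
  have h0 : (𝓕 (c • f) : L2) =ᵐ[volume] (c • (𝓕 f : L2) : ℝ → ℂ) := by
    rw [FourierTransform.fourier_smul]; exact Lp.coeFn_smul _ _
  filter_upwards [coeFn_fourier_fourierMultiplier m hm hb (c • f),
    coeFn_fourier_fourierMultiplier m hm hb f,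
    Lp.coeFn_smul c (𝓕 (fourierMultiplier m hm hb f)), h0] with ξ h1 h2 h4 h5
  rw [h1, h4, h5, Pi.smul_apply, Pi.smul_apply, h2, smul_eq_mul, smul_eq_mul]
  ring

theorem norm_fourierMultiplier_le (m : ℝ → ℂ) (hm : Measurable m) (hb : ∀ ξ, ‖m ξ‖ ≤ 1) (f : L2) :
    ‖fourierMultiplier m hm hb f‖ ≤ ‖f‖ := by
  rw [← Lp.norm_fourier_eq, ← Lp.norm_fourier_eq f]
  refine Lp.norm_le_norm_of_ae_le ?_
  filter_upwards [coeFn_fourier_fourierMultiplier m hm hb f] with ξ h1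
  rw [h1, norm_mul]
  exact mul_le_of_le_one_left (norm_nonneg _) (hb ξ)

/-- The Fourier multiplier as a continuous linear map. -/
def fourierMultiplierL (m : ℝ → ℂ) (hm : Measurable m) (hb : ∀ ξ, ‖m ξ‖ ≤ 1) : L2 →L[ℂ] L2 :=
  LinearMap.mkContinuous
    { toFun := fourierMultiplier m hm hb
      map_add' := fourierMultiplier_add m hm hb
      map_smul' := fourierMultiplier_smul m hm hb } 1
    (fun f => by simpa using norm_fourierMultiplier_le m hm hb f)

/-- `□_k` as a continuous linear map. -/
def boxL (k : ℤ) : L2 →L[ℂ] L2 :=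
  fourierMultiplierL (boxSymbol k) (measurable_boxSymbol k) (norm_boxSymbol_le k)

/-- `e^{i t Δ}` as a continuous linear map. -/
def schrodingerL (t : ℝ) : L2 →L[ℂ] L2 :=
  fourierMultiplierL (schrodingerSymbol t) (measurable_schrodingerSymbol t)
    (norm_schrodingerSymbol_le t)

theorem coeFn_fourier_box (k : ℤ) (f : L2) :
    (𝓕 (box k f) : L2) =ᵐ[volume] fun ξ => boxSymbol k ξ * (𝓕 f : L2) ξ :=
  coeFn_fourier_fourierMultiplier _ _ _ f

theorem coeFn_fourier_schrodinger (t : ℝ) (f : L2) :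
    (𝓕 (schrodinger t f) : L2) =ᵐ[volume] fun ξ => schrodingerSymbol t ξ * (𝓕 f : L2) ξ :=
  coeFn_fourier_fourierMultiplier _ _ _ f

theorem box_schrodinger (k : ℤ) (t : ℝ) (f : L2) :
    box k (schrodinger t f) = schrodinger t (box k f) := by
  apply fourier_injective
  filter_upwards [coeFn_fourier_box k (schrodinger t f), coeFn_fourier_schrodinger t f,
    coeFn_fourier_box k f, coeFn_fourier_schrodinger t (box k f)] with ξ h1 h2 h3 h4
  rw [h1, h2, h4, h3]
  ring

theorem schrodinger_neg (t : ℝ) (f : L2) : schrodinger t (schrodinger (-t) f) = f := by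
  apply fourier_injective
  filter_upwards [coeFn_fourier_schrodinger (-t) f,
    coeFn_fourier_schrodinger t (schrodinger (-t) f)] with ξ h1 h2
  rw [h2, h1, ← mul_assoc, schrodingerSymbol, schrodingerSymbol, ← Complex.exp_add]
  rw [show ((-(t * (2 * Real.pi * ξ) ^ 2) : ℝ) : ℂ) * Complex.I
    + ((-(-t * (2 * Real.pi * ξ) ^ 2) : ℝ) : ℂ) * Complex.I = 0 by push_cast; ring]
  simp

theorem norm_schrodinger (t : ℝ) (f : L2) : ‖schrodinger t f‖ = ‖f‖ := by
  refine le_antisymm (norm_fourierMultiplier_le _ _ _ f) ?_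
  conv_lhs => rw [← schrodinger_neg (-t) f, neg_neg]
  exact norm_fourierMultiplier_le _ _ _ _

/-! ### `TT*` in time with a Gaussian cutoff -/

/-- The phase `e^{-8π² i t η²}` of the product of two free Schrödinger waves. -/
def osc (t η : ℝ) : ℂ := Complex.exp ((-(8 * Real.pi ^ 2 * t * η ^ 2) : ℝ) * Complex.I)

theorem norm_osc (t η : ℝ) : ‖osc t η‖ = 1 := Complex.norm_exp_ofReal_mul_I _

theorem continuous_osc : Continuous fun z : ℝ × ℝ => osc z.1 z.2 := by
  unfold osc
  fun_prop

/-- The kernel produced by integrating the phase difference against a Gaussian in time. -/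
def oscKernel (T η η' : ℝ) : ℝ :=
  Real.sqrt Real.pi * T * Real.exp (-(T * (η ^ 2 - η' ^ 2)) ^ 2)

theorem measurable_oscKernel (T : ℝ) : Measurable fun z : ℝ × ℝ => oscKernel T z.1 z.2 := by
  have : Continuous fun z : ℝ × ℝ => oscKernel T z.1 z.2 := by
    unfold oscKernel
    fun_prop
  exact this.measurable

theorem oscKernel_comm (T η η' : ℝ) : oscKernel T η η' = oscKernel T η' η := by
  unfold oscKernel
  congr 3
  ring

/-- The mass of the kernel `oscKernel`. -/
def oscMass (T η : ℝ) : ℝ≥0∞ := ∫⁻ η', ENNReal.ofReal (oscKernel T η η')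

theorem measurable_oscMass (T : ℝ) : Measurable (oscMass T) :=
  Measurable.lintegral_prod_right (measurable_oscKernel T).ennreal_ofReal

/-- The phase difference has time frequency `8π²(η² - η'²)`, and the Fourier transform of the
Gaussian there is `√π T exp(-16π⁴ (T(η² - η'²))²)`. The factor `16π⁴ ≥ 1` in the exponent is
dropped. -/
theorem norm_integral_gaussian_osc_le {T : ℝ} (hT : 0 < T) (η η' : ℝ) :
    ‖∫ t : ℝ, (Real.exp (-(T ^ 2)⁻¹ * t ^ 2) : ℂ) * (osc t η * starRingEnd ℂ (osc t η'))‖ ≤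
      oscKernel T η η' := by
  have hb : 0 < (((T ^ 2)⁻¹ : ℝ) : ℂ).re := by
    rw [Complex.ofReal_re]; positivity
  have h := fourierIntegral_gaussian hb ((-(8 * Real.pi ^ 2 * (η ^ 2 - η' ^ 2)) : ℝ) : ℂ)
  have h2 : ∀ t : ℝ, (Real.exp (-(T ^ 2)⁻¹ * t ^ 2) : ℂ) * (osc t η * starRingEnd ℂ (osc t η')) =
      Complex.exp (Complex.I * ((-(8 * Real.pi ^ 2 * (η ^ 2 - η' ^ 2)) : ℝ) : ℂ) * t) *
        Complex.exp (-(((T ^ 2)⁻¹ : ℝ) : ℂ) * t ^ 2) := by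
    intro t
    rw [osc, osc, ← Complex.exp_conj, ← Complex.exp_add, Complex.ofReal_exp, ← Complex.exp_add,
      ← Complex.exp_add]
    congr 1
    simp only [map_mul, Complex.conj_ofReal, Complex.conj_I]
    push_cast
    ring
  simp_rw [h2]
  rw [h, norm_mul]
  have h3 : ‖((Real.pi : ℂ) / (((T ^ 2)⁻¹ : ℝ) : ℂ)) ^ (1 / 2 : ℂ)‖ = Real.sqrt Real.pi * T := by
    rw [← Complex.ofReal_div, show (1 / 2 : ℂ) = ((1 / 2 : ℝ) : ℂ) by push_cast; rfl,
      Complex.norm_cpow_eq_rpow_re_of_pos (by positivity), Complex.ofReal_re,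
      ← Real.sqrt_eq_rpow, div_inv_eq_mul, Real.sqrt_mul Real.pi_pos.le, Real.sqrt_sq hT.le]
  have h4 : (-(((-(8 * Real.pi ^ 2 * (η ^ 2 - η' ^ 2)) : ℝ) : ℂ) ^ 2) /
      (4 * (((T ^ 2)⁻¹ : ℝ) : ℂ))) =
      ((-(16 * Real.pi ^ 4 * (T * (η ^ 2 - η' ^ 2)) ^ 2) : ℝ) : ℂ) := by
    have : (T : ℂ) ≠ 0 := by exact_mod_cast hT.ne'
    push_cast
    field_simp
    ring
  rw [h3, h4, ← Complex.ofReal_exp, Complex.norm_real, Real.norm_eq_abs, Real.abs_exp, oscKernel]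
  gcongr
  have : 1 ≤ 16 * Real.pi ^ 4 := by
    have := Real.pi_gt_three
    have : 1 ≤ Real.pi ^ 4 := one_le_pow₀ (by linarith)
    linarith
  nlinarith [sq_nonneg (T * (η ^ 2 - η' ^ 2))]

theorem ennreal_mul_le_sq_add_sq (a b : ℝ≥0∞) : a * b ≤ a ^ 2 + b ^ 2 := by
  rcases le_total a b with h | h
  · exact (mul_le_mul_left h b).trans (by rw [sq b]; exact le_add_self)
  · exact (mul_le_mul_right h a).trans (by rw [sq a]; exact le_self_add)

/-- The Gaussian-weighted product of two oscillating densities. -/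
def oscPair (T : ℝ) (g : ℝ → ℂ) (t : ℝ) (z : ℝ × ℝ) : ℂ :=
  (Real.exp (-(T ^ 2)⁻¹ * t ^ 2) : ℂ) *
    ((g z.1 * osc t z.1) * starRingEnd ℂ (g z.2 * osc t z.2))

theorem integrable_oscPair {T : ℝ} (hT : 0 < T) {g : ℝ → ℂ} (hg : Integrable g) :
    Integrable (Function.uncurry (oscPair T g)) (volume.prod (volume.prod volume)) := by
  have hψi : Integrable (fun t : ℝ => Real.exp (-(T ^ 2)⁻¹ * t ^ 2)) :=
    integrable_exp_neg_mul_sq (by positivity)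
  have h1 : Integrable (fun w : ℝ × (ℝ × ℝ) =>
      (Real.exp (-(T ^ 2)⁻¹ * w.1 ^ 2) : ℂ) * (g w.2.1 * starRingEnd ℂ (g w.2.2)))
      (volume.prod (volume.prod volume)) :=
    hψi.ofReal.mul_prod (hg.mul_prod ((Complex.conjLIE.integrable_comp_iff).2 hg))
  have h2 : Continuous fun w : ℝ × (ℝ × ℝ) => osc w.1 w.2.1 * starRingEnd ℂ (osc w.1 w.2.2) := by
    have a1 : Continuous fun w : ℝ × (ℝ × ℝ) => osc w.1 w.2.1 :=
      continuous_osc.comp (f := fun w : ℝ × (ℝ × ℝ) => (w.1, w.2.1)) (by fun_prop)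
    have a2 : Continuous fun w : ℝ × (ℝ × ℝ) => osc w.1 w.2.2 :=
      continuous_osc.comp (f := fun w : ℝ × (ℝ × ℝ) => (w.1, w.2.2)) (by fun_prop)
    exact a1.mul (Complex.continuous_conj.comp a2)
  refine (h1.mul_bdd (c := 1) h2.aestronglyMeasurable
    (Eventually.of_forall fun w => ?_)).congr (Eventually.of_forall fun w => ?_)
  · simp [norm_osc]
  · simp only [oscPair, Function.uncurry, map_mul]
    ring

theorem integral_oscPair (T : ℝ) (g : ℝ → ℂ) (t : ℝ) :
    ∫ z, oscPair T g t z ∂(volume.prod volume) =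
      ((Real.exp (-(T ^ 2)⁻¹ * t ^ 2) * ‖∫ η, g η * osc t η‖ ^ 2 : ℝ) : ℂ) := by
  simp only [oscPair]
  rw [integral_const_mul,
    integral_prod_mul (fun η => g η * osc t η) (fun η => starRingEnd ℂ (g η * osc t η)),
    integral_conj, Complex.mul_conj, Complex.normSq_eq_norm_sq]
  push_cast
  ring

/-- Writing the squared modulus as a double frequency integral makes it possible to integrate in
time first, by Fubini. -/
theorem lintegral_gaussian_sq_norm_eq {T : ℝ} (hT : 0 < T) {g : ℝ → ℂ} (hg : Integrable g) :
    ∫⁻ t, ENNReal.ofReal (Real.exp (-(T ^ 2)⁻¹ * t ^ 2)) * ‖∫ η, g η * osc t η‖ₑ ^ 2 =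
      ‖∫ t, ∫ z, oscPair T g t z ∂(volume.prod volume)‖ₑ := by
  have hI : Integrable (fun t => Real.exp (-(T ^ 2)⁻¹ * t ^ 2) * ‖∫ η, g η * osc t η‖ ^ 2) := by
    have h := (integrable_oscPair hT hg).integral_prod_left
    have h2 := h.re
    refine h2.congr (Eventually.of_forall fun t => ?_)
    simp only [Function.uncurry]
    rw [integral_oscPair]
    exact Complex.ofReal_re _
  have hpos : ∀ t, 0 ≤ Real.exp (-(T ^ 2)⁻¹ * t ^ 2) * ‖∫ η, g η * osc t η‖ ^ 2 :=
    fun t => by positivity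
  simp_rw [integral_oscPair]
  rw [integral_complex_ofReal, ← ofReal_norm, Complex.norm_real, Real.norm_eq_abs,
    abs_of_nonneg (integral_nonneg hpos),
    ofReal_integral_eq_lintegral_ofReal hI (Eventually.of_forall hpos)]
  refine lintegral_congr fun t => ?_
  rw [ENNReal.ofReal_mul (Real.exp_nonneg _), ENNReal.ofReal_pow (norm_nonneg _),
    ofReal_norm]

theorem enorm_integral_oscPair_le {T : ℝ} (hT : 0 < T) (g : ℝ → ℂ) (z : ℝ × ℝ) :
    ‖∫ t, oscPair T g t z‖ₑ ≤
      ‖g z.1‖ₑ * ‖g z.2‖ₑ * ENNReal.ofReal (oscKernel T z.1 z.2) := by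
  have : ∀ t, oscPair T g t z = (g z.1 * starRingEnd ℂ (g z.2)) *
      ((Real.exp (-(T ^ 2)⁻¹ * t ^ 2) : ℂ) * (osc t z.1 * starRingEnd ℂ (osc t z.2))) := by
    intro t
    simp only [oscPair, map_mul]
    ring
  simp_rw [this]
  rw [integral_const_mul, enorm_mul, enorm_mul, RCLike.enorm_conj]
  gcongr
  rw [← ofReal_norm]
  exact ENNReal.ofReal_le_ofReal (norm_integral_gaussian_osc_le hT z.1 z.2)

theorem lintegral_prod_oscKernel (T : ℝ) {G : ℝ → ℝ≥0∞} (hG : Measurable G) :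
    ∫⁻ z : ℝ × ℝ, G z.1 * ENNReal.ofReal (oscKernel T z.1 z.2) ∂(volume.prod volume) =
      ∫⁻ η, G η * oscMass T η := by
  have hkm : Measurable fun z : ℝ × ℝ => ENNReal.ofReal (oscKernel T z.1 z.2) :=
    (measurable_oscKernel T).ennreal_ofReal
  have hm : Measurable fun z : ℝ × ℝ => G z.1 * ENNReal.ofReal (oscKernel T z.1 z.2) :=
    (hG.comp measurable_fst).mul hkm
  rw [lintegral_prod _ hm.aemeasurable]
  refine lintegral_congr fun η => ?_
  rw [oscMass]
  have hη : Measurable fun η' => ENNReal.ofReal (oscKernel T η η') := by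
    unfold oscKernel
    fun_prop
  exact lintegral_const_mul (G η) hη

theorem lintegral_prod_oscKernel_symm (T : ℝ) {G : ℝ → ℝ≥0∞} (hG : Measurable G) :
    ∫⁻ z : ℝ × ℝ, G z.2 * ENNReal.ofReal (oscKernel T z.1 z.2) ∂(volume.prod volume) =
      ∫⁻ η, G η * oscMass T η := by
  have hkm : Measurable fun z : ℝ × ℝ => ENNReal.ofReal (oscKernel T z.1 z.2) :=
    (measurable_oscKernel T).ennreal_ofReal
  have hm : Measurable fun z : ℝ × ℝ => G z.2 * ENNReal.ofReal (oscKernel T z.1 z.2) :=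
    (hG.comp measurable_snd).mul hkm
  rw [lintegral_prod_symm _ hm.aemeasurable]
  refine lintegral_congr fun η => ?_
  have hc : ∀ x, oscKernel T x η = oscKernel T η x := fun x => oscKernel_comm T x η
  simp only [hc]
  rw [oscMass]
  have hη : Measurable fun η' => ENNReal.ofReal (oscKernel T η η') := by
    unfold oscKernel
    fun_prop
  exact lintegral_const_mul (G η) hη

/-- Schur's test in the continuous variable: once the time integral has become the symmetric kernel,
`|g||g'| ≤ |g|² + |g'|²` leaves only its marginal `oscMass`. -/
theorem lintegral_gaussian_sq_norm_le {T : ℝ} (hT : 0 < T) {g : ℝ → ℂ} (hg : Integrable g)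
    (hgm : Measurable g) :
    ∫⁻ t, ENNReal.ofReal (Real.exp (-(T ^ 2)⁻¹ * t ^ 2)) * ‖∫ η, g η * osc t η‖ₑ ^ 2 ≤
      2 * ∫⁻ η, ‖g η‖ₑ ^ 2 * oscMass T η := by
  rw [lintegral_gaussian_sq_norm_eq hT hg, integral_integral_swap (integrable_oscPair hT hg)]
  refine (enorm_integral_le_lintegral_enorm _).trans
    ((lintegral_mono (enorm_integral_oscPair_le hT g)).trans ?_)
  have hG : Measurable fun η => ‖g η‖ₑ ^ 2 := hgm.enorm.pow_const 2
  have hkm : Measurable fun z : ℝ × ℝ => ENNReal.ofReal (oscKernel T z.1 z.2) :=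
    (measurable_oscKernel T).ennreal_ofReal
  have h1 := lintegral_prod_oscKernel T hG
  have h2 := lintegral_prod_oscKernel_symm T hG
  rw [two_mul]
  nth_rw 1 [← h1]
  have hm : Measurable fun z : ℝ × ℝ => ‖g z.1‖ₑ ^ 2 * ENNReal.ofReal (oscKernel T z.1 z.2) :=
    (hG.comp measurable_fst).mul hkm
  rw [← h2, ← lintegral_add_left hm]
  refine lintegral_mono fun z => ?_
  rw [← add_mul]
  exact mul_le_mul_left (ennreal_mul_le_sq_add_sq _ _) _

theorem lintegral_gaussian_shift {b : ℝ} (hb : 0 < b) (c : ℝ) :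
    ∫⁻ x : ℝ, ENNReal.ofReal (Real.exp (-b * (x + c) ^ 2)) =
      ENNReal.ofReal (Real.sqrt (Real.pi / b)) := by
  rw [lintegral_add_right_eq_self (fun x => ENNReal.ofReal (Real.exp (-b * x ^ 2))) c,
    ← ofReal_integral_eq_lintegral_ofReal (integrable_exp_neg_mul_sq hb)
      (Eventually.of_forall fun x => Real.exp_nonneg _), integral_gaussian]

/-- If the kernel is dominated by Gaussians centred at `±η`, its mass is controlled. -/
theorem oscMass_le_of_le {T : ℝ} (hT : 0 < T) {η b A : ℝ} (hb : 0 < b) (hA : 0 ≤ A)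
    (h : ∀ x y : ℝ, |x| ≤ |y| → |η| ≤ |y| →
      Real.exp (-(T * (x * y)) ^ 2) ≤ A * Real.exp (-b * x ^ 2)) :
    oscMass T η ≤ ENNReal.ofReal (2 * A * (Real.pi * T / Real.sqrt b)) := by
  have hpt : ∀ η', ENNReal.ofReal (oscKernel T η η') ≤ ENNReal.ofReal (Real.sqrt Real.pi * T * A) *
      (ENNReal.ofReal (Real.exp (-b * (η' + η) ^ 2)) +
        ENNReal.ofReal (Real.exp (-b * (η' + -η) ^ 2))) := by
    intro η'
    rw [← ENNReal.ofReal_add (Real.exp_nonneg _) (Real.exp_nonneg _),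
      ← ENNReal.ofReal_mul (by positivity)]
    refine ENNReal.ofReal_le_ofReal ?_
    rw [oscKernel, mul_assoc (Real.sqrt Real.pi * T) A]
    refine mul_le_mul_of_nonneg_left ?_ (by positivity)
    have e1 := Real.exp_nonneg (-b * (η' + η) ^ 2)
    have e2 := Real.exp_nonneg (-b * (η' + -η) ^ 2)
    -- `η² - η'²` is, up to sign, the product of `η' + η` and `η' - η`. The larger factor has size
    -- at least `|η|` because the two sizes add up to at least `2|η|`; the smaller one takes the
    -- role of `x`.
    rcases le_total |η' + η| |η' + -η| with hle | hle
    · have : |η| ≤ |η' + -η| := by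
        have h1 : 2 * |η| ≤ |η' + η| + |η' + -η| := by
          rw [← abs_two, ← abs_mul]
          refine le_trans (le_of_eq ?_) (abs_sub _ _)
          congr 1; ring
        linarith
      have := h _ _ hle this
      rw [show η ^ 2 - η' ^ 2 = -((η' + η) * (η' + -η)) by ring, mul_neg, neg_sq]
      nlinarith
    · have : |η| ≤ |η' + η| := by
        have h1 : 2 * |η| ≤ |η' + η| + |η' + -η| := by
          rw [← abs_two, ← abs_mul]
          refine le_trans (le_of_eq ?_) (abs_sub _ _)
          congr 1; ring
        linarith
      have := h _ _ hle this
      rw [show η ^ 2 - η' ^ 2 = -((η' + -η) * (η' + η)) by ring, mul_neg, neg_sq]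
      nlinarith
  refine (lintegral_mono hpt).trans (le_of_eq ?_)
  rw [lintegral_const_mul _ (by fun_prop), lintegral_add_left (by fun_prop),
    lintegral_gaussian_shift hb, lintegral_gaussian_shift hb,
    ← ENNReal.ofReal_add (Real.sqrt_nonneg _) (Real.sqrt_nonneg _),
    ← ENNReal.ofReal_mul (by positivity), Real.sqrt_div Real.pi_pos.le]
  congr 1
  have := Real.mul_self_sqrt Real.pi_pos.le
  have hs : Real.sqrt b ≠ 0 := (Real.sqrt_pos.2 hb).ne'
  field_simp
  nlinarith

/-- From `|y| ≥ |x|` and `(Tx² - 1/2)² ≥ 0` follows `(Txy)² ≥ (Tx²)² ≥ Tx² - 1/4`: a Gaussian of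
width `T^{-1/2}`, uniformly in `η`. -/
theorem oscMass_le_sqrt {T : ℝ} (hT : 0 < T) (η : ℝ) :
    oscMass T η ≤ ENNReal.ofReal (4 * Real.pi * Real.sqrt T) := by
  refine (oscMass_le_of_le hT (b := T) (A := 2) hT (by norm_num) ?_).trans (le_of_eq ?_)
  · intro x y hxy _
    have h1 : Real.exp (-(T * (x * y)) ^ 2) ≤ Real.exp (1 / 4) * Real.exp (-T * x ^ 2) := by
      rw [← Real.exp_add]
      apply Real.exp_le_exp.2
      have : x ^ 2 ≤ y ^ 2 := sq_le_sq.2 hxy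
      have h2 : x ^ 2 * x ^ 2 ≤ x ^ 2 * y ^ 2 := mul_le_mul_of_nonneg_left this (sq_nonneg x)
      have h3 : T ^ 2 * (x ^ 2 * x ^ 2) ≤ T ^ 2 * (x ^ 2 * y ^ 2) :=
        mul_le_mul_of_nonneg_left h2 (sq_nonneg T)
      nlinarith [sq_nonneg (T * x ^ 2 - 1 / 2)]
    have h2 : Real.exp (1 / 4) ≤ 2 := by
      have := Real.exp_one_lt_d9
      have h4 : Real.exp (1 / 4) ^ 4 = Real.exp 1 := by
        rw [← Real.exp_nat_mul]; norm_num
      by_contra hc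
      push Not at hc
      have : (2 : ℝ) ^ 4 < Real.exp (1 / 4) ^ 4 := pow_lt_pow_left₀ hc (by norm_num) (by norm_num)
      rw [h4] at this
      linarith
    exact h1.trans (mul_le_mul_of_nonneg_right h2 (Real.exp_nonneg _))
  · congr 1
    have := Real.mul_self_sqrt hT.le
    have hs : Real.sqrt T ≠ 0 := (Real.sqrt_pos.2 hT).ne'
    field_simp
    nlinarith

/-- Here `|y| ≥ |η|` is used instead, giving width `1/(T|η|)`; the prefactor `T` of the kernel
cancels. -/
theorem oscMass_le_inv {T : ℝ} (hT : 0 < T) {η : ℝ} (hη : η ≠ 0) :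
    oscMass T η ≤ ENNReal.ofReal (4 * Real.pi / |η|) := by
  refine (oscMass_le_of_le hT (b := (T * |η|) ^ 2) (A := 1) (by positivity) (by norm_num)
    ?_).trans ?_
  · intro x y _ hy
    rw [one_mul]
    apply Real.exp_le_exp.2
    have h1 : |η| ^ 2 ≤ y ^ 2 := by rw [sq_abs]; exact sq_le_sq.2 hy
    have h2 : (T * x) ^ 2 * |η| ^ 2 ≤ (T * x) ^ 2 * y ^ 2 :=
      mul_le_mul_of_nonneg_left h1 (sq_nonneg _)
    nlinarith
  · apply ENNReal.ofReal_le_ofReal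
    rw [Real.sqrt_sq (by positivity)]
    have : 0 < |η| := abs_pos.2 hη
    rw [show 2 * 1 * (Real.pi * T / (T * |η|)) = 2 * Real.pi / |η| by field_simp]
    gcongr
    norm_num

/-! ### From the `L⁴` norm of a free wave to a bilinear frequency integral -/

theorem lintegral_enorm_sq (f : L2) : ∫⁻ x, ‖f x‖ₑ ^ 2 = ‖f‖ₑ ^ 2 := by
  rw [Lp.enorm_def, eLpNorm_eq_lintegral_rpow_enorm_toReal (by norm_num) (by norm_num)]
  simp only [ENNReal.toReal_ofNat, ENNReal.rpow_ofNat, one_div]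
  rw [← ENNReal.rpow_natCast, ← ENNReal.rpow_mul]
  norm_num

/-- Plancherel for the square of a function with integrable Fourier transform. -/
theorem lintegral_fourierInv_pow_four_le {h : ℝ → ℂ} (hh : Integrable h) :
    ∫⁻ x, ‖𝓕⁻ h x‖ₑ ^ 4 ≤ ∫⁻ σ, ‖∫ s, h s * h (σ - s)‖ₑ ^ 2 := by
  set G : ℝ → ℂ := fun σ => ∫ s, h s * h (σ - s) with hG
  have hGconv : G = MeasureTheory.convolution h h (ContinuousLinearMap.mul ℂ ℂ) volume := rfl
  have hGi : Integrable G := hGconv ▸ hh.integrable_convolution _ hh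
  -- The self-convolution of an integrable function need not be square integrable; in that case the
  -- right side is infinite.
  rcases eq_or_ne (∫⁻ σ, ‖G σ‖ₑ ^ 2) ∞ with htop | htop
  · rw [htop]; exact le_top
  have hG2 : MemLp G 2 volume := by
    refine ⟨hGi.aestronglyMeasurable, ?_⟩
    rw [eLpNorm_lt_top_iff_lintegral_rpow_enorm_lt_top (by norm_num) (by norm_num)]
    simpa using htop.lt_top
  set g : L2 := hG2.toLp with hg
  have hgG : (g : ℝ → ℂ) =ᵐ[volume] G := hG2.coeFn_toLp
  have hF : (𝓕⁻ g : L2) =ᵐ[volume] fun x => 𝓕⁻ h x ^ 2 := by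
    refine (coeFn_fourierInv g (hGi.congr hgG.symm)).trans (Eventually.of_forall fun x => ?_)
    simp only [Real.fourierInv_eq_fourier_neg]
    have h1 : 𝓕 (g : ℝ → ℂ) (-x) = 𝓕 G (-x) := by
      rw [Real.fourier_eq, Real.fourier_eq]
      refine integral_congr_ae ?_
      filter_upwards [hgG] with y hy
      rw [hy]
    rw [h1, hGconv, Real.fourier_mul_convolution_eq hh hh, sq]
  have hn : ‖(𝓕⁻ g : L2)‖ = ‖g‖ := by
    rw [← Lp.norm_fourier_eq, FourierTransform.fourier_fourierInv_eq]
  refine le_of_eq ?_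
  calc ∫⁻ x, ‖𝓕⁻ h x‖ₑ ^ 4 = ∫⁻ x, ‖(𝓕⁻ g : L2) x‖ₑ ^ 2 := by
        refine lintegral_congr_ae ?_
        filter_upwards [hF] with x hx
        rw [hx, enorm_pow, ← pow_mul]
    _ = ∫⁻ σ, ‖g σ‖ₑ ^ 2 := by
        rw [lintegral_enorm_sq, lintegral_enorm_sq, ← ofReal_norm, ← ofReal_norm, hn]
    _ = ∫⁻ σ, ‖G σ‖ₑ ^ 2 := by
        refine lintegral_congr_ae ?_
        filter_upwards [hgG] with x hx
        rw [hx]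

/-- The free Schrödinger evolution on the Fourier side. -/
def evolve (t : ℝ) (h : ℝ → ℂ) (ξ : ℝ) : ℂ := schrodingerSymbol t ξ * h ξ

theorem norm_schrodingerSymbol (t ξ : ℝ) : ‖schrodingerSymbol t ξ‖ = 1 :=
  Complex.norm_exp_ofReal_mul_I _

theorem integrable_evolve (t : ℝ) {h : ℝ → ℂ} (hh : Integrable h) : Integrable (evolve t h) :=
  hh.bdd_mul (measurable_schrodingerSymbol t).aestronglyMeasurable
    (Eventually.of_forall fun ξ => (norm_schrodingerSymbol t ξ).le)

/-- With `s = σ/2 + η` one has `s² + (σ - s)² = σ²/2 + 2η²`, so the part of the phase depending on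
`σ` is a unimodular constant. -/
theorem enorm_integral_evolve_mul (t : ℝ) (h : ℝ → ℂ) (σ : ℝ) :
    ‖∫ s, evolve t h s * evolve t h (σ - s)‖ₑ =
      ‖∫ η, (h (η + σ / 2) * h (σ / 2 - η)) * osc t η‖ₑ := by
  rw [← integral_add_right_eq_self _ (σ / 2)]
  have : ∀ η, evolve t h (η + σ / 2) * evolve t h (σ - (η + σ / 2)) =
      Complex.exp ((-(2 * Real.pi ^ 2 * t * σ ^ 2) : ℝ) * Complex.I) *
        ((h (η + σ / 2) * h (σ / 2 - η)) * osc t η) := by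
    intro η
    rw [show σ - (η + σ / 2) = σ / 2 - η by ring, evolve, evolve, schrodingerSymbol,
      schrodingerSymbol, osc]
    have : Complex.exp (((-(t * (2 * Real.pi * (η + σ / 2)) ^ 2) : ℝ) : ℂ) * Complex.I) *
        Complex.exp (((-(t * (2 * Real.pi * (σ / 2 - η)) ^ 2) : ℝ) : ℂ) * Complex.I) =
        Complex.exp (((-(2 * Real.pi ^ 2 * t * σ ^ 2) : ℝ) : ℂ) * Complex.I) *
        Complex.exp (((-(8 * Real.pi ^ 2 * t * η ^ 2) : ℝ) : ℂ) * Complex.I) := by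
      rw [← Complex.exp_add, ← Complex.exp_add]
      congr 1
      push_cast
      ring
    linear_combination (h (η + σ / 2) * h (σ / 2 - η)) * this
  simp_rw [this]
  rw [integral_const_mul, enorm_mul, ← ofReal_norm, Complex.norm_exp_ofReal_mul_I]
  simp

theorem lintegral_evolve_le {h : ℝ → ℂ} (hm : Measurable h) (hi : Integrable h)
    (h2 : MemLp h 2 volume) {T : ℝ} (hT : 0 < T) :
    ∫⁻ t in Set.Icc 0 T, ∫⁻ x, ‖𝓕⁻ (evolve t h) x‖ₑ ^ 4 ≤
      6 * ∫⁻ σ, ∫⁻ η, (‖h (η + σ / 2)‖ₑ ^ 2 * ‖h (σ / 2 - η)‖ₑ ^ 2) * oscMass T η := by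
  set W : ℝ → ℝ → ℝ≥0∞ := fun t σ =>
    ‖∫ η, (h (η + σ / 2) * h (σ / 2 - η)) * osc t η‖ₑ ^ 2 with hW
  have hWm : Measurable (Function.uncurry W) := by
    have h1 : StronglyMeasurable fun w : (ℝ × ℝ) × ℝ =>
        (h (w.2 + w.1.2 / 2) * h (w.1.2 / 2 - w.2)) * osc w.1.1 w.2 := by
      refine Measurable.stronglyMeasurable ?_
      have a1 : Measurable fun w : (ℝ × ℝ) × ℝ => h (w.2 + w.1.2 / 2) := hm.comp (by fun_prop)
      have a2 : Measurable fun w : (ℝ × ℝ) × ℝ => h (w.1.2 / 2 - w.2) := hm.comp (by fun_prop)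
      have a3 : Measurable fun w : (ℝ × ℝ) × ℝ => osc w.1.1 w.2 := by
        unfold osc
        fun_prop
      exact (a1.mul a2).mul a3
    have h3 := h1.integral_prod_right' (ν := (volume : Measure ℝ))
    exact h3.measurable.enorm.pow_const 2
  set ψ : ℝ → ℝ≥0∞ := fun t => ENNReal.ofReal (Real.exp (-(T ^ 2)⁻¹ * t ^ 2)) with hψ
  have hψm : Measurable ψ := by
    simp only [hψ]
    fun_prop
  have hpoint : ∀ t ∈ Set.Icc 0 T, ∫⁻ x, ‖𝓕⁻ (evolve t h) x‖ₑ ^ 4 ≤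
      3 * ∫⁻ σ, ψ t * W t σ := by
    intro t ht
    refine (lintegral_fourierInv_pow_four_le (integrable_evolve t hi)).trans ?_
    simp_rw [enorm_integral_evolve_mul]
    -- On `[0, T]` the Gaussian is at least `1/e ≥ 1/3`, so it replaces the sharp cutoff at the cost
    -- of a factor `3`.
    have hc : 1 ≤ 3 * ψ t := by
      have : (1 : ℝ) ≤ 3 * Real.exp (-(T ^ 2)⁻¹ * t ^ 2) := by
        have h1 : Real.exp (-1) ≤ Real.exp (-(T ^ 2)⁻¹ * t ^ 2) := by
          apply Real.exp_le_exp.2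
          have : t ^ 2 ≤ T ^ 2 := pow_le_pow_left₀ ht.1 ht.2 2
          have h5 : (T ^ 2)⁻¹ * t ^ 2 ≤ (T ^ 2)⁻¹ * T ^ 2 :=
            mul_le_mul_of_nonneg_left this (by positivity)
          rw [inv_mul_cancel₀ (by positivity)] at h5
          linarith
        have h2 : Real.exp 1 ≤ 3 := by have := Real.exp_one_lt_d9; linarith
        have h3 : Real.exp 1 * Real.exp (-1) = 1 := by rw [← Real.exp_add]; simp
        nlinarith [Real.exp_pos (-1)]
      have := ENNReal.ofReal_le_ofReal this
      rwa [ENNReal.ofReal_one, ENNReal.ofReal_mul (by norm_num), ENNReal.ofReal_ofNat] at this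
    have hWt : Measurable fun σ => W t σ := hWm.of_uncurry_left
    rw [lintegral_const_mul (ψ t) hWt, ← mul_assoc]
    calc ∫⁻ σ, W t σ = 1 * ∫⁻ σ, W t σ := (one_mul _).symm
      _ ≤ _ := mul_le_mul_left hc _
  have hWψ : Measurable (Function.uncurry fun t σ => ψ t * W t σ) :=
    (hψm.comp measurable_fst).mul hWm
  calc ∫⁻ t in Set.Icc 0 T, ∫⁻ x, ‖𝓕⁻ (evolve t h) x‖ₑ ^ 4
      ≤ ∫⁻ t in Set.Icc 0 T, 3 * ∫⁻ σ, ψ t * W t σ :=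
        setLIntegral_mono' measurableSet_Icc hpoint
    _ ≤ ∫⁻ t, 3 * ∫⁻ σ, ψ t * W t σ := setLIntegral_le_lintegral _ _
    _ = 3 * ∫⁻ σ, ∫⁻ t, ψ t * W t σ := by
        rw [lintegral_const_mul' _ _ (by norm_num), lintegral_lintegral_swap hWψ.aemeasurable]
    _ ≤ 3 * ∫⁻ σ, 2 * ∫⁻ η, (‖h (η + σ / 2)‖ₑ ^ 2 * ‖h (σ / 2 - η)‖ₑ ^ 2) * oscMass T η := by
        refine mul_le_mul_right (lintegral_mono fun σ => ?_) _
        have hgm : Measurable fun η => h (η + σ / 2) * h (σ / 2 - η) := by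
          have a1 : Measurable fun η : ℝ => h (η + σ / 2) := hm.comp (by fun_prop)
          have a2 : Measurable fun η : ℝ => h (σ / 2 - η) := hm.comp (by fun_prop)
          exact a1.mul a2
        have hgi : Integrable fun η => h (η + σ / 2) * h (σ / 2 - η) := by
          have a1 : MemLp (fun η : ℝ => h (η + σ / 2)) 2 volume :=
            h2.comp_measurePreserving (measurePreserving_add_right volume (σ / 2))
          have a2 : MemLp (fun η : ℝ => h (σ / 2 - η)) 2 volume :=
            h2.comp_measurePreserving (Measure.measurePreserving_sub_left volume (σ / 2))
          exact a1.integrable_mul a2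
        refine (lintegral_gaussian_sq_norm_le hT hgi hgm).trans (le_of_eq ?_)
        simp_rw [enorm_mul, mul_pow]
    _ = _ := by
        rw [lintegral_const_mul' _ _ (by norm_num), ← mul_assoc]
        norm_num

/-- The change of variables `x = σ/2 + η`, `y = σ/2 - η` has Jacobian one and `η = (x - y)/2`; it
returns to the two original frequencies. -/
theorem lintegral_midpoint_change {f : ℝ → ℝ≥0∞} (hf : Measurable f) {k : ℝ → ℝ≥0∞}
    (hk : Measurable k) :
    ∫⁻ σ, ∫⁻ η, (f (η + σ / 2) * f (σ / 2 - η)) * k η =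
      ∫⁻ x, ∫⁻ y, (f x * f y) * k ((x - y) / 2) := by
  have h1 : ∀ σ, ∫⁻ η, (f (η + σ / 2) * f (σ / 2 - η)) * k η =
      ∫⁻ x, (f x * f (σ - x)) * k (x - σ / 2) := by
    intro σ
    conv_rhs => rw [← lintegral_add_right_eq_self _ (σ / 2)]
    refine lintegral_congr fun η => ?_
    rw [show σ - (η + σ / 2) = σ / 2 - η by ring, add_sub_cancel_right]
  simp_rw [h1]
  rw [lintegral_lintegral_swap]
  · refine lintegral_congr fun x => ?_
    rw [← lintegral_add_right_eq_self _ x]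
    refine lintegral_congr fun y => ?_
    rw [add_sub_cancel_right, show x - (y + x) / 2 = (x - y) / 2 by ring]
  · refine Measurable.aemeasurable ?_
    have a1 : Measurable fun w : ℝ × ℝ => f w.2 := hf.comp (by fun_prop)
    have a2 : Measurable fun w : ℝ × ℝ => f (w.1 - w.2) := hf.comp (by fun_prop)
    have a3 : Measurable fun w : ℝ × ℝ => k (w.2 - w.1 / 2) := hk.comp (by fun_prop)
    exact (a1.mul a2).mul a3

/-! ### Interaction of frequency cells and Schur's test -/

/-- The frequency cell of `□_k`, in the variable `ξ` with angular frequency `2 π ξ`. -/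
def cell (k : ℤ) : Set ℝ := {ξ | 2 * Real.pi * ξ ∈ Set.Icc ((k : ℝ) - 1 / 2) ((k : ℝ) + 1 / 2)}

theorem measurableSet_cell (k : ℤ) : MeasurableSet (cell k) :=
  (measurable_const.mul measurable_id) measurableSet_Icc

/-- The weight `max(1, |m|)^{-(1 - 2δ)}`. -/
def cellWeight (δ : ℝ) (m : ℤ) : ℝ := (max 1 |(m : ℝ)|) ^ (-(1 - 2 * δ))

theorem cellWeight_nonneg (δ : ℝ) (m : ℤ) : 0 ≤ cellWeight δ m := by
  unfold cellWeight
  positivity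

theorem cellWeight_neg (δ : ℝ) (m : ℤ) : cellWeight δ (-m) = cellWeight δ m := by
  simp [cellWeight]

/-- For `m = |k - l| ≥ 2` both bounds on the mass apply, and `min(√T, 1/m) ≤ (√T)^{2δ} m^{-(1-2δ)}`.
For equal or adjacent cells only `√T ≤ T^δ` is available, and it suffices. -/
theorem oscMass_cell_le {δ : ℝ} (hδ : 0 < δ) (hδ' : δ ≤ 1 / 2) {T : ℝ} (hT : 0 < T) (hT1 : T ≤ 1)
    {k l : ℤ} {x y : ℝ} (hx : x ∈ cell k) (hy : y ∈ cell l) :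
    oscMass T ((x - y) / 2) ≤
      ENNReal.ofReal (32 * Real.pi ^ 2 * T ^ δ * cellWeight δ (k - l)) := by
  have hπ := Real.pi_gt_three
  have hsqrt : Real.sqrt T ≤ T ^ δ := by
    rw [Real.sqrt_eq_rpow]
    exact Real.rpow_le_rpow_of_exponent_ge hT hT1 hδ'
  have hsqrt0 := Real.sqrt_nonneg T
  have hTδ : 0 < T ^ δ := Real.rpow_pos_of_pos hT δ
  rcases le_or_gt |(((k - l : ℤ)) : ℝ)| 1 with hkl | hkl
  · refine (oscMass_le_sqrt hT _).trans (ENNReal.ofReal_le_ofReal ?_)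
    rw [cellWeight, max_eq_left hkl, Real.one_rpow, mul_one]
    have : 4 * Real.pi ≤ 32 * Real.pi ^ 2 := by nlinarith
    exact mul_le_mul this hsqrt hsqrt0 (by positivity)
  · set m : ℝ := |(((k - l : ℤ)) : ℝ)| with hm
    have hm2 : 2 ≤ m := by
      rw [hm, ← Int.cast_abs] at hkl ⊢
      have : (1 : ℤ) < |k - l| := by exact_mod_cast hkl
      exact_mod_cast this
    -- The cells have angular half-width `1/2`, so `2π|x - y| ≥ m - 1 ≥ m/2`; this is where `m ≥ 2`
    -- enters.
    have hdist : m ≤ 8 * Real.pi * |(x - y) / 2| := by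
      have h1 : m ≤ 2 * Real.pi * |x - y| + 1 := by
        obtain ⟨hx1, hx2⟩ := hx
        obtain ⟨hy1, hy2⟩ := hy
        rw [hm, show 2 * Real.pi * |x - y| = |2 * Real.pi * x - 2 * Real.pi * y| by
          rw [← mul_sub, abs_mul, abs_of_pos (by positivity : (0 : ℝ) < 2 * Real.pi)]]
        push_cast
        have := abs_sub_abs_le_abs_sub ((k : ℝ) - l) (2 * Real.pi * x - 2 * Real.pi * y)
        have h3 : |((k : ℝ) - l) - (2 * Real.pi * x - 2 * Real.pi * y)| ≤ 1 := by
          rw [abs_le]; constructor <;> linarith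
        linarith
      rw [abs_div, abs_two]
      linarith
    have hpos : 0 < |(x - y) / 2| := by
      by_contra h
      have h0 : |(x - y) / 2| = 0 := le_antisymm (not_lt.1 h) (abs_nonneg _)
      rw [h0, mul_zero] at hdist
      linarith
    have hne : (x - y) / 2 ≠ 0 := abs_pos.1 hpos
    have hm0 : 0 < m := by linarith
    have hinv : 4 * Real.pi / |(x - y) / 2| ≤ 32 * Real.pi ^ 2 / m := by
      rw [div_le_div_iff₀ hpos hm0]
      nlinarith
    have hw : cellWeight δ (k - l) = m ^ (-(1 - 2 * δ)) := by
      rw [cellWeight, ← hm, max_eq_right hkl.le]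
    have hw2 : m⁻¹ ≤ m ^ (-(1 - 2 * δ)) := by
      rw [← Real.rpow_neg_one]
      exact Real.rpow_le_rpow_of_exponent_le hkl.le (by linarith)
    rw [hw]
    rcases le_total (Real.sqrt T) (m⁻¹) with hc | hc
    · refine (oscMass_le_sqrt hT _).trans (ENNReal.ofReal_le_ofReal ?_)
      have h1 : Real.sqrt T ≤ T ^ δ * m ^ (-(1 - 2 * δ)) := by
        calc Real.sqrt T = Real.sqrt T ^ (2 * δ) * Real.sqrt T ^ (1 - 2 * δ) := by
              rw [← Real.rpow_add (Real.sqrt_pos.2 hT)]; simp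
          _ ≤ T ^ δ * (m⁻¹) ^ (1 - 2 * δ) := by
              rw [Real.sqrt_eq_rpow, ← Real.rpow_mul hT.le, ← Real.sqrt_eq_rpow,
                show 1 / 2 * (2 * δ) = δ by ring]
              gcongr
              linarith
          _ = _ := by rw [Real.inv_rpow hm0.le, Real.rpow_neg hm0.le]
      rw [mul_assoc (32 * Real.pi ^ 2)]
      refine mul_le_mul ?_ h1 hsqrt0 (by positivity)
      nlinarith
    · refine (oscMass_le_inv hT hne).trans (ENNReal.ofReal_le_ofReal (hinv.trans ?_))
      have h1 : m⁻¹ ≤ T ^ δ * m ^ (-(1 - 2 * δ)) := by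
        calc m⁻¹ = (m⁻¹) ^ (2 * δ) * (m⁻¹) ^ (1 - 2 * δ) := by
              rw [← Real.rpow_add (inv_pos.2 hm0)]; simp
          _ ≤ Real.sqrt T ^ (2 * δ) * (m⁻¹) ^ (1 - 2 * δ) := by gcongr
          _ = _ := by
              rw [Real.inv_rpow hm0.le (1 - 2 * δ), Real.rpow_neg hm0.le, Real.sqrt_eq_rpow,
                ← Real.rpow_mul hT.le, show 1 / 2 * (2 * δ) = δ by ring]
      rw [mul_assoc (32 * Real.pi ^ 2), div_eq_mul_inv]
      exact mul_le_mul_of_nonneg_left h1 (by positivity)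

theorem summable_max_one_abs_rpow {b : ℝ} (hb : 1 < b) :
    Summable fun m : ℤ => (max 1 |(m : ℝ)|) ^ (-b) := by
  have h1 := Real.summable_abs_int_rpow hb
  have h2 : Summable fun m : ℤ => if m = 0 then (1 : ℝ) else 0 :=
    summable_of_ne_finset_zero (s := {0}) (by intro m hm; simpa using hm)
  refine Summable.of_nonneg_of_le (fun m => by positivity) (fun m => ?_) (h1.add h2)
  rcases eq_or_ne m 0 with rfl | hm
  · simp only [Int.cast_zero, abs_zero, if_true]
    rw [max_eq_left zero_le_one, Real.one_rpow]
    have := Real.rpow_nonneg (le_refl (0 : ℝ)) (-b)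
    linarith
  · have : (1 : ℝ) ≤ |(m : ℝ)| := by
      rw [← Int.cast_abs]; exact_mod_cast Int.one_le_abs hm
    rw [max_eq_right this, if_neg hm, add_zero]

/-- The weight is not summable, so with `N = |S|` one splits at `|m| = N`. Below `N`, a factor
`N^{5δ/2}` pays for raising the decay to the summable exponent `1 + δ/2`. Above `N`, each weight is
at most `N^{-(1-2δ)}` and there are at most `N` of them. No structure of `S` is needed. -/
theorem exists_sum_cellWeight_le {δ : ℝ} (hδ : 0 < δ) (hδ' : δ ≤ 1 / 2) :
    ∃ Z : ℝ, 0 < Z ∧ ∀ (S : Finset ℤ) (k : ℤ),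
      ∑ l ∈ S, cellWeight δ (k - l) ≤ Z * (S.card : ℝ) ^ (5 / 2 * δ) := by
  have hsum := summable_max_one_abs_rpow (b := 1 + δ / 2) (by linarith)
  set Z0 := ∑' m : ℤ, (max 1 |(m : ℝ)|) ^ (-(1 + δ / 2)) with hZ0
  have hZ0' : 0 ≤ Z0 := tsum_nonneg fun m => by positivity
  refine ⟨Z0 + 1, by linarith, fun S k => ?_⟩
  rcases S.eq_empty_or_nonempty with rfl | hS
  · simp only [Finset.sum_empty]
    positivity
  set N : ℝ := (S.card : ℝ) with hN
  have hN1 : 1 ≤ N := by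
    rw [hN]; exact_mod_cast hS.card_pos
  have hN0 : 0 < N := by linarith
  have hpt : ∀ m : ℤ, cellWeight δ m ≤
      N ^ (5 / 2 * δ) * (max 1 |(m : ℝ)|) ^ (-(1 + δ / 2)) + N ^ (-(1 - 2 * δ)) := by
    intro m
    have hM : 1 ≤ max 1 |(m : ℝ)| := le_max_left _ _
    have hM0 : 0 < max 1 |(m : ℝ)| := by linarith
    rcases le_total (max 1 |(m : ℝ)|) N with h | h
    · have : cellWeight δ m ≤ N ^ (5 / 2 * δ) * (max 1 |(m : ℝ)|) ^ (-(1 + δ / 2)) := by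
        rw [cellWeight, show -(1 - 2 * δ) = 5 / 2 * δ + -(1 + δ / 2) by ring,
          Real.rpow_add hM0]
        gcongr
      have := Real.rpow_nonneg hN0.le (-(1 - 2 * δ))
      linarith
    · have : cellWeight δ m ≤ N ^ (-(1 - 2 * δ)) :=
        Real.rpow_le_rpow_of_nonpos hN0 h (by linarith)
      have : 0 ≤ N ^ (5 / 2 * δ) * (max 1 |(m : ℝ)|) ^ (-(1 + δ / 2)) := by positivity
      linarith
  have h1 : ∑ l ∈ S, (max 1 |((k - l : ℤ) : ℝ)|) ^ (-(1 + δ / 2)) ≤ Z0 := by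
    have hinj : Function.Injective fun l : ℤ => k - l := sub_right_injective
    have := hsum.sum_le_tsum (S.map ⟨_, hinj⟩) (fun m _ => by positivity)
    rwa [Finset.sum_map] at this
  calc ∑ l ∈ S, cellWeight δ (k - l)
      ≤ ∑ l ∈ S, (N ^ (5 / 2 * δ) * (max 1 |((k - l : ℤ) : ℝ)|) ^ (-(1 + δ / 2)) +
          N ^ (-(1 - 2 * δ))) := Finset.sum_le_sum fun l _ => hpt (k - l)
    _ = N ^ (5 / 2 * δ) * ∑ l ∈ S, (max 1 |((k - l : ℤ) : ℝ)|) ^ (-(1 + δ / 2)) +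
          N * N ^ (-(1 - 2 * δ)) := by
        rw [Finset.sum_add_distrib, ← Finset.mul_sum, Finset.sum_const, nsmul_eq_mul]
    _ ≤ N ^ (5 / 2 * δ) * Z0 + N ^ (5 / 2 * δ) := by
        have h2 : N * N ^ (-(1 - 2 * δ)) ≤ N ^ (5 / 2 * δ) := by
          nth_rw 1 [← Real.rpow_one N]
          rw [← Real.rpow_add hN0]
          exact Real.rpow_le_rpow_of_exponent_le hN1 (by linarith)
        have := mul_le_mul_of_nonneg_left h1 (Real.rpow_nonneg hN0.le (5 / 2 * δ))
        linarith
    _ = _ := by ring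

/-- Schur's test for symmetric kernels on a finite set. -/
theorem sum_sum_mul_le_of_symm {ι : Type*} (S : Finset ι) (a : ι → ℝ≥0∞) (κ : ι → ι → ℝ≥0∞)
    (hκ : ∀ k l, κ k l = κ l k) (W : ℝ≥0∞) (hW : ∀ k ∈ S, ∑ l ∈ S, κ k l ≤ W) :
    ∑ k ∈ S, ∑ l ∈ S, a k * a l * κ k l ≤ 2 * W * ∑ k ∈ S, a k ^ 2 := by
  have h1 : ∑ k ∈ S, ∑ l ∈ S, a k ^ 2 * κ k l ≤ W * ∑ k ∈ S, a k ^ 2 := by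
    rw [Finset.mul_sum]
    refine Finset.sum_le_sum fun k hk => ?_
    rw [← Finset.mul_sum, mul_comm]
    exact mul_le_mul_left (hW k hk) _
  have h2 : ∑ k ∈ S, ∑ l ∈ S, a l ^ 2 * κ k l ≤ W * ∑ k ∈ S, a k ^ 2 := by
    rw [Finset.sum_comm]
    simp_rw [fun k l => hκ l k]
    exact h1
  calc ∑ k ∈ S, ∑ l ∈ S, a k * a l * κ k l
      ≤ ∑ k ∈ S, ∑ l ∈ S, (a k ^ 2 * κ k l + a l ^ 2 * κ k l) := by
        refine Finset.sum_le_sum fun k _ => Finset.sum_le_sum fun l _ => ?_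
        rw [← add_mul]
        exact mul_le_mul_left (ennreal_mul_le_sq_add_sq _ _) _
    _ ≤ _ := by
        simp_rw [Finset.sum_add_distrib]
        rw [mul_assoc, two_mul]
        exact add_le_add h1 h2

/-- Only the covering of the support by the cells matters here, so their common endpoints are
harmless. -/
theorem lintegral_mul_le_sum_cell {S : Finset ℤ} {f : ℝ → ℝ≥0∞} (hf : Measurable f)
    (hS : ∀ᵐ ξ, f ξ ≠ 0 → ∃ k ∈ S, ξ ∈ cell k) {φ : ℝ → ℝ≥0∞} (hφ : Measurable φ) :
    ∫⁻ ξ, f ξ * φ ξ ≤ ∑ k ∈ S, ∫⁻ ξ in cell k, f ξ * φ ξ := by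
  have hm : Measurable fun ξ => f ξ * φ ξ := hf.mul hφ
  simp_rw [← lintegral_indicator (measurableSet_cell _)]
  rw [← lintegral_finsetSum _ fun k _ => hm.indicator (measurableSet_cell k)]
  refine lintegral_mono_ae ?_
  filter_upwards [hS] with ξ hξ
  by_cases h0 : f ξ = 0
  · simp [h0]
  obtain ⟨k, hk, hkξ⟩ := hξ h0
  calc f ξ * φ ξ = (cell k).indicator (fun ξ => f ξ * φ ξ) ξ := by
        rw [Set.indicator_of_mem hkξ]
    _ ≤ _ := Finset.single_le_sum (f := fun k => (cell k).indicator (fun ξ => f ξ * φ ξ) ξ)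
        (fun _ _ => zero_le) hk

/-- Discretises the bilinear form: on each pair of cells the kernel is replaced by a bound depending
only on `k - l`. -/
theorem lintegral_cell_pair_le {δ : ℝ} (hδ : 0 < δ) (hδ' : δ ≤ 1 / 2) {T : ℝ} (hT : 0 < T)
    (hT1 : T ≤ 1) {S : Finset ℤ} {f : ℝ → ℝ≥0∞} (hf : Measurable f)
    (hS : ∀ᵐ ξ, f ξ ≠ 0 → ∃ k ∈ S, ξ ∈ cell k) :
    ∫⁻ x, ∫⁻ y, (f x * f y) * oscMass T ((x - y) / 2) ≤
      ∑ k ∈ S, ∑ l ∈ S, (∫⁻ x in cell k, f x) * (∫⁻ x in cell l, f x) *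
        ENNReal.ofReal (32 * Real.pi ^ 2 * T ^ δ * cellWeight δ (k - l)) := by
  have hM : Measurable fun w : ℝ × ℝ => f w.2 * oscMass T ((w.1 - w.2) / 2) := by
    have a1 : Measurable fun w : ℝ × ℝ => f w.2 := hf.comp (by fun_prop)
    have a2 : Measurable fun w : ℝ × ℝ => oscMass T ((w.1 - w.2) / 2) :=
      (measurable_oscMass T).comp (by fun_prop)
    exact a1.mul a2
  have hMx : ∀ x, Measurable fun y => f y * oscMass T ((x - y) / 2) := by
    intro x
    have a2 : Measurable fun y : ℝ => oscMass T ((x - y) / 2) :=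
      (measurable_oscMass T).comp (by fun_prop)
    exact hf.mul a2
  have hin : ∀ x, ∫⁻ y, (f x * f y) * oscMass T ((x - y) / 2) =
      f x * ∫⁻ y, f y * oscMass T ((x - y) / 2) := by
    intro x
    rw [← lintegral_const_mul _ (hMx x)]
    simp_rw [mul_assoc]
  simp_rw [hin]
  have hI : Measurable fun x => ∫⁻ y, f y * oscMass T ((x - y) / 2) :=
    Measurable.lintegral_prod_right hM
  refine (lintegral_mul_le_sum_cell hf hS hI).trans (Finset.sum_le_sum fun k _ => ?_)
  set c : ℤ → ℝ≥0∞ := fun l =>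
    ENNReal.ofReal (32 * Real.pi ^ 2 * T ^ δ * cellWeight δ (k - l)) with hc
  have hbound : ∀ x ∈ cell k, ∫⁻ y, f y * oscMass T ((x - y) / 2) ≤
      ∑ l ∈ S, (∫⁻ y in cell l, f y) * c l := by
    intro x hx
    have a2 : Measurable fun y : ℝ => oscMass T ((x - y) / 2) :=
      (measurable_oscMass T).comp (by fun_prop)
    refine (lintegral_mul_le_sum_cell hf hS a2).trans (Finset.sum_le_sum fun l _ => ?_)
    rw [← lintegral_mul_const _ hf]
    refine setLIntegral_mono' (measurableSet_cell l) fun y hy => ?_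
    exact mul_le_mul_right (oscMass_cell_le hδ hδ' hT hT1 hx hy) _
  calc ∫⁻ x in cell k, f x * ∫⁻ y, f y * oscMass T ((x - y) / 2)
      ≤ ∫⁻ x in cell k, f x * ∑ l ∈ S, (∫⁻ y in cell l, f y) * c l :=
        setLIntegral_mono' (measurableSet_cell k) fun x hx => mul_le_mul_right (hbound x hx) _
    _ = _ := by
        rw [lintegral_mul_const _ hf, Finset.mul_sum]
        exact Finset.sum_congr rfl fun l _ => (mul_assoc _ _ _).symm

/-- The `L⁴` estimate, with orthogonality over the frequency cells, for free Schrödinger waves. -/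
theorem exists_free_estimate {δ : ℝ} (hδ : 0 < δ) (hδ' : δ ≤ 1 / 2) :
    ∃ C : ℝ, 0 < C ∧ ∀ (T : ℝ), 0 < T → T ≤ 1 → ∀ (S : Finset ℤ) (h : ℝ → ℂ), Measurable h →
      Integrable h → MemLp h 2 volume → (∀ᵐ ξ, h ξ ≠ 0 → ∃ k ∈ S, ξ ∈ cell k) →
      ∫⁻ t in Set.Icc 0 T, ∫⁻ x, ‖𝓕⁻ (evolve t h) x‖ₑ ^ 4 ≤
        ENNReal.ofReal (C * T ^ δ * (S.card : ℝ) ^ (5 / 2 * δ)) *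
          ∑ k ∈ S, (∫⁻ ξ in cell k, ‖h ξ‖ₑ ^ 2) ^ 2 := by
  obtain ⟨Z, hZ, hZs⟩ := exists_sum_cellWeight_le hδ hδ'
  -- `12` is the `6` of `lintegral_evolve_le` times the `2` of the discrete Schur test.
  refine ⟨12 * (32 * Real.pi ^ 2 * Z), by positivity, fun T hT hT1 S h hm hi h2 hS => ?_⟩
  have hf : Measurable fun ξ => ‖h ξ‖ₑ ^ 2 := hm.enorm.pow_const 2
  have hS' : ∀ᵐ ξ, ‖h ξ‖ₑ ^ 2 ≠ 0 → ∃ k ∈ S, ξ ∈ cell k := by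
    filter_upwards [hS] with ξ hξ h0
    exact hξ fun h1 => h0 (by simp [h1])
  have hTδ : 0 < T ^ δ := Real.rpow_pos_of_pos hT δ
  have hW : ∀ k ∈ S, ∑ l ∈ S,
      ENNReal.ofReal (32 * Real.pi ^ 2 * T ^ δ * cellWeight δ (k - l)) ≤
        ENNReal.ofReal (32 * Real.pi ^ 2 * T ^ δ * (Z * (S.card : ℝ) ^ (5 / 2 * δ))) := by
    intro k _
    rw [← ENNReal.ofReal_sum_of_nonneg fun l _ =>
      mul_nonneg (by positivity) (cellWeight_nonneg _ _), ← Finset.mul_sum]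
    exact ENNReal.ofReal_le_ofReal (mul_le_mul_of_nonneg_left (hZs S k) (by positivity))
  refine (lintegral_evolve_le hm hi h2 hT).trans ?_
  rw [lintegral_midpoint_change hf (measurable_oscMass T)]
  refine (mul_le_mul_right ((lintegral_cell_pair_le hδ hδ' hT hT1 hf hS').trans
    (sum_sum_mul_le_of_symm S _ _ (fun k l => ?_) _ hW)) _).trans (le_of_eq ?_)
  · rw [← cellWeight_neg, neg_sub]
  · rw [← mul_assoc, ← mul_assoc, ← ENNReal.ofReal_ofNat 6, ← ENNReal.ofReal_ofNat 2,
      ← ENNReal.ofReal_mul (by norm_num), ← ENNReal.ofReal_mul (by norm_num)]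
    congr 2
    ring

/-! ### Band-limited functions: orthogonality, Bernstein, and the free estimate -/

/-- The Fourier transform of `f` is supported in the cells of the frequencies in `S`. -/
def BandLimited (S : Finset ℤ) (f : L2) : Prop :=
  ∀ᵐ ξ, (𝓕 f : L2) ξ ≠ 0 → ∃ k ∈ S, ξ ∈ cell k

theorem boxSymbol_of_mem {k : ℤ} {ξ : ℝ} (h : ξ ∈ cell k) : boxSymbol k ξ = 1 :=
  Set.indicator_of_mem (s := Set.Icc ((k : ℝ) - 1 / 2) ((k : ℝ) + 1 / 2)) h _

theorem boxSymbol_of_notMem {k : ℤ} {ξ : ℝ} (h : ξ ∉ cell k) : boxSymbol k ξ = 0 :=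
  Set.indicator_of_notMem (s := Set.Icc ((k : ℝ) - 1 / 2) ((k : ℝ) + 1 / 2)) h _

theorem coeFn_fourier_zero : (𝓕 (0 : L2) : L2) =ᵐ[volume] 0 := by
  have : (𝓕 (0 : L2) : L2) = 0 := (Lp.fourierTransformₗᵢ ℝ ℂ).map_zero
  rw [this]
  exact Lp.coeFn_zero _ _ _

theorem bandLimited_zero (S : Finset ℤ) : BandLimited S 0 := by
  filter_upwards [coeFn_fourier_zero] with ξ h h0
  exact absurd h h0

theorem bandLimited_box {S : Finset ℤ} {k : ℤ} (hk : k ∈ S) (f : L2) : BandLimited S (box k f) := by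
  filter_upwards [coeFn_fourier_box k f] with ξ h h0
  by_contra hc
  rw [h, boxSymbol_of_notMem (fun h1 => hc ⟨k, hk, h1⟩), zero_mul] at h0
  exact h0 rfl

theorem BandLimited.add {S : Finset ℤ} {f g : L2} (hf : BandLimited S f) (hg : BandLimited S g) :
    BandLimited S (f + g) := by
  have h0 : (𝓕 (f + g) : L2) =ᵐ[volume] ((𝓕 f : L2) + (𝓕 g : L2) : ℝ → ℂ) := by
    rw [FourierTransform.fourier_add]; exact Lp.coeFn_add _ _
  filter_upwards [hf, hg, h0] with ξ h1 h2 h3 h4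
  by_contra hc
  have a1 : (𝓕 f : L2) ξ = 0 := by by_contra h; exact hc (h1 h)
  have a2 : (𝓕 g : L2) ξ = 0 := by by_contra h; exact hc (h2 h)
  rw [h3, Pi.add_apply, a1, a2, add_zero] at h4
  exact h4 rfl

theorem BandLimited.smul {S : Finset ℤ} {f : L2} (hf : BandLimited S f) (c : ℂ) :
    BandLimited S (c • f) := by
  have h0 : (𝓕 (c • f) : L2) =ᵐ[volume] (c • (𝓕 f : L2) : ℝ → ℂ) := by
    rw [FourierTransform.fourier_smul]; exact Lp.coeFn_smul _ _
  filter_upwards [hf, h0] with ξ h1 h3 h4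
  refine h1 fun h => h4 ?_
  rw [h3, Pi.smul_apply, h, smul_zero]

theorem BandLimited.sub {S : Finset ℤ} {f g : L2} (hf : BandLimited S f) (hg : BandLimited S g) :
    BandLimited S (f - g) := by
  have := hf.add (hg.smul (-1))
  rwa [neg_one_smul, ← sub_eq_add_neg] at this

theorem BandLimited.sum {S : Finset ℤ} {ι : Type*} (s : Finset ι) {f : ι → L2}
    (hf : ∀ i ∈ s, BandLimited S (f i)) : BandLimited S (∑ i ∈ s, f i) := by
  classical
  induction s using Finset.induction_on with
  | empty => simpa using bandLimited_zero S
  | insert a s ha ih =>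
    rw [Finset.sum_insert ha]
    exact (hf a (Finset.mem_insert_self a s)).add
      (ih fun i hi => hf i (Finset.mem_insert_of_mem hi))

theorem BandLimited.schrodinger {S : Finset ℤ} {f : L2} (hf : BandLimited S f) (t : ℝ) :
    BandLimited S (schrodinger t f) := by
  filter_upwards [hf, coeFn_fourier_schrodinger t f] with ξ h1 h2 h3
  refine h1 fun h => h3 ?_
  rw [h2, h, mul_zero]

theorem box_box_self (k : ℤ) (f : L2) : box k (box k f) = box k f := by
  apply fourier_injective
  filter_upwards [coeFn_fourier_box k f, coeFn_fourier_box k (box k f)] with ξ h1 h2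
  rw [h2, h1]
  by_cases h : ξ ∈ cell k
  · rw [boxSymbol_of_mem h, one_mul, one_mul]
  · rw [boxSymbol_of_notMem h, zero_mul, zero_mul]

/-- Distinct closed cells share at most an endpoint, so the projections `□_k` are exactly orthogonal
despite the closed intervals. -/
theorem ae_notMem_cell_inter {k l : ℤ} (hkl : k ≠ l) : ∀ᵐ ξ : ℝ, ¬(ξ ∈ cell k ∧ ξ ∈ cell l) := by
  have hsub : {ξ : ℝ | ξ ∈ cell k ∧ ξ ∈ cell l} ⊆
      {((k : ℝ) + 1 / 2) / (2 * Real.pi), ((l : ℝ) + 1 / 2) / (2 * Real.pi)} := by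
    rintro ξ ⟨⟨h1, h2⟩, h3, h4⟩
    have hπ : (2 * Real.pi) ≠ 0 := by positivity
    rw [Set.mem_insert_iff, Set.mem_singleton_iff, eq_div_iff hπ, eq_div_iff hπ]
    rcases lt_or_gt_of_ne hkl with h | h
    · left
      have : (k : ℝ) + 1 ≤ l := by exact_mod_cast h
      linarith
    · right
      have : (l : ℝ) + 1 ≤ k := by exact_mod_cast h
      linarith
  have h0 : volume {ξ : ℝ | ξ ∈ cell k ∧ ξ ∈ cell l} = 0 :=
    ((Set.toFinite _).subset hsub).measure_zero _
  rw [ae_iff]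
  simpa using h0

theorem box_box_of_ne {k l : ℤ} (hkl : k ≠ l) (f : L2) : box k (box l f) = 0 := by
  apply fourier_injective
  filter_upwards [coeFn_fourier_box l f, coeFn_fourier_box k (box l f), coeFn_fourier_zero,
    ae_notMem_cell_inter hkl] with ξ h1 h2 h3 h4
  rw [h2, h1, h3, Pi.zero_apply]
  by_cases h : ξ ∈ cell k
  · rw [boxSymbol_of_notMem (fun h5 => h4 ⟨h, h5⟩), zero_mul, mul_zero]
  · rw [boxSymbol_of_notMem h, zero_mul]

theorem lintegral_cell_fourier (k : ℤ) (f : L2) :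
    ∫⁻ ξ in cell k, ‖(𝓕 f : L2) ξ‖ₑ ^ 2 = ‖box k f‖ₑ ^ 2 := by
  have h : ‖box k f‖ₑ = ‖(𝓕 (box k f) : L2)‖ₑ := by
    rw [← ofReal_norm, ← ofReal_norm, Lp.norm_fourier_eq]
  rw [h, ← lintegral_enorm_sq, ← lintegral_indicator (measurableSet_cell k)]
  refine lintegral_congr_ae ?_
  filter_upwards [coeFn_fourier_box k f] with ξ h1
  rw [h1]
  by_cases h : ξ ∈ cell k
  · rw [Set.indicator_of_mem h, boxSymbol_of_mem h, one_mul]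
  · rw [Set.indicator_of_notMem h, boxSymbol_of_notMem h, zero_mul]
    simp

theorem measurable_coeFn (f : L2) : Measurable (f : ℝ → ℂ) := (Lp.stronglyMeasurable f).measurable

theorem BandLimited.ae_sq {S : Finset ℤ} {f : L2} (hf : BandLimited S f) :
    ∀ᵐ ξ, ‖(𝓕 f : L2) ξ‖ₑ ^ 2 ≠ 0 → ∃ k ∈ S, ξ ∈ cell k := by
  filter_upwards [hf] with ξ hξ h0
  exact hξ fun h1 => h0 (by simp [h1])

theorem BandLimited.enorm_sq_le {S : Finset ℤ} {f : L2} (hf : BandLimited S f) :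
    ‖f‖ₑ ^ 2 ≤ ∑ k ∈ S, ‖box k f‖ₑ ^ 2 := by
  have h : ‖f‖ₑ = ‖(𝓕 f : L2)‖ₑ := by
    rw [← ofReal_norm, ← ofReal_norm, Lp.norm_fourier_eq]
  have h1 := lintegral_mul_le_sum_cell ((measurable_coeFn (𝓕 f)).enorm.pow_const 2) hf.ae_sq
    (φ := fun _ => 1) measurable_const
  simp only [mul_one] at h1
  rw [h, ← lintegral_enorm_sq]
  refine h1.trans (le_of_eq (Finset.sum_congr rfl fun k _ => lintegral_cell_fourier k f))

theorem volume_cell_le (k : ℤ) : volume (cell k) ≤ 1 := by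
  have hsub : cell k ⊆ Set.Icc (((k : ℝ) - 1 / 2) / (2 * Real.pi))
      (((k : ℝ) + 1 / 2) / (2 * Real.pi)) := by
    rintro ξ ⟨h1, h2⟩
    have : 0 < 2 * Real.pi := by positivity
    exact ⟨by rw [div_le_iff₀ this]; linarith, by rw [le_div_iff₀ this]; linarith⟩
  refine (measure_mono hsub).trans ?_
  rw [Real.volume_Icc, ← ENNReal.ofReal_one]
  apply ENNReal.ofReal_le_ofReal
  rw [← sub_div, div_le_one (by positivity)]
  have := Real.pi_gt_three
  linarith

/-- By Cauchy-Schwarz, a band-limited function has an integrable Fourier transform. -/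
theorem BandLimited.lintegral_fourier_le {S : Finset ℤ} {f : L2} (hf : BandLimited S f) :
    ∫⁻ ξ, ‖(𝓕 f : L2) ξ‖ₑ ≤ (S.card : ℝ≥0∞) ^ (1 / 2 : ℝ) * ‖f‖ₑ := by
  set U : Set ℝ := ⋃ k ∈ S, cell k with hU
  have hUm : MeasurableSet U := Finset.measurableSet_biUnion S fun k _ => measurableSet_cell k
  have hUv : volume U ≤ S.card := by
    refine (measure_biUnion_finset_le S _).trans ?_
    refine (Finset.sum_le_sum fun k _ => volume_cell_le k).trans ?_
    simp
  have h : ‖f‖ₑ = ‖(𝓕 f : L2)‖ₑ := by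
    rw [← ofReal_norm, ← ofReal_norm, Lp.norm_fourier_eq]
  have h1 : ∫⁻ ξ, ‖(𝓕 f : L2) ξ‖ₑ = ∫⁻ ξ, (U.indicator (fun _ => (1 : ℝ≥0∞)) ξ) * ‖(𝓕 f : L2) ξ‖ₑ := by
    refine lintegral_congr_ae ?_
    filter_upwards [hf] with ξ hξ
    by_cases hU' : ξ ∈ U
    · rw [Set.indicator_of_mem hU', one_mul]
    · have : (𝓕 f : L2) ξ = 0 := by
        by_contra h0
        obtain ⟨k, hk, hkξ⟩ := hξ h0
        exact hU' (Set.mem_biUnion hk hkξ)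
      rw [this]; simp
  have h2 := ENNReal.lintegral_mul_le_Lp_mul_Lq volume Real.HolderConjugate.two_two
    ((measurable_const (a := (1 : ℝ≥0∞))).indicator hUm).aemeasurable
    (measurable_coeFn (𝓕 f)).enorm.aemeasurable
  have h3 : ∫⁻ ξ, (U.indicator (fun _ => (1 : ℝ≥0∞)) ξ) ^ (2 : ℝ) = volume U := by
    rw [← lintegral_indicator_one hUm]
    refine lintegral_congr fun ξ => ?_
    by_cases hU' : ξ ∈ U
    · rw [Set.indicator_of_mem hU', Set.indicator_of_mem hU']; simp
    · rw [Set.indicator_of_notMem hU', Set.indicator_of_notMem hU']; simp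
  have h4 : (∫⁻ ξ, ‖(𝓕 f : L2) ξ‖ₑ ^ (2 : ℝ)) ^ (1 / 2 : ℝ) = ‖f‖ₑ := by
    simp only [ENNReal.rpow_ofNat]
    rw [lintegral_enorm_sq, ← h, ← ENNReal.rpow_natCast, ← ENNReal.rpow_mul]
    norm_num
  rw [h1]
  refine h2.trans ?_
  rw [h3, h4]
  gcongr

theorem BandLimited.integrable {S : Finset ℤ} {f : L2} (hf : BandLimited S f) :
    Integrable ((𝓕 f : L2) : ℝ → ℂ) := by
  refine ⟨(measurable_coeFn _).aestronglyMeasurable, ?_⟩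
  refine hf.lintegral_fourier_le.trans_lt (ENNReal.mul_lt_top ?_ enorm_lt_top)
  exact ENNReal.rpow_lt_top_of_nonneg (by norm_num) (by simp)

theorem BandLimited.coeFn_schrodinger {S : Finset ℤ} {f : L2} (hf : BandLimited S f) (t : ℝ) :
    (DNLS.schrodinger t f : ℝ → ℂ) =ᵐ[volume] 𝓕⁻ (evolve t (𝓕 f : L2)) := by
  have h1 := coeFn_fourierInv _ (hf.schrodinger t).integrable
  rw [FourierTransform.fourierInv_fourier_eq] at h1
  refine h1.trans (Eventually.of_forall fun x => ?_)
  rw [Real.fourierInv_eq, Real.fourierInv_eq]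
  refine integral_congr_ae ?_
  filter_upwards [coeFn_fourier_schrodinger t f] with ξ hξ
  rw [hξ, evolve]

/-- Bernstein's inequality. -/
theorem BandLimited.eLpNorm_top_le {S : Finset ℤ} {f : L2} (hf : BandLimited S f) :
    eLpNorm f ∞ volume ≤ (S.card : ℝ≥0∞) ^ (1 / 2 : ℝ) * ‖f‖ₑ := by
  have h1 := coeFn_fourierInv _ hf.integrable
  rw [FourierTransform.fourierInv_fourier_eq] at h1
  rw [eLpNorm_exponent_top]
  refine eLpNormEssSup_le_of_ae_enorm_bound ?_
  filter_upwards [h1] with x hx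
  rw [hx, Real.fourierInv_eq]
  refine (enorm_integral_le_lintegral_enorm _).trans (le_trans (le_of_eq ?_) hf.lintegral_fourier_le)
  refine lintegral_congr fun ξ => ?_
  rw [← ofReal_norm, Circle.norm_smul, ofReal_norm]

theorem eLpNorm_four_pow_four (f : ℝ → ℂ) :
    eLpNorm f 4 volume ^ 4 = ∫⁻ x, ‖f x‖ₑ ^ 4 := by
  rw [eLpNorm_eq_lintegral_rpow_enorm_toReal (by norm_num) (by norm_num)]
  simp only [ENNReal.toReal_ofNat, ENNReal.rpow_ofNat, one_div]
  rw [← ENNReal.rpow_natCast, ← ENNReal.rpow_mul]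
  norm_num

/-- Interpolation between `L²` and Bernstein's inequality. It serves only for the chaining
remainder, which tends to zero for fixed `S`, so the power of `|S|` is immaterial. -/
theorem BandLimited.eLpNorm_four_le {S : Finset ℤ} {f : L2} (hf : BandLimited S f) :
    eLpNorm f 4 volume ≤ (S.card : ℝ≥0∞) ^ (1 / 4 : ℝ) * ‖f‖ₑ := by
  have h1 : eLpNorm f 4 volume ^ 4 ≤ ((S.card : ℝ≥0∞) ^ (1 / 4 : ℝ) * ‖f‖ₑ) ^ 4 := by
    rw [eLpNorm_four_pow_four]
    have hb : ∀ᵐ x, ‖f x‖ₑ ≤ (S.card : ℝ≥0∞) ^ (1 / 2 : ℝ) * ‖f‖ₑ := by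
      have := hf.eLpNorm_top_le
      rw [eLpNorm_exponent_top] at this
      filter_upwards [enorm_ae_le_eLpNormEssSup (f : ℝ → ℂ) volume] with x hx
      exact hx.trans this
    calc ∫⁻ x, ‖f x‖ₑ ^ 4
        ≤ ∫⁻ x, ((S.card : ℝ≥0∞) ^ (1 / 2 : ℝ) * ‖f‖ₑ) ^ 2 * ‖f x‖ₑ ^ 2 := by
          refine lintegral_mono_ae ?_
          filter_upwards [hb] with x hx
          rw [show 4 = 2 + 2 from rfl, pow_add]
          gcongr
      _ = ((S.card : ℝ≥0∞) ^ (1 / 4 : ℝ) * ‖f‖ₑ) ^ 4 := by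
          rw [lintegral_const_mul _ ((measurable_coeFn f).enorm.pow_const 2), lintegral_enorm_sq,
            mul_pow, mul_pow, mul_assoc, ← pow_add]
          congr 1
          rw [← ENNReal.rpow_natCast, ← ENNReal.rpow_mul, ← ENNReal.rpow_natCast _ 4,
            ← ENNReal.rpow_mul]
          norm_num
  exact (ENNReal.pow_le_pow_left_iff (by norm_num : (4 : ℕ) ≠ 0)).1 h1

/-- The explicit Fourier integral is jointly measurable in `(t, x)`. In the chaining this is applied
to fixed data, which is why the time dependence of `u` itself need not be measurable. -/
theorem BandLimited.measurable_eLpNorm_four {S : Finset ℤ} {f : L2} (hf : BandLimited S f) :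
    Measurable fun t : ℝ => eLpNorm (DNLS.schrodinger t f) 4 volume := by
  have hm : Measurable fun w : ℝ × ℝ => 𝓕⁻ (evolve w.1 (𝓕 f : L2)) w.2 := by
    simp only [Real.fourierInv_eq']
    refine (StronglyMeasurable.integral_prod_right' (ν := (volume : Measure ℝ))
      (f := fun w : (ℝ × ℝ) × ℝ => Complex.exp (((2 * Real.pi * inner ℝ w.2 w.1.2 : ℝ) : ℂ) *
        Complex.I) • evolve w.1.1 (𝓕 f : L2) w.2) ?_).measurable
    refine Measurable.stronglyMeasurable ?_
    have a1 : Measurable fun w : (ℝ × ℝ) × ℝ => (𝓕 f : L2) w.2 :=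
      (measurable_coeFn _).comp (by fun_prop)
    have a2 : Measurable fun w : (ℝ × ℝ) × ℝ => schrodingerSymbol w.1.1 w.2 := by
      unfold schrodingerSymbol
      fun_prop
    have a3 : Measurable fun w : (ℝ × ℝ) × ℝ =>
        Complex.exp (((2 * Real.pi * inner ℝ w.2 w.1.2 : ℝ) : ℂ) * Complex.I) := by
      fun_prop
    exact a3.smul (a2.mul a1)
  have : ∀ t, eLpNorm (DNLS.schrodinger t f) 4 volume =
      (∫⁻ x, ‖𝓕⁻ (evolve t (𝓕 f : L2)) x‖ₑ ^ 4) ^ (1 / 4 : ℝ) := by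
    intro t
    rw [eLpNorm_congr_ae (hf.coeFn_schrodinger t), ← eLpNorm_four_pow_four, ← ENNReal.rpow_natCast,
      ← ENNReal.rpow_mul]
    norm_num
  simp_rw [this]
  have hm4 : Measurable fun w : ℝ × ℝ => ‖𝓕⁻ (evolve w.1 (𝓕 f : L2)) w.2‖ₑ ^ 4 :=
    hm.enorm.pow_const 4
  exact (Measurable.lintegral_prod_right hm4).pow_const _

/-- The free `L⁴` estimate for band-limited data. -/
theorem exists_schrodinger_estimate {δ : ℝ} (hδ : 0 < δ) (hδ' : δ ≤ 1 / 2) :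
    ∃ C : ℝ, 0 < C ∧ ∀ (T : ℝ), 0 < T → T ≤ 1 → ∀ (S : Finset ℤ) (f : L2), BandLimited S f →
      ∫⁻ t in Set.Icc 0 T, eLpNorm (schrodinger t f) 4 volume ^ 4 ≤
        ENNReal.ofReal (C * T ^ δ * (S.card : ℝ) ^ (5 / 2 * δ)) * ∑ k ∈ S, ‖box k f‖ₑ ^ 4 := by
  obtain ⟨C, hC, hmain⟩ := exists_free_estimate hδ hδ'
  refine ⟨C, hC, fun T hT hT1 S f hf => ?_⟩
  have h := hmain T hT hT1 S (𝓕 f : L2) (measurable_coeFn _) hf.integrable (Lp.memLp _) hf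
  simp_rw [lintegral_cell_fourier, ← pow_mul] at h
  refine le_trans (le_of_eq ?_) h
  refine lintegral_congr fun t => ?_
  rw [eLpNorm_congr_ae (hf.coeFn_schrodinger t), eLpNorm_four_pow_four]

/-! ### Monotone control of `U²` functions -/

/-- `w`, extended by zero to `±∞`, has square variation controlled by a monotone function with
values in `[0, R]`, and `w` has limits at `±∞`. -/
structure Controlled (w : ℝ → L2) (R : ℝ) (W : EReal → L2) (B : EReal → ℝ) : Prop where
  coe : ∀ s : ℝ, W s = w s
  bot : W ⊥ = 0
  top : W ⊤ = 0
  mono : Monotone B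
  nonneg : ∀ s, 0 ≤ B s
  le : ∀ s, B s ≤ R
  sq_le : ∀ s s', s ≤ s' → ‖W s' - W s‖ ^ 2 ≤ B s' - B s
  tendsto_bot : Tendsto w atBot (𝓝 0)
  tendsto_top : ∃ r, Tendsto w atTop (𝓝 r)

theorem Controlled.norm_sq_le {w : ℝ → L2} {R : ℝ} {W : EReal → L2} {B : EReal → ℝ}
    (h : Controlled w R W B) (s : EReal) : ‖W s‖ ^ 2 ≤ R := by
  have := h.sq_le ⊥ s bot_le
  rw [h.bot, sub_zero] at this
  linarith [h.nonneg ⊥, h.le s]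

theorem sum_fin_telescope {M : Type*} [AddCommGroup M] (n : ℕ) (f : Fin (n + 1) → M) :
    ∑ k : Fin n, (f k.castSucc - f k.succ) = f 0 - f (Fin.last n) := by
  induction n with
  | zero => simp
  | succ n ih =>
    rw [Fin.sum_univ_castSucc]
    have := ih fun k => f k.castSucc
    simp only [← Fin.succ_castSucc] at this ⊢
    rw [this]
    simp

/-- The indicator of `[t, ∞]` as a real number. -/
def step (t s : EReal) : ℝ := if t ≤ s then 1 else 0

theorem step_nonneg (t s : EReal) : 0 ≤ step t s := by
  unfold step; split_ifs <;> norm_num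

theorem step_le_one (t s : EReal) : step t s ≤ 1 := by
  unfold step; split_ifs <;> norm_num

theorem step_mono (t : EReal) : Monotone (step t) := by
  intro s s' h
  unfold step
  split_ifs with h1 h2
  · rfl
  · exact absurd (h1.trans h) h2
  · norm_num
  · rfl

theorem indicator_Ico_eq_step {t t' : EReal} (h : t ≤ t') (φ : L2) (s : EReal) :
    (Set.Ico t t').indicator (fun _ => φ) s = (step t s - step t' s) • φ := by
  unfold step
  by_cases h1 : t ≤ s
  · by_cases h2 : t' ≤ s
    · rw [Set.indicator_of_notMem (fun h3 => not_lt.2 h2 h3.2)]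
      simp [h1, h2]
    · have h3 : s ∈ Set.Ico t t' := ⟨h1, not_le.1 h2⟩
      rw [Set.indicator_of_mem h3]
      simp [h1, h2]
  · rw [Set.indicator_of_notMem (fun h3 => h1 h3.1)]
    have h2 : ¬t' ≤ s := fun h2 => h1 (h.trans h2)
    simp [h1, h2]

/-- Cauchy-Schwarz for a combination of vectors with total weight at most `2`. -/
theorem norm_sum_smul_sq_le {ι : Type*} (s : Finset ι) (d : ι → ℝ) (φ : ι → L2)
    (hd : ∑ i ∈ s, |d i| ≤ 2) :
    ‖∑ i ∈ s, d i • φ i‖ ^ 2 ≤ 2 * ∑ i ∈ s, |d i| * ‖φ i‖ ^ 2 := by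
  have h1 : ‖∑ i ∈ s, d i • φ i‖ ≤ ∑ i ∈ s, |d i| * ‖φ i‖ := by
    refine (norm_sum_le _ _).trans (le_of_eq (Finset.sum_congr rfl fun i _ => ?_))
    rw [norm_smul, Real.norm_eq_abs]
  have h2 : (∑ i ∈ s, |d i| * ‖φ i‖) ^ 2 ≤ (∑ i ∈ s, |d i|) * ∑ i ∈ s, |d i| * ‖φ i‖ ^ 2 := by
    refine Finset.sum_sq_le_sum_mul_sum_of_sq_le_mul s (fun i _ => abs_nonneg _)
      (fun i _ => by positivity) fun i _ => le_of_eq (by ring)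
  have h3 : 0 ≤ ∑ i ∈ s, |d i| * ‖φ i‖ ^ 2 := Finset.sum_nonneg fun i _ => by positivity
  calc ‖∑ i ∈ s, d i • φ i‖ ^ 2 ≤ (∑ i ∈ s, |d i| * ‖φ i‖) ^ 2 := by gcongr
    _ ≤ _ := h2
    _ ≤ _ := by gcongr

theorem tendsto_indicator_Ico_atTop {t t' : EReal} (h : t < t') (φ : L2) :
    ∃ r, Tendsto (fun s : ℝ => (Set.Ico t t').indicator (fun _ => φ) (s : EReal)) atTop (𝓝 r) := by
  rcases eq_or_ne t' ⊤ with rfl | ht'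
  · refine ⟨φ, tendsto_const_nhds.congr' ?_⟩
    have := EReal.tendsto_coe_atTop.eventually (lt_mem_nhds h)
    filter_upwards [this] with s hs
    rw [Set.indicator_of_mem]
    exact ⟨hs.le, EReal.coe_lt_top s⟩
  · refine ⟨0, tendsto_const_nhds.congr' ?_⟩
    have := EReal.tendsto_coe_atTop.eventually (lt_mem_nhds ht'.lt_top)
    filter_upwards [this] with s hs
    rw [Set.indicator_of_notMem]
    exact fun h3 => not_lt.2 hs.le h3.2

/-- Between two times an atom changes only through pieces that are switched on or off. At each time
at most one piece is active, so the coefficients of an increment have total weight at most `2`, and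
Cauchy-Schwarz bounds its square by `2 ∑ ‖φ_k‖²` over the pieces affected. -/
theorem exists_controlled_of_isAtom {a : ℝ → L2} (ha : IsAtom 2 a) :
    ∃ W B, Controlled a 4 W B := by
  obtain ⟨P, φ, h0, h1, h2⟩ := ha
  simp only [Real.rpow_two] at h1
  have hlt : ∀ k : Fin P.K, P.t k.castSucc < P.t k.succ := fun k =>
    P.strictMono Fin.castSucc_lt_succ
  -- The first piece vanishes; this gives the value at `-∞` and the limit there. At `+∞` the value
  -- is zero because the intervals are half-open.
  have hφ0 : ∀ k : Fin P.K, P.t k.castSucc = ⊥ → φ k = 0 := by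
    intro k hk
    have : k.castSucc = 0 := P.strictMono.injective (hk.trans P.first.symm)
    exact h0 k (by simpa using congrArg Fin.val this)
  set W : EReal → L2 := fun s => ∑ k : Fin P.K,
      (Set.Ico (P.t k.castSucc) (P.t k.succ)).indicator (fun _ => φ k) s with hW
  have hWs : ∀ s, W s = ∑ k : Fin P.K, (step (P.t k.castSucc) s - step (P.t k.succ) s) • φ k :=
    fun s => Finset.sum_congr rfl fun k _ => indicator_Ico_eq_step (hlt k).le _ _
  -- `B` charges `2‖φ_k‖²` when piece `k` is switched on and again when it is switched off; since `∑
  -- ‖φ_k‖² = 1` the total is at most `4`.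
  set B : EReal → ℝ := fun s => 2 * ∑ k : Fin P.K,
      (step (P.t k.castSucc) s + step (P.t k.succ) s) * ‖φ k‖ ^ 2 with hB
  refine ⟨W, B, fun s => (h2 s).symm, ?_, ?_, ?_, ?_, ?_, ?_, ?_, ?_⟩
  · refine Finset.sum_eq_zero fun k _ => ?_
    rw [Set.indicator_apply]
    split_ifs with h
    · exact hφ0 k (le_bot_iff.1 h.1)
    · rfl
  · refine Finset.sum_eq_zero fun k _ => ?_
    rw [Set.indicator_of_notMem]
    exact fun h => not_top_lt h.2
  · intro s s' hs
    simp only [hB]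
    gcongr
    · exact step_mono _ hs
    · exact step_mono _ hs
  · intro s
    have : ∀ k : Fin P.K, 0 ≤ (step (P.t k.castSucc) s + step (P.t k.succ) s) * ‖φ k‖ ^ 2 :=
      fun k => mul_nonneg (add_nonneg (step_nonneg _ _) (step_nonneg _ _)) (by positivity)
    exact mul_nonneg (by norm_num) (Finset.sum_nonneg fun k _ => this k)
  · intro s
    have : ∑ k : Fin P.K, (step (P.t k.castSucc) s + step (P.t k.succ) s) * ‖φ k‖ ^ 2 ≤
        ∑ k : Fin P.K, 2 * ‖φ k‖ ^ 2 := by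
      refine Finset.sum_le_sum fun k _ => ?_
      gcongr
      linarith [step_le_one (P.t k.castSucc) s, step_le_one (P.t k.succ) s]
    rw [← Finset.mul_sum, h1] at this
    simp only [hB]
    linarith
  · intro s s' hs
    have hd : ∀ u, ∑ k : Fin P.K, (step (P.t k.castSucc) u - step (P.t k.succ) u) ≤ 1 := by
      intro u
      rw [sum_fin_telescope P.K fun k => step (P.t k) u]
      linarith [step_le_one (P.t 0) u, step_nonneg (P.t (Fin.last P.K)) u]
    have hpos : ∀ u (k : Fin P.K), 0 ≤ step (P.t k.castSucc) u - step (P.t k.succ) u := by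
      intro u k
      unfold step
      split_ifs with h3 h4 h5
      · norm_num
      · norm_num
      · exact absurd ((hlt k).le.trans h5) h3
      · norm_num
    set d : Fin P.K → ℝ := fun k => (step (P.t k.castSucc) s' - step (P.t k.succ) s') -
      (step (P.t k.castSucc) s - step (P.t k.succ) s) with hdd
    have hWd : W s' - W s = ∑ k, d k • φ k := by
      rw [hWs, hWs, ← Finset.sum_sub_distrib]
      exact Finset.sum_congr rfl fun k _ => (sub_smul _ _ _).symm
    have hd2 : ∑ k, |d k| ≤ 2 := by
      have : ∀ k, |d k| ≤ (step (P.t k.castSucc) s' - step (P.t k.succ) s') +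
          (step (P.t k.castSucc) s - step (P.t k.succ) s) := by
        intro k
        have h3 := hpos s k
        have h4 := hpos s' k
        simp only [hdd]
        rw [abs_le]
        constructor <;> linarith
      refine (Finset.sum_le_sum fun k _ => this k).trans ?_
      rw [Finset.sum_add_distrib]
      linarith [hd s, hd s']
    have hBd : B s' - B s = 2 * ∑ k : Fin P.K, ((step (P.t k.castSucc) s' - step (P.t k.castSucc) s)
        + (step (P.t k.succ) s' - step (P.t k.succ) s)) * ‖φ k‖ ^ 2 := by
      simp only [hB]
      rw [← mul_sub, ← Finset.sum_sub_distrib]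
      congr 1
      exact Finset.sum_congr rfl fun k _ => by ring
    rw [hWd, hBd]
    refine (norm_sum_smul_sq_le _ d φ hd2).trans ?_
    gcongr with k
    have h3 := step_mono (P.t k.castSucc) hs
    have h4 := step_mono (P.t k.succ) hs
    simp only [hdd]
    rw [abs_le]
    constructor <;> linarith
  · have : Tendsto (fun s : ℝ => ∑ k : Fin P.K,
        (Set.Ico (P.t k.castSucc) (P.t k.succ)).indicator (fun _ => φ k) (s : EReal)) atBot
        (𝓝 (∑ k : Fin P.K, 0)) := by
      refine tendsto_finsetSum _ fun k _ => tendsto_const_nhds.congr' ?_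
      rcases eq_or_ne (P.t k.castSucc) ⊥ with h | h
      · rw [hφ0 k h]
        exact Eventually.of_forall fun s => by simp
      · have := EReal.tendsto_coe_atBot.eventually (gt_mem_nhds h.bot_lt)
        filter_upwards [this] with s hs
        rw [Set.indicator_of_notMem]
        exact fun h3 => not_lt.2 h3.1 hs
    rw [Finset.sum_const_zero] at this
    exact this.congr fun s => (h2 s).symm
  · choose r hr using fun k : Fin P.K => tendsto_indicator_Ico_atTop (hlt k) (φ k)
    exact ⟨∑ k, r k, (tendsto_finsetSum _ fun k _ => hr k).congr fun s => (h2 s).symm⟩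

/-- Cauchy-Schwarz with weights `c`: summing `2r x_j ≤ r² + x_j²` against `c_j` and taking the
optimal `r = X / M`. -/
theorem tsum_mul_sq_le {c x : ℕ → ℝ} (hc0 : ∀ j, 0 ≤ c j) (hc : Summable c)
    (hcx : Summable fun j => c j * x j) (hcx2 : Summable fun j => c j * x j ^ 2) {M : ℝ}
    (hM : 0 < M) (hcM : ∑' j, c j ≤ M) :
    (∑' j, c j * x j) ^ 2 ≤ M * ∑' j, c j * x j ^ 2 := by
  set X := ∑' j, c j * x j
  set Y := ∑' j, c j * x j ^ 2
  have h : ∀ r : ℝ, 2 * r * X ≤ r ^ 2 * M + Y := by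
    intro r
    have h1 : ∑' j, 2 * r * (c j * x j) ≤ ∑' j, (r ^ 2 * c j + c j * x j ^ 2) := by
      refine Summable.tsum_le_tsum (fun j => ?_) (hcx.mul_left _) ((hc.mul_left _).add hcx2)
      nlinarith [mul_nonneg (hc0 j) (sq_nonneg (r - x j))]
    rw [tsum_mul_left, Summable.tsum_add (hc.mul_left _) hcx2, tsum_mul_left] at h1
    nlinarith [sq_nonneg r, mul_le_mul_of_nonneg_left hcM (sq_nonneg r)]
  have h2 := h (X / M)
  have h3 : 2 * (X / M) * X = 2 * (X ^ 2 / M) := by ring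
  have h4 : (X / M) ^ 2 * M = X ^ 2 / M := by field_simp
  rw [h3, h4] at h2
  have h5 : X ^ 2 / M ≤ Y := by linarith
  rw [div_le_iff₀ hM] at h5
  linarith

/-- A superposition `∑ c_j a_j` is controlled by `M ∑ |c_j| B_j`: Cauchy-Schwarz against the weights
`|c_j|` costs their sum, which is below `M`, and `B_j ≤ 4` yields the range `[0, 4M²]`. -/
theorem exists_controlled_of_uNorm_lt {w : ℝ → L2} {M : ℝ} (hM : 0 < M)
    (hw : uNorm 2 w < ENNReal.ofReal M) : ∃ W B, Controlled w (4 * M ^ 2) W B := by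
  simp only [uNorm, iInf_lt_iff] at hw
  obtain ⟨c, a, ha, hc, hsum, hlt⟩ := hw
  choose W B hWB using fun j => exists_controlled_of_isAtom (ha j)
  have hcM : ∑' j, ‖c j‖ < M := by
    rw [← ENNReal.ofReal_lt_ofReal_iff hM,
      ENNReal.ofReal_tsum_of_nonneg (fun j => norm_nonneg _) hc]
    simpa [ofReal_norm] using hlt
  have hW2 : ∀ j s, ‖W j s‖ ≤ 2 := by
    intro j s
    have := (hWB j).norm_sq_le s
    nlinarith [norm_nonneg (W j s)]
  have hsW : ∀ s, Summable fun j => c j • W j s := fun s => by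
    refine Summable.of_norm_bounded (hc.mul_right 2) fun j => ?_
    rw [norm_smul]
    exact mul_le_mul_of_nonneg_left (hW2 j s) (norm_nonneg _)
  have hsB : ∀ s, Summable fun j => ‖c j‖ * B j s := fun s => by
    refine Summable.of_nonneg_of_le (fun j => mul_nonneg (norm_nonneg _) ((hWB j).nonneg s))
      (fun j => mul_le_mul_of_nonneg_left ((hWB j).le s) (norm_nonneg _)) (hc.mul_right 4)
  have hlim : ∀ (l : Filter ℝ) (r : ℕ → L2), (∀ j, Tendsto (a j) l (𝓝 (r j))) →
      Tendsto w l (𝓝 (∑' j, c j • r j)) := by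
    intro l r hr
    have : w = fun t => ∑' j, c j • a j t := funext fun t => ((hsum t).tsum_eq).symm
    rw [this]
    refine tendsto_tsum_of_dominated_convergence (hc.mul_right 2) (fun j => (hr j).const_smul _)
      (Eventually.of_forall fun t j => ?_)
    rw [norm_smul, ← (hWB j).coe t]
    exact mul_le_mul_of_nonneg_left (hW2 j t) (norm_nonneg _)
  refine ⟨fun s => ∑' j, c j • W j s, fun s => M * ∑' j, ‖c j‖ * B j s, fun s => ?_, ?_, ?_, ?_,
    fun s => ?_, fun s => ?_, fun s s' hs => ?_, ?_, ?_⟩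
  · simp_rw [fun j => (hWB j).coe s]
    exact (hsum s).tsum_eq
  · simp [fun j => (hWB j).bot]
  · simp [fun j => (hWB j).top]
  · intro s s' hs
    refine mul_le_mul_of_nonneg_left (Summable.tsum_le_tsum (fun j => ?_) (hsB s) (hsB s')) hM.le
    exact mul_le_mul_of_nonneg_left ((hWB j).mono hs) (norm_nonneg _)
  · exact mul_nonneg hM.le (tsum_nonneg fun j => mul_nonneg (norm_nonneg _) ((hWB j).nonneg s))
  · have h1 : ∑' j, ‖c j‖ * B j s ≤ ∑' j, ‖c j‖ * 4 :=
      Summable.tsum_le_tsum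
        (fun j => mul_le_mul_of_nonneg_left ((hWB j).le s) (norm_nonneg _)) (hsB s) (hc.mul_right 4)
    rw [tsum_mul_right] at h1
    nlinarith
  · have hx : ∀ j, ‖W j s' - W j s‖ ^ 2 ≤ B j s' - B j s := fun j => (hWB j).sq_le s s' hs
    have hsd : Summable fun j => ‖c j‖ * ‖W j s' - W j s‖ := by
      refine Summable.of_nonneg_of_le (fun j => by positivity) (fun j => ?_) (hc.mul_right 4)
      refine mul_le_mul_of_nonneg_left ((norm_sub_le _ _).trans ?_) (norm_nonneg _)
      linarith [hW2 j s, hW2 j s']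
    have hsBd : Summable fun j => ‖c j‖ * (B j s' - B j s) := by
      simpa only [mul_sub] using (hsB s').sub (hsB s)
    have hsd2 : Summable fun j => ‖c j‖ * ‖W j s' - W j s‖ ^ 2 :=
      Summable.of_nonneg_of_le (fun j => by positivity)
        (fun j => mul_le_mul_of_nonneg_left (hx j) (norm_nonneg _)) hsBd
    have h1 : ‖∑' j, c j • W j s' - ∑' j, c j • W j s‖ ≤ ∑' j, ‖c j‖ * ‖W j s' - W j s‖ := by
      rw [← Summable.tsum_sub (hsW s') (hsW s)]
      have h2 : ∀ j, ‖c j • W j s' - c j • W j s‖ = ‖c j‖ * ‖W j s' - W j s‖ := fun j => by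
        rw [← smul_sub, norm_smul]
      refine (norm_tsum_le_tsum_norm (by simpa only [h2] using hsd)).trans (le_of_eq ?_)
      simp_rw [h2]
    calc ‖∑' j, c j • W j s' - ∑' j, c j • W j s‖ ^ 2
        ≤ (∑' j, ‖c j‖ * ‖W j s' - W j s‖) ^ 2 := by gcongr
      _ ≤ M * ∑' j, ‖c j‖ * ‖W j s' - W j s‖ ^ 2 :=
          tsum_mul_sq_le (fun j => norm_nonneg _) hc hsd hsd2 hM hcM.le
      _ ≤ M * ∑' j, ‖c j‖ * (B j s' - B j s) := by
          refine mul_le_mul_of_nonneg_left (Summable.tsum_le_tsum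
            (fun j => mul_le_mul_of_nonneg_left (hx j) (norm_nonneg _)) hsd2 hsBd) hM.le
      _ = _ := by
          simp_rw [mul_sub (‖c _‖)]
          rw [Summable.tsum_sub (hsB s') (hsB s), mul_sub]
  · simpa using hlim atBot (fun _ => 0) fun j => (hWB j).tendsto_bot
  · choose r hr using fun j => (hWB j).tendsto_top
    exact ⟨_, hlim atTop r hr⟩

/-! ### Chaining over dyadic levels -/

/-- A bounded function on a nonempty type is approximated by finitely many of its values, at every
dyadic scale. -/
theorem exists_dyadic_representatives {α : Type*} [Nonempty α] (A : α → ℝ) {R : ℝ} (hR : 0 < R)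
    (h0 : ∀ t, 0 ≤ A t) (h1 : ∀ t, A t ≤ R) :
    ∃ (idx : ℕ → α → ℕ) (rep : ℕ → ℕ → α), (∀ n t, idx n t ≤ 2 ^ n) ∧
      ∀ n t, |A (rep n (idx n t)) - A t| ≤ R / 2 ^ n := by
  classical
  set idx : ℕ → α → ℕ := fun n t => ⌊A t / R * 2 ^ n⌋₊ with hidx
  -- `idx n t` is the level of `A t / R` on the grid of mesh `2^{-n}`, and `rep n i` is some time at
  -- level `i`. The arbitrary default at an empty level is harmless, since the approximation is
  -- claimed only at levels `idx n t`.
  refine ⟨idx, fun n i => if h : ∃ t, idx n t = i then h.choose else Classical.arbitrary α,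
    fun n t => ?_, fun n t => ?_⟩
  · have h2 : A t / R * 2 ^ n ≤ ((2 ^ n : ℕ) : ℝ) := by
      push_cast
      have : A t / R ≤ 1 := (div_le_one hR).2 (h1 t)
      nlinarith [pow_pos (two_pos : (0 : ℝ) < 2) n]
    exact (Nat.floor_le_floor h2).trans (le_of_eq (Nat.floor_natCast _))
  · have hex : ∃ t', idx n t' = idx n t := ⟨t, rfl⟩
    have hc : idx n hex.choose = idx n t := hex.choose_spec
    simp only [dif_pos hex]
    have hpos : ∀ t, 0 ≤ A t / R * 2 ^ n := fun t => by
      have := h0 t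
      positivity
    have a1 := Nat.floor_le (hpos t)
    have a2 := Nat.lt_floor_add_one (A t / R * 2 ^ n)
    have b1 := Nat.floor_le (hpos hex.choose)
    have b2 := Nat.lt_floor_add_one (A hex.choose / R * 2 ^ n)
    simp only [hidx] at hc
    rw [hc] at b1 b2
    have h3 : |A hex.choose / R * 2 ^ n - A t / R * 2 ^ n| ≤ 1 := by
      rw [abs_le]; constructor <;> linarith
    have h4 : A hex.choose / R * 2 ^ n - A t / R * 2 ^ n =
        (A hex.choose - A t) * (2 ^ n / R) := by ring
    rw [h4, abs_mul, abs_of_pos (by positivity : (0 : ℝ) < 2 ^ n / R)] at h3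
    rw [le_div_iff₀ (by positivity)]
    have h5 : |A hex.choose - A t| * 2 ^ n = |A hex.choose - A t| * (2 ^ n / R) * R := by
      field_simp
    rw [h5]
    nlinarith

/-- Each of the `|S|` cells has squared norm at most `E^{1/2}`. Like `BandLimited.eLpNorm_four_le`,
this serves the chaining remainder. -/
theorem BandLimited.enorm_le_of_sum_four {S : Finset ℤ} {f : L2} (hf : BandLimited S f)
    {E : ℝ≥0∞} (h : ∑ k ∈ S, ‖box k f‖ₑ ^ 4 ≤ E) :
    ‖f‖ₑ ≤ (S.card : ℝ≥0∞) ^ (1 / 2 : ℝ) * E ^ (1 / 4 : ℝ) := by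
  have h1 : ∀ k ∈ S, ‖box k f‖ₑ ^ 2 ≤ E ^ (1 / 2 : ℝ) := by
    intro k hk
    have h2 : ‖box k f‖ₑ ^ 4 ≤ E :=
      (Finset.single_le_sum (f := fun k => ‖box k f‖ₑ ^ 4) (fun _ _ => zero_le) hk).trans h
    have h3 := ENNReal.rpow_le_rpow h2 (by norm_num : (0 : ℝ) ≤ 1 / 2)
    rw [← ENNReal.rpow_natCast, ← ENNReal.rpow_mul] at h3
    norm_num at h3
    simpa using h3
  have h4 : ‖f‖ₑ ^ 2 ≤ S.card * E ^ (1 / 2 : ℝ) := by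
    refine hf.enorm_sq_le.trans ((Finset.sum_le_sum h1).trans (le_of_eq ?_))
    rw [Finset.sum_const, nsmul_eq_mul]
  have h5 := ENNReal.rpow_le_rpow h4 (by norm_num : (0 : ℝ) ≤ 1 / 2)
  rw [← ENNReal.rpow_natCast, ← ENNReal.rpow_mul,
    ENNReal.mul_rpow_of_nonneg _ _ (by norm_num), ← ENNReal.rpow_mul] at h5
  norm_num at h5
  simpa using h5

theorem eLpNorm_four_eq {α : Type*} [MeasurableSpace α] (μ : Measure α) (f : α → ℝ≥0∞) :
    eLpNorm f 4 μ = (∫⁻ t, f t ^ 4 ∂μ) ^ (1 / 4 : ℝ) := by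
  rw [eLpNorm_eq_lintegral_rpow_enorm_toReal (by norm_num) (by norm_num)]
  simp

theorem sum_geometric_le {r : ℝ} (hr0 : 0 ≤ r) (hr1 : r < 1) (M : ℕ) :
    ∑ n ∈ Finset.range M, ENNReal.ofReal (r ^ n) ≤ ENNReal.ofReal (1 - r)⁻¹ := by
  rw [← ENNReal.ofReal_sum_of_nonneg fun n _ => pow_nonneg hr0 n]
  apply ENNReal.ofReal_le_ofReal
  rw [← tsum_geometric_of_lt_one hr0 hr1]
  exact (summable_geometric_of_lt_one hr0 hr1).sum_le_tsum _ fun n _ => pow_nonneg hr0 n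

set_option maxHeartbeats 800000 in
/-- The chaining estimate: a free `L⁴` bound in terms of `∑ ‖□_k f‖⁴` transfers to time-dependent
data whose `ℓ⁴` increments are controlled by a power `θ > 1` of a bounded function. -/
theorem mixedNorm_four_le_of_increments {S : Finset ℤ} {T θ R : ℝ} (hθ : 1 < θ) (hθ2 : θ ≤ 2)
    (hR : 0 < R) {Q : ℝ≥0∞}
    (hQ : ∀ f : L2, BandLimited S f →
      ∫⁻ t in Set.Icc 0 T, eLpNorm (schrodinger t f) 4 volume ^ 4 ≤ Q * ∑ k ∈ S, ‖box k f‖ₑ ^ 4)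
    {v : ℝ → L2} (hv : ∀ t, BandLimited S (v t)) {A : ℝ → ℝ} (h0 : ∀ t, 0 ≤ A t)
    (h1 : ∀ t, A t ≤ R)
    (hinc : ∀ s s', ∑ k ∈ S, ‖box k (v s' - v s)‖ₑ ^ 4 ≤ ENNReal.ofReal (|A s' - A s| ^ θ))
    (hbase : ∀ s, ∑ k ∈ S, ‖box k (v s)‖ₑ ^ 4 ≤ ENNReal.ofReal (R ^ θ)) :
    mixedNorm 4 4 (Set.Icc 0 T) (fun t => schrodinger t (v t)) ≤
      (8 * Q * ENNReal.ofReal (R ^ θ)) ^ (1 / 4 : ℝ) *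
        ENNReal.ofReal (1 - 2 ^ (-((θ - 1) / 4)))⁻¹ := by
  obtain ⟨idx, rep, hidx, hrep⟩ := exists_dyadic_representatives A hR h0 h1
  set μ : Measure ℝ := volume.restrict (Set.Icc 0 T) with hμ
  -- A link joins a representative at scale `n + 1` to the representative at scale `n` of its own
  -- level. It depends on `i` and not on `t`, so scale `n` involves only `2^n + 1` fixed data.
  set D : ℕ → ℕ → L2 := fun n i => match n with
    | 0 => v (rep 0 i)
    | n + 1 => v (rep (n + 1) i) - v (rep n (idx n (rep (n + 1) i))) with hD
  have hDband : ∀ n i, BandLimited S (D n i) := by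
    intro n i
    cases n with
    | zero => exact hv _
    | succ n => exact (hv _).sub (hv _)
  have hDle : ∀ n i, ∑ k ∈ S, ‖box k (D n i)‖ₑ ^ 4 ≤
      ENNReal.ofReal (4 * R ^ θ * (2 ^ (-θ)) ^ n) := by
    intro n i
    have hRθ : 0 ≤ R ^ θ := by positivity
    cases n with
    | zero =>
      refine (hbase _).trans (ENNReal.ofReal_le_ofReal ?_)
      rw [pow_zero, mul_one]
      linarith
    | succ n =>
      refine (hinc _ _).trans (ENNReal.ofReal_le_ofReal ?_)
      have h2 := hrep n (rep (n + 1) i)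
      rw [abs_sub_comm] at h2
      calc |A (rep (n + 1) i) - A (rep n (idx n (rep (n + 1) i)))| ^ θ ≤ (R / 2 ^ n) ^ θ := by
            gcongr
        _ = R ^ θ * (2 ^ (-θ)) ^ n := by
            rw [Real.div_rpow hR.le (by positivity), div_eq_mul_inv, ← Real.rpow_natCast 2 n,
              ← Real.rpow_mul (by norm_num), ← Real.rpow_natCast, ← Real.rpow_mul (by norm_num),
              ← Real.rpow_neg (by norm_num)]
            congr 2
            ring
        -- The link into scale `n + 1` has the size of scale `n`; the factor `4 ≥ 2^θ` absorbs this
        -- shift, and here `θ ≤ 2` is used.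
        _ ≤ 4 * R ^ θ * (2 ^ (-θ)) ^ (n + 1) := by
            rw [pow_succ]
            have h3 : (1 : ℝ) ≤ 4 * 2 ^ (-θ) := by
              have h4 : (2 : ℝ) ^ (-2 : ℝ) ≤ 2 ^ (-θ) :=
                Real.rpow_le_rpow_of_exponent_le (by norm_num) (by linarith)
              rw [Real.rpow_neg (by norm_num)] at h4
              norm_num at h4
              linarith
            have h5 : 0 ≤ R ^ θ * (2 ^ (-θ)) ^ n := by positivity
            nlinarith
  -- The maximum over the links of one scale is replaced by their `ℓ⁴` sum, which is measurable in
  -- `t` and can be integrated link by link.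
  set Y : ℕ → ℝ → ℝ≥0∞ := fun n t =>
    ∑ i ∈ Finset.range (2 ^ n + 1), eLpNorm (schrodinger t (D n i)) 4 volume ^ 4 with hY
  set X : ℕ → ℝ → ℝ≥0∞ := fun n t => Y n t ^ (1 / 4 : ℝ) with hX
  have hYm : ∀ n, Measurable (Y n) := fun n =>
    Finset.measurable_fun_sum _ fun i _ => (hDband n i).measurable_eLpNorm_four.pow_const 4
  have hXm : ∀ n, Measurable (X n) := fun n => (hYm n).pow_const _
  have hDX : ∀ n i t, i ≤ 2 ^ n → eLpNorm (schrodinger t (D n i)) 4 volume ≤ X n t := by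
    intro n i t hi
    have h2 : eLpNorm (schrodinger t (D n i)) 4 volume ^ 4 ≤ Y n t :=
      Finset.single_le_sum (f := fun i => eLpNorm (schrodinger t (D n i)) 4 volume ^ 4)
        (fun _ _ => zero_le) (Finset.mem_range.2 (Nat.lt_succ_of_le hi))
    have h3 := ENNReal.rpow_le_rpow h2 (by norm_num : (0 : ℝ) ≤ 1 / 4)
    rw [← ENNReal.rpow_natCast, ← ENNReal.rpow_mul] at h3
    norm_num at h3
    simpa [hX] using h3
  have hadd : ∀ (t : ℝ) (f g : L2), eLpNorm (schrodinger t (f + g)) 4 volume ≤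
      eLpNorm (schrodinger t f) 4 volume + eLpNorm (schrodinger t g) 4 volume := by
    intro t f g
    have : schrodinger t (f + g) = schrodinger t f + schrodinger t g :=
      fourierMultiplier_add _ _ _ f g
    rw [this, eLpNorm_congr_ae (Lp.coeFn_add _ _)]
    exact eLpNorm_add_le (Lp.aestronglyMeasurable _) (Lp.aestronglyMeasurable _) (by norm_num)
  have hchain : ∀ M i t, i ≤ 2 ^ M → eLpNorm (schrodinger t (v (rep M i))) 4 volume ≤
      ∑ n ∈ Finset.range (M + 1), X n t := by
    intro M
    induction M with
    | zero =>
      intro i t hi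
      rw [Finset.sum_range_one]
      exact hDX 0 i t hi
    | succ M ih =>
      intro i t hi
      have h2 : v (rep (M + 1) i) = v (rep M (idx M (rep (M + 1) i))) + D (M + 1) i := by
        simp [hD]
      rw [h2, Finset.sum_range_succ]
      exact (hadd t _ _).trans (add_le_add (ih _ t (hidx M _)) (hDX (M + 1) i t hi))
  -- The error of stopping at scale `M`. It is controlled without the free estimate and vanishes as
  -- `M → ∞` because `S` and `R` are fixed.
  set rem : ℕ → ℝ≥0∞ := fun M => (S.card : ℝ≥0∞) ^ (1 / 4 : ℝ) *
    ((S.card : ℝ≥0∞) ^ (1 / 2 : ℝ) * ENNReal.ofReal ((R / 2 ^ M) ^ θ) ^ (1 / 4 : ℝ)) with hrem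
  have hrem0 : Tendsto rem atTop (𝓝 0) := by
    have a1 : Tendsto (fun M : ℕ => R / 2 ^ M) atTop (𝓝 0) := by
      have := (tendsto_pow_atTop_nhds_zero_of_lt_one (by norm_num : (0 : ℝ) ≤ 1 / 2)
        (by norm_num)).const_mul R
      simpa [div_eq_mul_inv] using this
    have a2 : Tendsto (fun M : ℕ => (R / 2 ^ M) ^ θ) atTop (𝓝 0) := by
      have := a1.rpow_const (p := θ) (Or.inr (by linarith))
      rwa [Real.zero_rpow (by linarith)] at this
    have a3 := (ENNReal.continuous_rpow_const (y := 1 / 4)).tendsto _ |>.comp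
      (ENNReal.tendsto_ofReal a2)
    rw [ENNReal.ofReal_zero, ENNReal.zero_rpow_of_pos (by norm_num)] at a3
    have hfin : ∀ y : ℝ, 0 ≤ y → (S.card : ℝ≥0∞) ^ y ≠ ∞ := fun y hy =>
      (ENNReal.rpow_lt_top_of_nonneg hy (by simp)).ne
    have a4 := ENNReal.Tendsto.const_mul (ENNReal.Tendsto.const_mul a3
      (Or.inr (hfin (1 / 2) (by norm_num)))) (Or.inr (hfin (1 / 4) (by norm_num)))
    simpa [hrem] using a4
  have hpt : ∀ M t, eLpNorm (schrodinger t (v t)) 4 volume ≤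
      ∑ n ∈ Finset.range (M + 1), X n t + rem M := by
    intro M t
    set x := rep M (idx M t) with hx
    have h2 : v t = v x + (v t - v x) := by simp
    rw [h2]
    refine (hadd t _ _).trans (add_le_add (hchain M _ t (hidx M t)) ?_)
    have hb := (hv t).sub (hv x)
    refine ((hb.schrodinger t).eLpNorm_four_le).trans ?_
    rw [← ofReal_norm, norm_schrodinger, ofReal_norm]
    refine mul_le_mul_right (hb.enorm_le_of_sum_four ((hinc _ _).trans
      (ENNReal.ofReal_le_ofReal ?_))) _
    have := hrep M t
    rw [abs_sub_comm] at this
    gcongr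
  -- `r⁴ = 2 · 2^{-θ}` is the number of links times the energy per link, from one scale to the next;
  -- `θ > 1` makes it less than one.
  set r : ℝ := 2 ^ (-((θ - 1) / 4)) with hr
  have hr0 : 0 ≤ r := by positivity
  have hr1 : r < 1 := Real.rpow_lt_one_of_one_lt_of_neg (by norm_num) (by linarith)
  set K : ℝ≥0∞ := (8 * Q * ENNReal.ofReal (R ^ θ)) ^ (1 / 4 : ℝ) with hK
  have hXn : ∀ n, eLpNorm (X n) 4 μ ≤ K * ENNReal.ofReal (r ^ n) := by
    intro n
    rw [eLpNorm_four_eq]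
    have h2 : ∀ t, X n t ^ 4 = Y n t := by
      intro t
      simp only [hX]
      rw [← ENNReal.rpow_natCast, ← ENNReal.rpow_mul]
      norm_num
    simp_rw [h2, hY]
    rw [lintegral_finsetSum _ fun i _ => (hDband n i).measurable_eLpNorm_four.pow_const 4]
    have h3 : ∑ i ∈ Finset.range (2 ^ n + 1),
        ∫⁻ t, eLpNorm (schrodinger t (D n i)) 4 volume ^ 4 ∂μ ≤
        8 * Q * ENNReal.ofReal (R ^ θ) * ENNReal.ofReal (r ^ n) ^ 4 := by
      calc _ ≤ ∑ i ∈ Finset.range (2 ^ n + 1),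
              Q * ENNReal.ofReal (4 * R ^ θ * (2 ^ (-θ)) ^ n) :=
            Finset.sum_le_sum fun i _ => (hQ _ (hDband n i)).trans
              (mul_le_mul_right (hDle n i) _)
        _ = Q * ENNReal.ofReal ((2 ^ n + 1) * (4 * R ^ θ * (2 ^ (-θ)) ^ n)) := by
            rw [Finset.sum_const, Finset.card_range, nsmul_eq_mul,
              ENNReal.ofReal_mul (p := 2 ^ n + 1) (by positivity)]
            have : ((2 ^ n + 1 : ℕ) : ℝ≥0∞) = ENNReal.ofReal (2 ^ n + 1) := by
              rw [← ENNReal.ofReal_natCast]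
              push_cast
              rfl
            rw [this]
            ring
        _ ≤ Q * ENNReal.ofReal (8 * (R ^ θ) * (r ^ n) ^ 4) := by
            refine mul_le_mul_right (ENNReal.ofReal_le_ofReal ?_) _
            have h5 : (r ^ n) ^ 4 = 2 ^ n * (2 ^ (-θ)) ^ n := by
              rw [← mul_pow, ← pow_mul, mul_comm n 4, pow_mul]
              congr 1
              rw [hr, ← Real.rpow_natCast, ← Real.rpow_mul (by norm_num)]
              nth_rw 2 [← Real.rpow_one 2]
              rw [← Real.rpow_add (by norm_num)]
              congr 1
              push_cast
              ring
            rw [h5]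
            have h6 : (1 : ℝ) ≤ 2 ^ n := one_le_pow₀ (by norm_num)
            have h7 : 0 ≤ R ^ θ * (2 ^ (-θ)) ^ n := by positivity
            nlinarith
        _ = _ := by
            rw [ENNReal.ofReal_mul (by positivity), ENNReal.ofReal_mul (by norm_num),
              ENNReal.ofReal_pow (by positivity), ENNReal.ofReal_ofNat]
            ring
    refine (ENNReal.rpow_le_rpow h3 (by norm_num)).trans (le_of_eq ?_)
    rw [ENNReal.mul_rpow_of_nonneg _ _ (by norm_num), ← ENNReal.rpow_natCast, ← ENNReal.rpow_mul]
    norm_num [hK]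
  have hM : ∀ M, mixedNorm 4 4 (Set.Icc 0 T) (fun t => schrodinger t (v t)) ≤
      K * ENNReal.ofReal (1 - r)⁻¹ + rem M * μ Set.univ ^ (1 / 4 : ℝ) := by
    intro M
    rw [mixedNorm]
    calc eLpNorm (fun t => eLpNorm (schrodinger t (v t)) 4 volume) 4 μ
        ≤ eLpNorm ((∑ n ∈ Finset.range (M + 1), X n) + fun _ => rem M) 4 μ := by
          -- The left integrand may fail to be measurable; monotonicity of the lower integral needs
          -- no measurability.
          rw [eLpNorm_four_eq, eLpNorm_four_eq]
          gcongr with t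
          simpa using hpt M t
      _ ≤ ∑ n ∈ Finset.range (M + 1), eLpNorm (X n) 4 μ + eLpNorm (fun _ => rem M) 4 μ := by
          refine (eLpNorm_add_le ?_ aestronglyMeasurable_const (by norm_num)).trans
            (add_le_add (eLpNorm_sum_le (fun n _ => (hXm n).aestronglyMeasurable)
              (by norm_num)) le_rfl)
          have hsum : ∑ n ∈ Finset.range (M + 1), X n =
              fun a => ∑ n ∈ Finset.range (M + 1), X n a := by
            ext a
            simp
          rw [hsum]
          exact (Finset.measurable_fun_sum _ fun n _ => hXm n).aestronglyMeasurable
      _ ≤ ∑ n ∈ Finset.range (M + 1), K * ENNReal.ofReal (r ^ n) +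
            rem M * μ Set.univ ^ (1 / 4 : ℝ) := by
          refine add_le_add (Finset.sum_le_sum fun n _ => hXn n) (le_of_eq ?_)
          rw [eLpNorm_four_eq, lintegral_const, ENNReal.mul_rpow_of_nonneg _ _ (by norm_num),
            ← ENNReal.rpow_natCast, ← ENNReal.rpow_mul]
          norm_num
      _ ≤ _ := by
          rw [← Finset.mul_sum]
          gcongr
          exact sum_geometric_le hr0 hr1 _
  have hμfin : μ Set.univ ^ (1 / 4 : ℝ) ≠ ∞ := by
    refine (ENNReal.rpow_lt_top_of_nonneg (by norm_num) ?_).ne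
    simp [hμ]
  have hlim : Tendsto (fun M => K * ENNReal.ofReal (1 - r)⁻¹ + rem M * μ Set.univ ^ (1 / 4 : ℝ))
      atTop (𝓝 (K * ENNReal.ofReal (1 - r)⁻¹)) := by
    have := (ENNReal.Tendsto.mul_const hrem0 (Or.inr hμfin)).const_add
      (K * ENNReal.ofReal (1 - r)⁻¹)
    simpa using this
  exact ge_of_tendsto' hlim hM

/-! ### Assembling the frequency components -/

/-- From `x² ≤ b ≤ R` follows `x^p ≤ b^{p/2} ≤ b R^{p/2-1}`, and then `ℓ^p ⊆ ℓ⁴`. The bound is kept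
linear in `b` so that, when each `b k` is an increment, the sum over `k` is the increment of a
single function. -/
theorem sum_pow_four_le {ι : Type*} (S : Finset ι) {p : ℝ} (hp : 2 ≤ p) (hp4 : p ≤ 4)
    {x b R : ι → ℝ} (hx : ∀ k ∈ S, 0 ≤ x k) (hxb : ∀ k ∈ S, x k ^ 2 ≤ b k)
    (hbR : ∀ k ∈ S, b k ≤ R k) :
    ∑ k ∈ S, x k ^ 4 ≤ (∑ k ∈ S, b k * R k ^ (p / 2 - 1)) ^ (4 / p) := by
  have hp0 : 0 < p := by linarith
  set y : ι → ℝ := fun k => b k * R k ^ (p / 2 - 1) with hy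
  have hb0 : ∀ k ∈ S, 0 ≤ b k := fun k hk => (sq_nonneg _).trans (hxb k hk)
  have hR0 : ∀ k ∈ S, 0 ≤ R k := fun k hk => (hb0 k hk).trans (hbR k hk)
  have hy0 : ∀ k ∈ S, 0 ≤ y k := fun k hk =>
    mul_nonneg (hb0 k hk) (Real.rpow_nonneg (hR0 k hk) _)
  have hY0 : 0 ≤ ∑ k ∈ S, y k := Finset.sum_nonneg hy0
  have hpow : ∀ a : ℝ, 0 ≤ a → ∀ r : ℝ, 0 ≤ r → a ^ (1 + r) = a * a ^ r := by
    intro a ha r hr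
    rw [Real.rpow_add_of_nonneg ha (by norm_num) hr, Real.rpow_one]
  have hxy : ∀ k ∈ S, x k ^ p ≤ y k := by
    intro k hk
    calc x k ^ p = (x k ^ 2) ^ (p / 2) := by
          rw [← Real.rpow_natCast, ← Real.rpow_mul (hx k hk)]
          congr 1
          push_cast
          ring
      _ ≤ b k ^ (p / 2) := Real.rpow_le_rpow (sq_nonneg _) (hxb k hk) (by linarith)
      _ = b k * b k ^ (p / 2 - 1) := by
          rw [← hpow _ (hb0 k hk) _ (by linarith)]
          congr 1
          ring
      _ ≤ y k := mul_le_mul_of_nonneg_left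
          (Real.rpow_le_rpow (hb0 k hk) (hbR k hk) (by linarith)) (hb0 k hk)
  have hθ : 1 ≤ 4 / p := by rw [le_div_iff₀ hp0]; linarith
  calc ∑ k ∈ S, x k ^ 4 ≤ ∑ k ∈ S, y k * (∑ k ∈ S, y k) ^ (4 / p - 1) := by
        refine Finset.sum_le_sum fun k hk => ?_
        calc x k ^ 4 = (x k ^ p) ^ (4 / p) := by
              rw [← Real.rpow_mul (hx k hk), mul_div_cancel₀ _ hp0.ne']
              norm_cast
          _ ≤ y k ^ (4 / p) :=
              Real.rpow_le_rpow (Real.rpow_nonneg (hx k hk) _) (hxy k hk) (by linarith)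
          _ = y k * y k ^ (4 / p - 1) := by
              rw [← hpow _ (hy0 k hk) _ (by linarith)]
              congr 1
              ring
          _ ≤ _ := mul_le_mul_of_nonneg_left (Real.rpow_le_rpow (hy0 k hk)
              (Finset.single_le_sum hy0 hk) (by linarith)) (hy0 k hk)
    _ = _ := by
        rw [← Finset.sum_mul, ← hpow _ hY0 _ (by linarith)]
        congr 1
        ring

theorem sum_enorm_pow_four {ι : Type*} (S : Finset ι) (f : ι → L2) :
    ∑ k ∈ S, ‖f k‖ₑ ^ 4 = ENNReal.ofReal (∑ k ∈ S, ‖f k‖ ^ 4) := by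
  rw [ENNReal.ofReal_sum_of_nonneg fun k _ => by positivity]
  refine Finset.sum_congr rfl fun k _ => ?_
  rw [ENNReal.ofReal_pow (norm_nonneg _), ofReal_norm]

/-- The components `□_k e^{-itΔ} u`. -/
def component (u : ℝ → L2) (k : ℤ) (t : ℝ) : L2 := box k (pullBack u t)

theorem box_zero (k : ℤ) : box k 0 = 0 := (boxL k).map_zero

theorem box_sub (k : ℤ) (f g : L2) : box k (f - g) = box k f - box k g := (boxL k).map_sub f g

theorem box_sum {ι : Type*} (k : ℤ) (s : Finset ι) (f : ι → L2) :
    box k (∑ i ∈ s, f i) = ∑ i ∈ s, box k (f i) := map_sum (boxL k) f s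

theorem schrodinger_sum {ι : Type*} (t : ℝ) (s : Finset ι) (f : ι → L2) :
    schrodinger t (∑ i ∈ s, f i) = ∑ i ∈ s, schrodinger t (f i) := map_sum (schrodingerL t) f s

theorem box_sum_of_box_eq {S : Finset ℤ} {f : ℤ → L2} (hf : ∀ k ∈ S, box k (f k) = f k) {k : ℤ}
    (hk : k ∈ S) : box k (∑ l ∈ S, f l) = f k := by
  rw [box_sum, Finset.sum_eq_single_of_mem k hk, hf k hk]
  intro l hl hlk
  rw [← hf l hl]
  exact box_box_of_ne hlk.symm _

theorem bandLimited_sum_of_box_eq {S : Finset ℤ} {f : ℤ → L2} (hf : ∀ k ∈ S, box k (f k) = f k) :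
    BandLimited S (∑ l ∈ S, f l) := by
  refine BandLimited.sum _ fun l hl => ?_
  rw [← hf l hl]
  exact bandLimited_box hl _

/-- Orthogonality of the frequency components. -/
theorem norm_sq_sum_le_of_box_eq {S : Finset ℤ} {f : ℤ → L2} (hf : ∀ k ∈ S, box k (f k) = f k) :
    ‖∑ l ∈ S, f l‖ ^ 2 ≤ ∑ l ∈ S, ‖f l‖ ^ 2 := by
  have h := (bandLimited_sum_of_box_eq hf).enorm_sq_le
  have h2 : ∑ k ∈ S, ‖box k (∑ l ∈ S, f l)‖ₑ ^ 2 = ENNReal.ofReal (∑ l ∈ S, ‖f l‖ ^ 2) := by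
    rw [ENNReal.ofReal_sum_of_nonneg fun k _ => by positivity]
    refine Finset.sum_congr rfl fun k hk => ?_
    rw [box_sum_of_box_eq hf hk, ENNReal.ofReal_pow (norm_nonneg _), ofReal_norm]
  rw [h2, ← ofReal_norm, ← ENNReal.ofReal_pow (norm_nonneg _),
    ENNReal.ofReal_le_ofReal_iff (Finset.sum_nonneg fun k _ => by positivity)] at h
  exact h

theorem component_box (u : ℝ → L2) (k : ℤ) (t : ℝ) : box k (component u k t) = component u k t :=
  box_box_self _ _

theorem schrodinger_sum_component (S : Finset ℤ) (u : ℝ → L2) (t : ℝ) :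
    schrodinger t (∑ k ∈ S, component u k t) = ∑ k ∈ S, box k (u t) := by
  rw [schrodinger_sum]
  refine Finset.sum_congr rfl fun k _ => ?_
  rw [component, ← box_schrodinger, pullBack, schrodinger_neg]

theorem pullBack_sum_box (S : Finset ℤ) (u : ℝ → L2) (t : ℝ) :
    pullBack (fun t => ∑ k ∈ S, box k (u t)) t = ∑ k ∈ S, component u k t := by
  rw [pullBack, schrodinger_sum]
  refine Finset.sum_congr rfl fun k _ => ?_
  rw [component, pullBack, box_schrodinger]

/-- A family of controls for the components of `u` with frequencies in `S`. -/
def ControlledFamily (S : Finset ℤ) (u : ℝ → L2) (M : ℤ → ℝ) (W : ℤ → EReal → L2)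
    (B : ℤ → EReal → ℝ) : Prop :=
  ∀ k ∈ S, Controlled (component u k) (4 * M k ^ 2) (W k) (B k)

theorem exists_controlledFamily {S : Finset ℤ} {u : ℝ → L2} {M : ℤ → ℝ} (hM : ∀ k, 0 < M k)
    (hu : ∀ k ∈ S, uNorm 2 (component u k) < ENNReal.ofReal (M k)) :
    ∃ W B, ControlledFamily S u M W B := by
  have : ∀ k, ∃ W B, k ∈ S → Controlled (component u k) (4 * M k ^ 2) W B := by
    intro k
    by_cases hk : k ∈ S
    · obtain ⟨W, B, h⟩ := exists_controlled_of_uNorm_lt (hM k) (hu k hk)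
      exact ⟨W, B, fun _ => h⟩
    · exact ⟨0, 0, fun h => absurd h hk⟩
  choose W B h using this
  exact ⟨W, B, fun k hk => h k hk⟩

theorem ControlledFamily.box_eq {S : Finset ℤ} {u : ℝ → L2} {M : ℤ → ℝ} {W : ℤ → EReal → L2}
    {B : ℤ → EReal → ℝ} (h : ControlledFamily S u M W B) (s : EReal) :
    ∀ k ∈ S, box k (W k s) = W k s := by
  intro k hk
  induction s with
  | bot => rw [(h k hk).bot, box_zero]
  | top => rw [(h k hk).top, box_zero]
  | coe s => rw [(h k hk).coe, component_box]

theorem ControlledFamily.sum_eq {S : Finset ℤ} {u : ℝ → L2} {M : ℤ → ℝ} {W : ℤ → EReal → L2}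
    {B : ℤ → EReal → ℝ} (h : ControlledFamily S u M W B) (t : ℝ) :
    ∑ k ∈ S, component u k t = ∑ k ∈ S, W k t :=
  Finset.sum_congr rfl fun k hk => ((h k hk).coe t).symm

/-- Chaining with `θ = 4/p`: the range of the common function is `R = 2^p ∑ M_k^p`, and `(R^θ)^{1/4}
= R^{1/p}` returns the `ℓ^p` norm of the `M_k`. -/
theorem ControlledFamily.mixedNorm_four_le {S : Finset ℤ} (hS : S.Nonempty) {u : ℝ → L2}
    {M : ℤ → ℝ} (hM : ∀ k, 0 < M k) {W : ℤ → EReal → L2} {B : ℤ → EReal → ℝ}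
    (h : ControlledFamily S u M W B) {p : ℝ} (hp : 2 ≤ p) (hp4 : p < 4) {T : ℝ} {Q : ℝ≥0∞}
    (hQ : ∀ f : L2, BandLimited S f →
      ∫⁻ t in Set.Icc 0 T, eLpNorm (schrodinger t f) 4 volume ^ 4 ≤ Q * ∑ k ∈ S, ‖box k f‖ₑ ^ 4) :
    mixedNorm 4 4 (Set.Icc 0 T) (fun t => ∑ k ∈ S, box k (u t)) ≤
      (8 * Q) ^ (1 / 4 : ℝ) * ENNReal.ofReal (2 * (1 - 2 ^ (-((4 / p - 1) / 4)))⁻¹) *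
        (∑ k ∈ S, ENNReal.ofReal (M k) ^ p) ^ (1 / p) := by
  have hp0 : 0 < p := by linarith
  set R : ℝ := ∑ k ∈ S, (4 * M k ^ 2) * (4 * M k ^ 2) ^ (p / 2 - 1) with hR
  -- The weights `(4M_k²)^{p/2-1}` put the separate controls on one scale, so that all components
  -- are discretised in time by the levels of one function.
  set A : ℝ → ℝ := fun t => ∑ k ∈ S, B k t * (4 * M k ^ 2) ^ (p / 2 - 1) with hA
  have hM2 : ∀ k, 0 < 4 * M k ^ 2 := fun k => by have := hM k; positivity
  have hRpos : 0 < R := Finset.sum_pos (fun k _ => mul_pos (hM2 k) (Real.rpow_pos_of_pos (hM2 k) _)) hS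
  have hv : ∀ t : ℝ, (fun t => ∑ k ∈ S, box k (u t)) t = schrodinger t (∑ k ∈ S, W k t) := by
    intro t
    rw [← h.sum_eq, schrodinger_sum_component]
  have hord : ∀ s s' : ℝ, s ≤ s' →
      ∑ k ∈ S, ‖W k s' - W k s‖ ^ 4 ≤ |A s' - A s| ^ (4 / p) := by
    intro s s' hs
    have hs' : (s : EReal) ≤ s' := EReal.coe_le_coe_iff.2 hs
    have h2 := sum_pow_four_le S hp hp4.le (x := fun k => ‖W k s' - W k s‖)
      (b := fun k => B k s' - B k s) (R := fun k => 4 * M k ^ 2) (fun k _ => norm_nonneg _)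
      (fun k hk => (h k hk).sq_le _ _ hs')
      (fun k hk => by linarith [(h k hk).nonneg s, (h k hk).le s'])
    have h3 : ∑ k ∈ S, (B k s' - B k s) * (4 * M k ^ 2) ^ (p / 2 - 1) = A s' - A s := by
      simp only [hA]
      rw [← Finset.sum_sub_distrib]
      exact Finset.sum_congr rfl fun k _ => sub_mul _ _ _
    have h4 : 0 ≤ A s' - A s := by
      rw [← h3]
      refine Finset.sum_nonneg fun k hk => mul_nonneg ?_ (Real.rpow_nonneg (hM2 k).le _)
      linarith [(h k hk).mono hs']
    rw [h3] at h2
    rwa [abs_of_nonneg h4]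
  have hinc : ∀ s s' : ℝ, ∑ k ∈ S, ‖W k s' - W k s‖ ^ 4 ≤ |A s' - A s| ^ (4 / p) := by
    intro s s'
    rcases le_total s s' with hs | hs
    · exact hord s s' hs
    · have := hord s' s hs
      rw [abs_sub_comm] at this
      simpa only [norm_sub_rev] using this
  have hbase : ∀ s : ℝ, ∑ k ∈ S, ‖W k s‖ ^ 4 ≤ R ^ (4 / p) := fun s =>
    sum_pow_four_le S hp hp4.le (x := fun k => ‖W k s‖) (b := fun k => 4 * M k ^ 2)
      (R := fun k => 4 * M k ^ 2) (fun k _ => norm_nonneg _)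
      (fun k hk => (h k hk).norm_sq_le _) (fun k _ => le_rfl)
  have key := mixedNorm_four_le_of_increments (S := S) (T := T) (θ := 4 / p) (R := R)
    (by rw [lt_div_iff₀ hp0]; linarith) (by rw [div_le_iff₀ hp0]; linarith) hRpos hQ
    (v := fun t => ∑ k ∈ S, W k t) (fun t => bandLimited_sum_of_box_eq (h.box_eq t)) (A := A)
    (fun t => Finset.sum_nonneg fun k hk =>
      mul_nonneg ((h k hk).nonneg _) (Real.rpow_nonneg (hM2 k).le _))
    (fun t => Finset.sum_le_sum fun k hk =>
      mul_le_mul_of_nonneg_right ((h k hk).le _) (Real.rpow_nonneg (hM2 k).le _))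
    (fun s s' => by
      have : ∀ k ∈ S, ‖box k (∑ l ∈ S, W l s' - ∑ l ∈ S, W l s)‖ₑ ^ 4 = ‖W k s' - W k s‖ₑ ^ 4 := by
        intro k hk
        rw [box_sub, box_sum_of_box_eq (h.box_eq _) hk, box_sum_of_box_eq (h.box_eq _) hk]
      rw [Finset.sum_congr rfl this, sum_enorm_pow_four]
      exact ENNReal.ofReal_le_ofReal (hinc s s'))
    (fun s => by
      have : ∀ k ∈ S, ‖box k (∑ l ∈ S, W l s)‖ₑ ^ 4 = ‖W k s‖ₑ ^ 4 := by
        intro k hk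
        rw [box_sum_of_box_eq (h.box_eq _) hk]
      rw [Finset.sum_congr rfl this, sum_enorm_pow_four]
      exact ENNReal.ofReal_le_ofReal (hbase s))
  rw [funext hv]
  refine key.trans (le_of_eq ?_)
  have hRe : ENNReal.ofReal (R ^ (4 / p)) ^ (1 / 4 : ℝ) =
      ENNReal.ofReal 2 * (∑ k ∈ S, ENNReal.ofReal (M k) ^ p) ^ (1 / p) := by
    have h1 : R = 2 ^ p * ∑ k ∈ S, M k ^ p := by
      rw [hR, Finset.mul_sum]
      refine Finset.sum_congr rfl fun k _ => ?_
      nth_rw 1 [← Real.rpow_one (4 * M k ^ 2)]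
      rw [← Real.rpow_add (hM2 k), ← Real.mul_rpow (by norm_num) (hM k).le,
        show (4 : ℝ) * M k ^ 2 = (2 * M k) ^ (2 : ℝ) by rw [Real.rpow_two]; ring,
        ← Real.rpow_mul (by have := hM k; positivity)]
      congr 1
      ring
    have h2 : ∑ k ∈ S, ENNReal.ofReal (M k) ^ p = ENNReal.ofReal (∑ k ∈ S, M k ^ p) := by
      rw [ENNReal.ofReal_sum_of_nonneg fun k _ => Real.rpow_nonneg (hM k).le _]
      exact Finset.sum_congr rfl fun k _ => ENNReal.ofReal_rpow_of_pos (hM k)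
    have h3 : 0 ≤ ∑ k ∈ S, M k ^ p := Finset.sum_nonneg fun k _ => Real.rpow_nonneg (hM k).le _
    rw [h2, ENNReal.ofReal_rpow_of_nonneg (by positivity) (by norm_num),
      ENNReal.ofReal_rpow_of_nonneg h3 (by positivity), ← ENNReal.ofReal_mul (by norm_num),
      ← Real.rpow_mul hRpos.le, h1, show 4 / p * (1 / 4) = 1 / p by field_simp,
      Real.mul_rpow (by positivity) h3, ← Real.rpow_mul (by norm_num),
      mul_one_div_cancel hp0.ne', Real.rpow_one]
  rw [ENNReal.mul_rpow_of_nonneg _ _ (by norm_num), hRe, ENNReal.ofReal_mul (by norm_num)]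
  ring

theorem sqrt_sum_four_mul_sq {S : Finset ℤ} {M : ℤ → ℝ} (hM : ∀ k, 0 < M k) :
    ENNReal.ofReal (∑ k ∈ S, 4 * M k ^ 2) ^ (1 / 2 : ℝ) =
      2 * (∑ k ∈ S, ENNReal.ofReal (M k) ^ (2 : ℝ)) ^ (1 / 2 : ℝ) := by
  have h2 : ENNReal.ofReal (∑ k ∈ S, 4 * M k ^ 2) =
      2 ^ (2 : ℝ) * ∑ k ∈ S, ENNReal.ofReal (M k) ^ (2 : ℝ) := by
    rw [ENNReal.ofReal_sum_of_nonneg fun k _ => by positivity, Finset.mul_sum]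
    refine Finset.sum_congr rfl fun k _ => ?_
    rw [ENNReal.ofReal_mul (by norm_num), ENNReal.ofReal_pow (hM k).le]
    simp only [ENNReal.rpow_ofNat]
    norm_num
  rw [h2, ENNReal.mul_rpow_of_nonneg _ _ (by norm_num), ← ENNReal.rpow_mul]
  norm_num

theorem ControlledFamily.enorm_le {S : Finset ℤ} {u : ℝ → L2}
    {M : ℤ → ℝ} (hM : ∀ k, 0 < M k) {W : ℤ → EReal → L2} {B : ℤ → EReal → ℝ}
    (h : ControlledFamily S u M W B) (t : ℝ) :
    ‖∑ k ∈ S, box k (u t)‖ₑ ≤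
      2 * (∑ k ∈ S, ENNReal.ofReal (M k) ^ (2 : ℝ)) ^ (1 / 2 : ℝ) := by
  rw [← sqrt_sum_four_mul_sq hM, ← schrodinger_sum_component, ← ofReal_norm, norm_schrodinger,
    h.sum_eq, ENNReal.ofReal_rpow_of_nonneg (Finset.sum_nonneg fun k _ => by positivity)
      (by norm_num), ← Real.sqrt_eq_rpow]
  apply ENNReal.ofReal_le_ofReal
  apply Real.le_sqrt_of_sq_le
  exact (norm_sq_sum_le_of_box_eq (h.box_eq t)).trans
    (Finset.sum_le_sum fun k hk => (h k hk).norm_sq_le _)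

theorem ControlledFamily.mixedNorm_top_two_le {S : Finset ℤ} {u : ℝ → L2}
    {M : ℤ → ℝ} (hM : ∀ k, 0 < M k) {W : ℤ → EReal → L2} {B : ℤ → EReal → ℝ}
    (h : ControlledFamily S u M W B) :
    mixedNorm ∞ 2 Set.univ (fun t => ∑ k ∈ S, box k (u t)) ≤
      2 * (∑ k ∈ S, ENNReal.ofReal (M k) ^ (2 : ℝ)) ^ (1 / 2 : ℝ) := by
  rw [mixedNorm, eLpNorm_exponent_top]
  refine eLpNormEssSup_le_of_ae_enorm_bound (Eventually.of_forall fun t => ?_)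
  rw [enorm_eq_self, ← Lp.enorm_def]
  exact h.enorm_le hM t

theorem ControlledFamily.mixedNorm_top_top_le {S : Finset ℤ} {u : ℝ → L2}
    {M : ℤ → ℝ} (hM : ∀ k, 0 < M k) {W : ℤ → EReal → L2} {B : ℤ → EReal → ℝ}
    (h : ControlledFamily S u M W B) :
    mixedNorm ∞ ∞ Set.univ (fun t => ∑ k ∈ S, box k (u t)) ≤
      2 * (S.card : ℝ≥0∞) ^ (1 / 2 : ℝ) *
        (∑ k ∈ S, ENNReal.ofReal (M k) ^ (2 : ℝ)) ^ (1 / 2 : ℝ) := by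
  rw [mixedNorm, eLpNorm_exponent_top]
  refine eLpNormEssSup_le_of_ae_enorm_bound (Eventually.of_forall fun t => ?_)
  rw [enorm_eq_self]
  have hb : BandLimited S (∑ k ∈ S, box k (u t)) :=
    BandLimited.sum _ fun k hk => bandLimited_box hk _
  refine hb.eLpNorm_top_le.trans ((mul_le_mul_right (h.enorm_le hM t) _).trans (le_of_eq ?_))
  ring

/-- Orthogonality turns each squared increment of the sum into a sum over `k` of increments of `B
k`, which telescope along any partition. The conventions at `±∞` agree with `W`, which vanishes at
both ends. -/
theorem ControlledFamily.vNormΔ_le {S : Finset ℤ} {u : ℝ → L2}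
    {M : ℤ → ℝ} (hM : ∀ k, 0 < M k) {W : ℤ → EReal → L2} {B : ℤ → EReal → ℝ}
    (h : ControlledFamily S u M W B) :
    vNormΔ 2 (fun t => ∑ k ∈ S, box k (u t)) ≤
      2 * (∑ k ∈ S, ENNReal.ofReal (M k) ^ (2 : ℝ)) ^ (1 / 2 : ℝ) := by
  have hpb : pullBack (fun t => ∑ k ∈ S, box k (u t)) = fun t => ∑ k ∈ S, component u k t :=
    funext fun t => pullBack_sum_box S u t
  have hbot : Tendsto (fun t => ∑ k ∈ S, component u k t) atBot (𝓝 0) := by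
    have := tendsto_finsetSum S fun k hk => (h k hk).tendsto_bot
    simpa using this
  have htop : ∃ r, Tendsto (fun t => ∑ k ∈ S, component u k t) atTop (𝓝 r) := by
    have : ∀ k, ∃ r, k ∈ S → Tendsto (component u k) atTop (𝓝 r) := fun k => by
      by_cases hk : k ∈ S
      · obtain ⟨r, hr⟩ := (h k hk).tendsto_top
        exact ⟨r, fun _ => hr⟩
      · exact ⟨0, fun h1 => absurd h1 hk⟩
    choose r hr using this
    exact ⟨_, tendsto_finsetSum S fun k hk => hr k hk⟩
  have hext : ∀ s, extend 0 (fun t => ∑ k ∈ S, component u k t) s = ∑ k ∈ S, W k s := by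
    intro s
    induction s with
    | bot =>
      rw [extend, if_pos rfl]
      exact (Finset.sum_eq_zero fun k hk => (h k hk).bot).symm
    | top =>
      rw [extend, if_neg (by simp), if_pos rfl]
      exact (Finset.sum_eq_zero fun k hk => (h k hk).top).symm
    | coe s =>
      rw [extend, if_neg (EReal.coe_ne_bot s), if_neg (EReal.coe_ne_top s), EReal.toReal_coe]
      exact h.sum_eq s
  rw [vNormΔ, vNorm, hpb]
  refine (iInf₂_le (0 : L2) hbot).trans ((iInf_le _ htop).trans (iSup_le fun P => ?_))
  simp only [hext]
  rw [← sqrt_sum_four_mul_sq hM]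
  refine ENNReal.rpow_le_rpow ?_ (by norm_num)
  have hone : ∀ j : Fin P.K, ‖∑ k ∈ S, W k (P.t j.succ) - ∑ k ∈ S, W k (P.t j.castSucc)‖ ^ 2 ≤
      ∑ k ∈ S, (B k (P.t j.succ) - B k (P.t j.castSucc)) := by
    intro j
    rw [← Finset.sum_sub_distrib]
    refine (norm_sq_sum_le_of_box_eq fun k hk => ?_).trans (Finset.sum_le_sum fun k hk => ?_)
    · rw [box_sub, h.box_eq _ k hk, h.box_eq _ k hk]
    · exact (h k hk).sq_le _ _ (P.strictMono Fin.castSucc_lt_succ).le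
  have hsum : ∑ j : Fin P.K, ‖∑ k ∈ S, W k (P.t j.succ) - ∑ k ∈ S, W k (P.t j.castSucc)‖ ^ 2 ≤
      ∑ k ∈ S, 4 * M k ^ 2 := by
    refine (Finset.sum_le_sum fun j _ => hone j).trans ?_
    rw [Finset.sum_comm]
    refine Finset.sum_le_sum fun k hk => ?_
    have h1 := sum_fin_telescope P.K fun j => -B k (P.t j)
    simp only [neg_sub_neg] at h1
    rw [h1]
    linarith [(h k hk).le (P.t (Fin.last P.K)), (h k hk).nonneg (P.t 0)]
  refine le_trans (le_of_eq ?_) (ENNReal.ofReal_le_ofReal hsum)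
  rw [ENNReal.ofReal_sum_of_nonneg fun k _ => by positivity]
  refine Finset.sum_congr rfl fun j _ => ?_
  rw [ENNReal.ofReal_pow (norm_nonneg _), ofReal_norm]
  simp

/-! ### From majorants to norms, and Hölder in the frequency index -/

/-- A bound for all majorants of the `U k` is a bound for the `U k` themselves. -/
theorem le_of_forall_majorant {S : Finset ℤ} {U : ℤ → ℝ≥0∞} {L K : ℝ≥0∞} {p : ℝ} (hp : 0 < p)
    (hK : K ≠ ∞) (hK0 : S.Nonempty → K ≠ 0)
    (h : ∀ M : ℤ → ℝ, (∀ k, 0 < M k) → (∀ k ∈ S, U k < ENNReal.ofReal (M k)) →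
      L ≤ K * (∑ k ∈ S, ENNReal.ofReal (M k) ^ p) ^ (1 / p)) :
    L ≤ K * (∑ k ∈ S, U k ^ p) ^ (1 / p) := by
  by_cases hfin : ∀ k ∈ S, U k ≠ ∞
  · have hη : ∀ η : ℝ, 0 < η →
        L ≤ K * (∑ k ∈ S, (U k + ENNReal.ofReal η) ^ p) ^ (1 / p) := by
      intro η hη
      have hUe : ∀ k ∈ S, ENNReal.ofReal ((U k).toReal + η) = U k + ENNReal.ofReal η := by
        intro k hk
        rw [ENNReal.ofReal_add ENNReal.toReal_nonneg hη.le, ENNReal.ofReal_toReal (hfin k hk)]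
      -- The strict majorants `U k + η` are inserted and `η` tends to `0`.
      have h1 := h (fun k => (U k).toReal + η)
        (fun k => by have := ENNReal.toReal_nonneg (a := U k); linarith) (fun k hk => by
          rw [hUe k hk]
          exact ENNReal.lt_add_right (hfin k hk) (by simpa using hη))
      refine h1.trans (le_of_eq ?_)
      congr 2
      exact Finset.sum_congr rfl fun k hk => by rw [hUe k hk]
    have ht : Tendsto (fun η : ℝ => K * (∑ k ∈ S, (U k + ENNReal.ofReal η) ^ p) ^ (1 / p))
        (𝓝[>] 0) (𝓝 (K * (∑ k ∈ S, U k ^ p) ^ (1 / p))) := by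
      have h0 : Tendsto (fun η : ℝ => ENNReal.ofReal η) (𝓝[>] 0) (𝓝 0) := by
        have := (ENNReal.continuous_ofReal.tendsto 0).mono_left
          (nhdsWithin_le_nhds (s := Set.Ioi (0 : ℝ)))
        simpa using this
      have h1 : ∀ k ∈ S, Tendsto (fun η : ℝ => (U k + ENNReal.ofReal η) ^ p) (𝓝[>] 0)
          (𝓝 (U k ^ p)) := by
        intro k _
        have := h0.const_add (U k)
        rw [add_zero] at this
        exact ((ENNReal.continuous_rpow_const (y := p)).tendsto _).comp this
      have h2 := ((ENNReal.continuous_rpow_const (y := 1 / p)).tendsto _).comp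
        (tendsto_finsetSum S h1)
      exact ENNReal.Tendsto.const_mul h2 (Or.inr hK)
    refine ge_of_tendsto ht ?_
    filter_upwards [self_mem_nhdsWithin] with η hη'
    exact hη η hη'
  -- If some `U k` is infinite there is no majorant, but the right side is `K · ∞ = ∞`; this is why
  -- `K ≠ 0` is required.
  · push Not at hfin
    obtain ⟨k, hk, hkU⟩ := hfin
    have h1 : ∑ k ∈ S, U k ^ p = ∞ := by
      refine ENNReal.sum_eq_top.2 ⟨k, hk, ?_⟩
      rw [hkU, ENNReal.top_rpow_of_pos hp]
    rw [h1, ENNReal.top_rpow_of_pos (by positivity), ENNReal.mul_top (hK0 ⟨k, hk⟩)]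
    exact le_top

theorem sum_rpow_le_card_mul (S : Finset ℤ) (U : ℤ → ℝ≥0∞) {p q : ℝ} (hp : 0 < p)
    (hpq : p ≤ q) :
    (∑ k ∈ S, U k ^ p) ^ (1 / p) ≤
      (S.card : ℝ≥0∞) ^ (1 / p - 1 / q) * (∑ k ∈ S, U k ^ q) ^ (1 / q) := by
  have hq : 0 < q := hp.trans_le hpq
  have h := ENNReal.rpow_sum_le_const_mul_sum_rpow S (fun k => U k ^ p)
    (p := q / p) (by rw [le_div_iff₀ hp]; linarith)
  have h2 : ∀ k, (U k ^ p) ^ (q / p) = U k ^ q := fun k => by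
    rw [← ENNReal.rpow_mul, mul_div_cancel₀ _ hp.ne']
  simp_rw [h2] at h
  have h3 := ENNReal.rpow_le_rpow h (by positivity : 0 ≤ 1 / q)
  rw [ENNReal.mul_rpow_of_nonneg _ _ (by positivity), ← ENNReal.rpow_mul, ← ENNReal.rpow_mul] at h3
  have e1 : q / p * (1 / q) = 1 / p := by field_simp
  have e2 : (q / p - 1) * (1 / q) = 1 / p - 1 / q := by field_simp
  rwa [e1, e2] at h3

theorem mixedNorm_zero (p r : ℝ≥0∞) (J : Set ℝ) : mixedNorm p r J (fun _ => 0) = 0 := by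
  have : eLpNorm ((0 : L2) : ℝ → ℂ) r volume = 0 := by
    rw [eLpNorm_congr_ae (Lp.coeFn_zero ℂ 2 volume)]
    exact eLpNorm_zero
  rw [mixedNorm, this]
  exact eLpNorm_zero

theorem proj_eq_sum {I : Set ℝ} {S : Finset ℤ} (hS : ∀ k : ℤ, k ∈ S ↔ (k : ℝ) ∈ I) (u : ℝ → L2) :
    proj I u = fun t => ∑ k ∈ S, box k (u t) := by
  funext t
  have h : {k : ℤ | (k : ℝ) ∈ I} = (S : Set ℤ) := by
    ext k
    exact (hS k).symm
  rw [proj]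
  calc ∑ᶠ k : {k : ℤ | (k : ℝ) ∈ I}, box k (u t) = ∑ᶠ k ∈ {k : ℤ | (k : ℝ) ∈ I}, box k (u t) :=
        finsum_set_coe_eq_finsum_mem (f := fun k : ℤ => box k (u t)) {k : ℤ | (k : ℝ) ∈ I}
    _ = _ := by rw [h, finsum_mem_coe_finset]

theorem one_le_bracket (x : ℝ) : 1 ≤ bracket x :=
  Real.one_le_sqrt.2 (by nlinarith [sq_nonneg x])

theorem abs_le_bracket (x : ℝ) : |x| ≤ bracket x :=
  Real.abs_le_sqrt (by linarith)

/-- Removes the weight `⟨k⟩^{1/2}` from the `X` norm at the price of `W`, a bound for `⟨k⟩^{-1/2}`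
on `S`. -/
theorem sum_rpow_le_xNormΔ {I : Set ℝ} {S : Finset ℤ} (hS : ∀ k : ℤ, k ∈ S ↔ (k : ℝ) ∈ I) {q : ℝ}
    (hq : 0 < q) {W : ℝ≥0∞} (hW : ∀ k ∈ S, ENNReal.ofReal (bracket k ^ (-(1 / 2) : ℝ)) ≤ W)
    (u : ℝ → L2) :
    (∑ k ∈ S, uNorm 2 (component u k) ^ q) ^ (1 / q) ≤ W * xNormΔ (1 / 2) q I u := by
  set f : ℤ → ℝ≥0∞ := fun k =>
    ENNReal.ofReal (bracket k ^ (1 / 2 * q)) * uNorm 2 (component u k) ^ q with hf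
  have hx : xNormΔ (1 / 2) q I u = (∑ k ∈ S, f k) ^ (1 / q) := by
    rw [xNormΔ, xNorm, ← Finset.tsum_subtype S f]
    congr 1
    exact ((Equiv.subtypeEquivRight hS).tsum_eq (fun k : {k : ℤ // (k : ℝ) ∈ I} => f k)).symm
  have hterm : ∀ k ∈ S, uNorm 2 (component u k) ^ q ≤ W ^ q * f k := by
    intro k hk
    have hb : 0 < bracket k := lt_of_lt_of_le one_pos (one_le_bracket k)
    have h1 : 1 ≤ W ^ q * ENNReal.ofReal (bracket k ^ (1 / 2 * q)) := by
      calc (1 : ℝ≥0∞) = ENNReal.ofReal (bracket k ^ (-(1 / 2) : ℝ)) ^ q *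
            ENNReal.ofReal (bracket k ^ (1 / 2 * q)) := by
            rw [ENNReal.ofReal_rpow_of_pos (Real.rpow_pos_of_pos hb _), ← Real.rpow_mul hb.le,
              ← ENNReal.ofReal_mul (Real.rpow_nonneg hb.le _), ← Real.rpow_add hb]
            norm_num
        _ ≤ _ := by
            gcongr
            exact hW k hk
    calc uNorm 2 (component u k) ^ q = 1 * uNorm 2 (component u k) ^ q := (one_mul _).symm
      _ ≤ W ^ q * ENNReal.ofReal (bracket k ^ (1 / 2 * q)) * uNorm 2 (component u k) ^ q := by
          gcongr
      _ = _ := mul_assoc _ _ _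
  rw [hx]
  calc (∑ k ∈ S, uNorm 2 (component u k) ^ q) ^ (1 / q) ≤ (∑ k ∈ S, W ^ q * f k) ^ (1 / q) :=
        ENNReal.rpow_le_rpow (Finset.sum_le_sum hterm) (by positivity)
    _ = _ := by
        rw [← Finset.mul_sum, ENNReal.mul_rpow_of_nonneg _ _ (by positivity), ← ENNReal.rpow_mul,
          mul_one_div_cancel hq.ne', ENNReal.rpow_one]

/-! ### The estimates for a finite set of frequencies -/

/-- The four estimates for finitely many frequencies, in terms of a bound `N` for their number and
a bound `W` for their weights. -/
theorem exists_finite_frequency_estimates {ε : ℝ} (hε : 0 < ε) (hε' : ε < 1 / 10) :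
    ∃ C : ℝ, 0 < C ∧ ∀ (q : ℝ), 4 ≤ q → ∀ (T : ℝ), 0 < T → T < 1 → ∀ (I : Set ℝ) (S : Finset ℤ),
      (∀ k : ℤ, k ∈ S ↔ (k : ℝ) ∈ I) → ∀ (N W : ℝ≥0∞), (S.card : ℝ≥0∞) ≤ N →
      (∀ k ∈ S, ENNReal.ofReal (bracket k ^ (-(1 / 2) : ℝ)) ≤ W) → ∀ u : ℝ → L2,
      mixedNorm 4 4 (Set.Icc 0 T) (proj I u) ≤ ENNReal.ofReal (C * T ^ (ε / 3)) *
        N ^ (1 / 4 - 1 / q + ε) * W * xNormΔ (1 / 2) q I u ∧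
      mixedNorm ∞ 2 Set.univ (proj I u) ≤ ENNReal.ofReal C *
        N ^ (1 / 2 - 1 / q) * W * xNormΔ (1 / 2) q I u ∧
      vNormΔ 2 (proj I u) ≤ ENNReal.ofReal C *
        N ^ (1 / 2 - 1 / q) * W * xNormΔ (1 / 2) q I u ∧
      mixedNorm ∞ ∞ Set.univ (proj I u) ≤ ENNReal.ofReal C *
        N ^ (1 - 1 / q) * W * xNormΔ (1 / 2) q I u := by
  -- After the fourth root, `δ = 4ε/3` gives `T^{δ/4} = T^{ε/3}` and `|S|^{5δ/8} = |S|^{5ε/6}`.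
  obtain ⟨C₀, hC₀, hfree⟩ := exists_schrodinger_estimate (δ := 4 * ε / 3) (by positivity)
    (by linarith)
  -- `p` lies just below `4`, so that `4/p > 1`. Hölder from `ℓ^p` to `ℓ^q` costs `|S|^{1/4 + ε/6 -
  -- 1/q}`; with the `5ε/6` of the free estimate this exhausts the allowed loss `ε`.
  set p : ℝ := (1 / 4 + ε / 6)⁻¹ with hp
  have hpinv : 1 / p = 1 / 4 + ε / 6 := by rw [hp, one_div, inv_inv]
  have hp0 : 0 < p := by rw [hp]; positivity
  have hp2 : 2 ≤ p := by
    rw [hp, le_inv_comm₀ (by norm_num) (by positivity)]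
    linarith
  have hp4 : p < 4 := by
    rw [hp, inv_lt_comm₀ (by positivity) (by norm_num)]
    linarith
  set G : ℝ := 2 * (1 - 2 ^ (-((4 / p - 1) / 4)))⁻¹ with hG
  have hGpos : 0 < G := by
    have h1 : 1 < 4 / p := by rw [lt_div_iff₀ hp0]; linarith
    have h2 : (2 : ℝ) ^ (-((4 / p - 1) / 4)) < 1 :=
      Real.rpow_lt_one_of_one_lt_of_neg (by norm_num) (by linarith)
    have h3 : 0 < 1 - (2 : ℝ) ^ (-((4 / p - 1) / 4)) := by linarith
    rw [hG]
    positivity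
  set C₁ : ℝ := (8 * C₀) ^ (1 / 4 : ℝ) * G with hC₁
  have hC₁pos : 0 < C₁ := by rw [hC₁]; positivity
  refine ⟨max C₁ 2, by positivity, fun q hq T hT hT1 I S hS N W hN hW u => ?_⟩
  have hq0 : 0 < q := by linarith
  have hq4 : 1 / q ≤ 1 / 4 := one_div_le_one_div_of_le (by norm_num) hq
  rw [proj_eq_sum hS]
  set X := xNormΔ (1 / 2) q I u with hX
  set U : ℤ → ℝ≥0∞ := fun k => uNorm 2 (component u k) with hU
  have hXle : (∑ k ∈ S, U k ^ q) ^ (1 / q) ≤ W * X := sum_rpow_le_xNormΔ hS hq0 hW u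
  have hHold : ∀ r : ℝ, 0 < r → r ≤ q → (∑ k ∈ S, U k ^ r) ^ (1 / r) ≤
      (S.card : ℝ≥0∞) ^ (1 / r - 1 / q) * (W * X) := fun r hr hrq =>
    (sum_rpow_le_card_mul S U hr hrq).trans (by gcongr)
  have h2C : (2 : ℝ≥0∞) ≤ ENNReal.ofReal (max C₁ 2) := by
    rw [← ENNReal.ofReal_ofNat]
    exact ENNReal.ofReal_le_ofReal (le_max_right _ _)
  have hcard0 : ∀ y : ℝ, S.Nonempty → (S.card : ℝ≥0∞) ^ y ≠ 0 := fun y hne => by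
    refine (ENNReal.rpow_pos ?_ (by simp)).ne'
    exact_mod_cast hne.card_pos
  have hcardT : ∀ y : ℝ, 0 ≤ y → (S.card : ℝ≥0∞) ^ y ≠ ∞ := fun y hy =>
    (ENNReal.rpow_lt_top_of_nonneg hy (by simp)).ne
  have hhalf : ∀ L : ℝ≥0∞, L ≤ 2 * (∑ k ∈ S, U k ^ (2 : ℝ)) ^ (1 / 2 : ℝ) →
      L ≤ ENNReal.ofReal (max C₁ 2) * N ^ (1 / 2 - 1 / q) * W * X := by
    intro L hL
    refine hL.trans ?_
    calc 2 * (∑ k ∈ S, U k ^ (2 : ℝ)) ^ (1 / 2 : ℝ)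
        ≤ 2 * ((S.card : ℝ≥0∞) ^ (1 / 2 - 1 / q) * (W * X)) := by
          gcongr
          exact hHold 2 (by norm_num) (by linarith)
      _ ≤ ENNReal.ofReal (max C₁ 2) * (N ^ (1 / 2 - 1 / q) * (W * X)) := by
          gcongr
          linarith
      _ = _ := by ring
  refine ⟨?_, hhalf _ ?_, hhalf _ ?_, ?_⟩
  · rcases S.eq_empty_or_nonempty with hemp | hne
    · subst hemp
      simp only [Finset.sum_empty]
      rw [mixedNorm_zero]
      exact zero_le
    set Q : ℝ≥0∞ := ENNReal.ofReal (C₀ * T ^ (4 * ε / 3) * (S.card : ℝ) ^ (5 / 2 * (4 * ε / 3)))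
      with hQ
    have hcard : (0 : ℝ) < S.card := by exact_mod_cast hne.card_pos
    have hQe : (8 * Q) ^ (1 / 4 : ℝ) * ENNReal.ofReal G =
        ENNReal.ofReal (C₁ * T ^ (ε / 3)) * (S.card : ℝ≥0∞) ^ (5 / 6 * ε) := by
      have hcr : (S.card : ℝ≥0∞) ^ (5 / 6 * ε) = ENNReal.ofReal ((S.card : ℝ) ^ (5 / 6 * ε)) := by
        rw [← ENNReal.ofReal_rpow_of_pos hcard, ENNReal.ofReal_natCast]
      have hT0 : 0 < T ^ (4 * ε / 3) := Real.rpow_pos_of_pos hT _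
      rw [hcr, hQ, ← ENNReal.ofReal_ofNat 8, ← ENNReal.ofReal_mul (by norm_num),
        ENNReal.ofReal_rpow_of_pos (by positivity), ← ENNReal.ofReal_mul (by positivity),
        ← ENNReal.ofReal_mul (by positivity)]
      congr 1
      rw [show 8 * (C₀ * T ^ (4 * ε / 3) * (S.card : ℝ) ^ (5 / 2 * (4 * ε / 3))) =
        (8 * C₀) * T ^ (4 * ε / 3) * (S.card : ℝ) ^ (5 / 2 * (4 * ε / 3)) by ring,
        Real.mul_rpow (by positivity) (by positivity), Real.mul_rpow (by positivity) hT0.le,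
        ← Real.rpow_mul hT.le, ← Real.rpow_mul hcard.le,
        show 4 * ε / 3 * (1 / 4) = ε / 3 by ring,
        show 5 / 2 * (4 * ε / 3) * (1 / 4) = 5 / 6 * ε by ring, hC₁]
      ring
    have hTpos : 0 < C₁ * T ^ (ε / 3) := mul_pos hC₁pos (Real.rpow_pos_of_pos hT _)
    have hmain := le_of_forall_majorant (S := S) (U := U)
      (L := mixedNorm 4 4 (Set.Icc 0 T) (fun t => ∑ k ∈ S, box k (u t)))
      (K := ENNReal.ofReal (C₁ * T ^ (ε / 3)) * (S.card : ℝ≥0∞) ^ (5 / 6 * ε)) hp0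
      (ENNReal.mul_ne_top ENNReal.ofReal_ne_top (hcardT _ (by positivity)))
      (fun hne => mul_ne_zero (ENNReal.ofReal_pos.2 hTpos).ne' (hcard0 _ hne))
      (fun M hM hUM => by
        obtain ⟨Wf, B, hWB⟩ := exists_controlledFamily hM hUM
        have := hWB.mixedNorm_four_le hne hM hp2 hp4 (T := T) (Q := Q)
          (fun f hf => hfree T hT hT1.le S f hf)
        rwa [hQe] at this)
    refine hmain.trans ?_
    calc ENNReal.ofReal (C₁ * T ^ (ε / 3)) * (S.card : ℝ≥0∞) ^ (5 / 6 * ε) *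
          (∑ k ∈ S, U k ^ p) ^ (1 / p)
        ≤ ENNReal.ofReal (C₁ * T ^ (ε / 3)) * (S.card : ℝ≥0∞) ^ (5 / 6 * ε) *
          ((S.card : ℝ≥0∞) ^ (1 / p - 1 / q) * (W * X)) := by
          gcongr
          exact hHold p hp0 (by linarith)
      _ = ENNReal.ofReal (C₁ * T ^ (ε / 3)) * (S.card : ℝ≥0∞) ^ (1 / 4 - 1 / q + ε) * W * X := by
          have h1 : 1 / 4 - 1 / q + ε = 5 / 6 * ε + (1 / p - 1 / q) := by rw [hpinv]; ring
          rw [h1, ENNReal.rpow_add_of_nonneg _ _ (by positivity) (by rw [hpinv]; linarith)]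
          ring
      _ ≤ _ := by
          gcongr
          exact le_max_left _ _
  · refine le_of_forall_majorant (by norm_num) (by norm_num) (fun _ => by norm_num)
      fun M hM hUM => ?_
    obtain ⟨Wf, B, hWB⟩ := exists_controlledFamily hM hUM
    exact hWB.mixedNorm_top_two_le hM
  · refine le_of_forall_majorant (by norm_num) (by norm_num) (fun _ => by norm_num)
      fun M hM hUM => ?_
    obtain ⟨Wf, B, hWB⟩ := exists_controlledFamily hM hUM
    exact hWB.vNormΔ_le hM
  · have hmain := le_of_forall_majorant (S := S) (U := U)
      (L := mixedNorm ∞ ∞ Set.univ (fun t => ∑ k ∈ S, box k (u t)))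
      (K := 2 * (S.card : ℝ≥0∞) ^ (1 / 2 : ℝ)) (p := 2) (by norm_num)
      (ENNReal.mul_ne_top (by norm_num) (hcardT _ (by norm_num)))
      (fun hne => mul_ne_zero (by norm_num) (hcard0 _ hne))
      (fun M hM hUM => by
        obtain ⟨Wf, B, hWB⟩ := exists_controlledFamily hM hUM
        exact hWB.mixedNorm_top_top_le hM)
    refine hmain.trans ?_
    calc 2 * (S.card : ℝ≥0∞) ^ (1 / 2 : ℝ) * (∑ k ∈ S, U k ^ (2 : ℝ)) ^ (1 / 2 : ℝ)
        ≤ 2 * (S.card : ℝ≥0∞) ^ (1 / 2 : ℝ) * ((S.card : ℝ≥0∞) ^ (1 / 2 - 1 / q) * (W * X)) := by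
          gcongr
          exact hHold 2 (by norm_num) (by linarith)
      _ = 2 * (S.card : ℝ≥0∞) ^ (1 - 1 / q) * W * X := by
          have h1 : 1 - 1 / q = 1 / 2 + (1 / 2 - 1 / q) := by ring
          rw [h1, ENNReal.rpow_add_of_nonneg _ _ (by norm_num) (by linarith)]
          ring
      _ ≤ _ := by
          gcongr
          linarith

/-! ### Counting integers in intervals -/

theorem card_le_volume_add_one {I : Set ℝ} (hI : I.OrdConnected) {S : Finset ℤ}
    (hS : ∀ k ∈ S, (k : ℝ) ∈ I) : (S.card : ℝ≥0∞) ≤ volume I + 1 := by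
  rcases S.eq_empty_or_nonempty with rfl | hne
  · simp
  set m := S.min' hne
  set M := S.max' hne
  have hmM : m ≤ M := S.min'_le _ (S.max'_mem hne)
  have h1 : S ⊆ Finset.Icc m M := fun k hk =>
    Finset.mem_Icc.2 ⟨S.min'_le k hk, S.le_max' k hk⟩
  have h2 : (S.card : ℝ) ≤ (M - m : ℝ) + 1 := by
    have h3 := Finset.card_le_card h1
    rw [Int.card_Icc] at h3
    have h4 : (S.card : ℤ) ≤ M + 1 - m := by omega
    have h5 : (S.card : ℝ) ≤ ((M + 1 - m : ℤ) : ℝ) := by exact_mod_cast h4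
    push_cast at h5
    linarith
  have h3 : ENNReal.ofReal (M - m : ℝ) ≤ volume I := by
    rw [← Real.volume_Icc]
    exact measure_mono (hI.out (hS m (S.min'_mem hne)) (hS M (S.max'_mem hne)))
  have h4 : (0 : ℝ) ≤ M - m := by
    have : (m : ℝ) ≤ M := by exact_mod_cast hmM
    linarith
  calc (S.card : ℝ≥0∞) = ENNReal.ofReal S.card := (ENNReal.ofReal_natCast _).symm
    _ ≤ ENNReal.ofReal ((M - m : ℝ) + 1) := ENNReal.ofReal_le_ofReal h2
    _ = ENNReal.ofReal (M - m : ℝ) + 1 := by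
        rw [ENNReal.ofReal_add h4 zero_le_one, ENNReal.ofReal_one]
    _ ≤ _ := by gcongr

/-- The count of integers by the volume plus one already excludes infinitely many of them, so finite
volume suffices. -/
theorem exists_finset_integers {I : Set ℝ} (hI : I.OrdConnected) (hv : volume I < ∞) :
    ∃ S : Finset ℤ, ∀ k : ℤ, k ∈ S ↔ (k : ℝ) ∈ I := by
  have hfin : {k : ℤ | (k : ℝ) ∈ I}.Finite := by
    by_contra hinf
    obtain ⟨n, hn⟩ := ENNReal.exists_nat_gt (ENNReal.add_lt_top.2 ⟨hv, ENNReal.one_lt_top⟩).ne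
    obtain ⟨S, hS, hcard⟩ := Set.Infinite.exists_subset_card_eq hinf n
    have := card_le_volume_add_one hI (S := S) fun k hk => hS hk
    rw [hcard] at this
    exact absurd hn (not_lt.2 this)
  exact ⟨hfin.toFinset, fun k => by simp⟩

/-- The four estimates with real-valued bounds `κ ρ` for the number of frequencies and `ω σ` for
their weights. -/
theorem exists_interval_estimates {ε : ℝ} (hε : 0 < ε) (hε' : ε < 1 / 10) {κ ω : ℝ} (hκ : 1 ≤ κ)
    (hω : 0 < ω) :
    ∃ C : ℝ, 0 < C ∧ ∀ (q : ℝ), 4 ≤ q → ∀ (T : ℝ), 0 < T → T < 1 → ∀ (I : Set ℝ) (S : Finset ℤ),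
      (∀ k : ℤ, k ∈ S ↔ (k : ℝ) ∈ I) → ∀ (ρ σ : ℝ), 0 < ρ → 0 < σ → (S.card : ℝ) ≤ κ * ρ →
      (∀ k ∈ S, bracket k ^ (-(1 / 2) : ℝ) ≤ ω * σ) → ∀ u : ℝ → L2,
      mixedNorm 4 4 (Set.Icc 0 T) (proj I u) ≤
        ENNReal.ofReal (C * T ^ (ε / 3) * (ρ ^ (1 / 4 - 1 / q + ε) * σ)) * xNormΔ (1 / 2) q I u ∧
      mixedNorm ∞ 2 Set.univ (proj I u) ≤
        ENNReal.ofReal (C * (ρ ^ (1 / 2 - 1 / q) * σ)) * xNormΔ (1 / 2) q I u ∧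
      vNormΔ 2 (proj I u) ≤
        ENNReal.ofReal (C * (ρ ^ (1 / 2 - 1 / q) * σ)) * xNormΔ (1 / 2) q I u ∧
      mixedNorm ∞ ∞ Set.univ (proj I u) ≤
        ENNReal.ofReal (C * (ρ ^ (1 - 1 / q) * σ)) * xNormΔ (1 / 2) q I u := by
  obtain ⟨C, hC, hmain⟩ := exists_finite_frequency_estimates hε hε'
  refine ⟨C * κ * ω, by positivity, fun q hq T hT hT1 I S hS ρ σ hρ hσ hcard hbr u => ?_⟩
  have hq4 : 1 / q ≤ 1 / 4 := one_div_le_one_div_of_le (by norm_num) hq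
  have hq0 : 0 < 1 / q := by positivity
  have hN : (S.card : ℝ≥0∞) ≤ ENNReal.ofReal (κ * ρ) := by
    rw [← ENNReal.ofReal_natCast]
    exact ENNReal.ofReal_le_ofReal hcard
  have h := hmain q hq T hT hT1 I S hS (ENNReal.ofReal (κ * ρ)) (ENNReal.ofReal (ω * σ)) hN
    (fun k hk => ENNReal.ofReal_le_ofReal (hbr k hk)) u
  have hcomb : ∀ (τ : ℝ), 0 ≤ τ → ∀ e : ℝ, 0 ≤ e → e ≤ 1 →
      ENNReal.ofReal τ * ENNReal.ofReal (κ * ρ) ^ e * ENNReal.ofReal (ω * σ) ≤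
        ENNReal.ofReal (τ * κ * ω * (ρ ^ e * σ)) := by
    intro τ hτ e he he1
    rw [ENNReal.ofReal_rpow_of_pos (by positivity), ← ENNReal.ofReal_mul hτ,
      ← ENNReal.ofReal_mul (by positivity)]
    apply ENNReal.ofReal_le_ofReal
    rw [Real.mul_rpow (by positivity) hρ.le]
    -- All exponents lie in `[0, 1]`, which keeps the constant independent of `q`.
    have h1 : κ ^ e ≤ κ := by
      conv_rhs => rw [← Real.rpow_one κ]
      exact Real.rpow_le_rpow_of_exponent_le hκ he1
    have h2 : 0 ≤ τ * (ω * (ρ ^ e * σ)) := by positivity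
    nlinarith [mul_le_mul_of_nonneg_right h1 h2]
  refine ⟨h.1.trans ?_, h.2.1.trans ?_, h.2.2.1.trans ?_, h.2.2.2.trans ?_⟩
  · gcongr
    refine (hcomb (C * T ^ (ε / 3)) (by positivity) _ (by linarith) (by linarith)).trans
      (le_of_eq ?_)
    congr 1
    ring
  · gcongr
    exact hcomb C hC.le _ (by linarith) (by linarith)
  · gcongr
    exact hcomb C hC.le _ (by linarith) (by linarith)
  · gcongr
    exact hcomb C hC.le _ (by linarith) (by linarith)

theorem bracket_rpow_le {x y : ℝ} (hy : 0 < y) (h : y ≤ |x|) :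
    bracket x ^ (-(1 / 2) : ℝ) ≤ y ^ (-(1 / 2) : ℝ) :=
  Real.rpow_le_rpow_of_nonpos hy (h.trans (abs_le_bracket x)) (by norm_num)

theorem bracket_le_two_mul {x : ℝ} (hx : 1 ≤ x) : bracket x ≤ 2 * x := by
  rw [bracket]
  exact Real.sqrt_le_iff.2 ⟨by linarith, by nlinarith⟩

/-- `⟨l⟩ ≤ 2l` for `l ≥ 1`, hence `|x| ≥ (c/2)⟨l⟩`. -/
theorem bracket_rpow_le_of_mul_le {c l x : ℝ} (hc : 0 < c) (hl : 1 ≤ l) (h : c * l ≤ |x|) :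
    bracket x ^ (-(1 / 2) : ℝ) ≤ (c / 2) ^ (-(1 / 2) : ℝ) * bracket l ^ (-(1 / 2) : ℝ) := by
  have hb : 0 < bracket l := lt_of_lt_of_le one_pos (one_le_bracket l)
  rw [← Real.mul_rpow (by positivity) hb.le]
  refine bracket_rpow_le (by positivity) (le_trans ?_ h)
  have := bracket_le_two_mul hl
  nlinarith

theorem card_le_of_volume_le {I : Set ℝ} (hI : I.OrdConnected) {S : Finset ℤ}
    (hS : ∀ k ∈ S, (k : ℝ) ∈ I) {V : ℝ} (hV : 0 ≤ V) (h : volume I ≤ ENNReal.ofReal V) :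
    (S.card : ℝ) ≤ V + 1 := by
  have h1 : ENNReal.ofReal S.card ≤ ENNReal.ofReal (V + 1) := by
    rw [ENNReal.ofReal_natCast, ENNReal.ofReal_add hV zero_le_one, ENNReal.ofReal_one]
    exact (card_le_volume_add_one hI hS).trans (by gcongr)
  exact (ENNReal.ofReal_le_ofReal_iff (by linarith)).1 h1

/-! ### The four families of intervals -/

/-- The lower bound on the length absorbs the extra integer: `|I| + 1 ≤ (1 + 1/c₀)|I|`. -/
theorem estimates_long_intervals (c₀ : ℝ) (hc₀ : 0 < c₀) (ε : ℝ) (hε : 0 < ε) (hε' : ε < 1 / 10) :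
    ∃ C : ℝ, 0 < C ∧
      ∀ q : ℝ, 4 ≤ q → ∀ T : ℝ, 0 < T → T < 1 →
      ∀ I : Set ℝ, I.OrdConnected → ENNReal.ofReal c₀ ≤ volume I → volume I < ∞ →
      ∀ u : ℝ → L2,
        mixedNorm 4 4 (Set.Icc 0 T) (proj I u) ≤
            ENNReal.ofReal (C * T ^ (ε / 3)) * volume I ^ (1 / 4 - 1 / q + ε) *
              maxWeight I * xNormΔ (1 / 2) q I u ∧
        mixedNorm ∞ 2 Set.univ (proj I u) ≤
            ENNReal.ofReal C * volume I ^ (1 / 2 - 1 / q) *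
              maxWeight I * xNormΔ (1 / 2) q I u ∧
        vNormΔ 2 (proj I u) ≤
            ENNReal.ofReal C * volume I ^ (1 / 2 - 1 / q) *
              maxWeight I * xNormΔ (1 / 2) q I u ∧
        mixedNorm ∞ ∞ Set.univ (proj I u) ≤
            ENNReal.ofReal C * volume I ^ (1 - 1 / q) *
              maxWeight I * xNormΔ (1 / 2) q I u := by
  obtain ⟨C, hC, hmain⟩ := exists_finite_frequency_estimates hε hε'
  set κ : ℝ := 1 + 1 / c₀ with hκ
  have hκ1 : 1 ≤ κ := by
    have : 0 < 1 / c₀ := by positivity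
    linarith
  refine ⟨C * κ, by positivity, fun q hq T hT hT1 I hI hlow hfin u => ?_⟩
  have hq4 : 1 / q ≤ 1 / 4 := one_div_le_one_div_of_le (by norm_num) hq
  have hq0 : 0 < 1 / q := by positivity
  obtain ⟨S, hS⟩ := exists_finset_integers hI hfin
  have hN : (S.card : ℝ≥0∞) ≤ ENNReal.ofReal κ * volume I := by
    refine (card_le_volume_add_one hI fun k hk => (hS k).1 hk).trans ?_
    have h1 : 1 ≤ ENNReal.ofReal (1 / c₀) * volume I := by
      calc (1 : ℝ≥0∞) = ENNReal.ofReal (1 / c₀) * ENNReal.ofReal c₀ := by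
            rw [← ENNReal.ofReal_mul (by positivity), one_div_mul_cancel hc₀.ne',
              ENNReal.ofReal_one]
        _ ≤ _ := by gcongr
    rw [hκ, ENNReal.ofReal_add zero_le_one (by positivity), ENNReal.ofReal_one, add_mul, one_mul]
    gcongr
  have h := hmain q hq T hT hT1 I S hS (ENNReal.ofReal κ * volume I) (maxWeight I) hN
    (fun k hk => le_iSup₂_of_le (k : ℝ) ((hS k).1 hk) le_rfl) u
  have hcomb : ∀ (τ : ℝ), 0 ≤ τ → ∀ e : ℝ, 0 ≤ e → e ≤ 1 →
      ENNReal.ofReal τ * (ENNReal.ofReal κ * volume I) ^ e ≤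
        ENNReal.ofReal (τ * κ) * volume I ^ e := by
    intro τ hτ e he he1
    rw [ENNReal.mul_rpow_of_nonneg _ _ he, ENNReal.ofReal_mul hτ, mul_assoc]
    gcongr
    conv_rhs => rw [← ENNReal.rpow_one (ENNReal.ofReal κ)]
    exact ENNReal.rpow_le_rpow_of_exponent_le (ENNReal.one_le_ofReal.2 hκ1) he1
  refine ⟨h.1.trans ?_, h.2.1.trans ?_, h.2.2.1.trans ?_, h.2.2.2.trans ?_⟩
  · refine mul_le_mul' (mul_le_mul' ?_ le_rfl) le_rfl
    refine (hcomb (C * T ^ (ε / 3)) (by positivity) _ (by linarith) (by linarith)).trans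
      (le_of_eq ?_)
    rw [mul_right_comm C]
  · exact mul_le_mul' (mul_le_mul' (hcomb C hC.le _ (by linarith) (by linarith)) le_rfl) le_rfl
  · exact mul_le_mul' (mul_le_mul' (hcomb C hC.le _ (by linarith) (by linarith)) le_rfl) le_rfl
  · exact mul_le_mul' (mul_le_mul' (hcomb C hC.le _ (by linarith) (by linarith)) le_rfl) le_rfl

theorem estimates_dyadic_intervals (a b : ℝ) (ha : 0 < a) (hab : a < b) (ε : ℝ) (hε : 0 < ε)
    (hε' : ε < 1 / 10) :
    ∃ C : ℝ, 0 < C ∧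
      ∀ q : ℝ, 4 ≤ q → ∀ T : ℝ, 0 < T → T < 1 →
      ∀ (j : ℤ) (I : Set ℝ), I = Set.Icc (a * 2 ^ j) (b * 2 ^ j) →
      ∀ u : ℝ → L2,
        mixedNorm 4 4 (Set.Icc 0 T) (proj I u) ≤
            ENNReal.ofReal (C * T ^ (ε / 3) * 2 ^ ((j : ℝ) * (-(1 / 4) - 1 / q + ε))) *
              xNormΔ (1 / 2) q I u ∧
        mixedNorm ∞ 2 Set.univ (proj I u) ≤
            ENNReal.ofReal (C * 2 ^ (-(j : ℝ) / q)) * xNormΔ (1 / 2) q I u ∧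
        vNormΔ 2 (proj I u) ≤
            ENNReal.ofReal (C * 2 ^ (-(j : ℝ) / q)) * xNormΔ (1 / 2) q I u ∧
        mixedNorm ∞ ∞ Set.univ (proj I u) ≤
            ENNReal.ofReal (C * 2 ^ ((j : ℝ) * (1 / 2 - 1 / q))) *
              xNormΔ (1 / 2) q I u := by
  have hb : 0 < b := ha.trans hab
  obtain ⟨C, hC, hmain⟩ := exists_interval_estimates hε hε' (κ := 2 * b + 1)
    (ω := a ^ (-(1 / 2) : ℝ)) (by linarith) (by positivity)
  refine ⟨C, hC, fun q hq T hT hT1 j I hI u => ?_⟩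
  have hOC : I.OrdConnected := hI ▸ Set.ordConnected_Icc
  have hvol : volume I = ENNReal.ofReal (b * 2 ^ j - a * 2 ^ j) := by rw [hI, Real.volume_Icc]
  have hj : (0 : ℝ) < 2 ^ j := by positivity
  obtain ⟨S, hS⟩ := exists_finset_integers hOC (hvol ▸ ENNReal.ofReal_lt_top)
  have hmem : ∀ k ∈ S, a * 2 ^ j ≤ (k : ℝ) ∧ (k : ℝ) ≤ b * 2 ^ j := fun k hk => by
    have := (hS k).1 hk
    rw [hI] at this
    exact this
  have hcard : (S.card : ℝ) ≤ (2 * b + 1) * 2 ^ (j : ℝ) := by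
    rw [Real.rpow_intCast]
    rcases S.eq_empty_or_nonempty with hemp | ⟨k, hk⟩
    · rw [hemp]
      simp only [Finset.card_empty, Nat.cast_zero]
      positivity
    · obtain ⟨h1, h2⟩ := hmem k hk
      have h3 : (0 : ℝ) < k := lt_of_lt_of_le (by positivity) h1
      -- For negative `j` the extra `1` in the count is not bounded by the length alone. But an
      -- integer in the interval is positive, so `1 ≤ k ≤ b 2^j` whenever there is one.
      have h4 : (1 : ℝ) ≤ k := by exact_mod_cast (show (0 : ℤ) < k by exact_mod_cast h3)
      have h5 := card_le_of_volume_le hOC (fun k hk => (hS k).1 hk)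
        (by nlinarith : (0 : ℝ) ≤ b * 2 ^ j - a * 2 ^ j) hvol.le
      nlinarith
  have hbr : ∀ k ∈ S, bracket k ^ (-(1 / 2) : ℝ) ≤
      a ^ (-(1 / 2) : ℝ) * 2 ^ (-(j : ℝ) / 2) := by
    intro k hk
    have h1 := bracket_rpow_le (x := k) (y := a * 2 ^ j) (by positivity)
      ((hmem k hk).1.trans (le_abs_self _))
    refine h1.trans (le_of_eq ?_)
    rw [Real.mul_rpow ha.le hj.le, ← Real.rpow_intCast, ← Real.rpow_mul (by norm_num)]
    congr 2
    ring
  have h := hmain q hq T hT hT1 I S hS (2 ^ (j : ℝ)) (2 ^ (-(j : ℝ) / 2)) (by positivity)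
    (by positivity) hcard hbr u
  have hexp : ∀ e : ℝ, ((2 : ℝ) ^ (j : ℝ)) ^ e * 2 ^ (-(j : ℝ) / 2) = 2 ^ ((j : ℝ) * (e - 1 / 2)) := by
    intro e
    rw [← Real.rpow_mul (by norm_num), ← Real.rpow_add (by norm_num)]
    congr 1
    ring
  simp only [hexp] at h
  have e1 : (j : ℝ) * (1 / 4 - 1 / q + ε - 1 / 2) = (j : ℝ) * (-(1 / 4) - 1 / q + ε) := by ring
  have e2 : (j : ℝ) * (1 / 2 - 1 / q - 1 / 2) = -(j : ℝ) / q := by ring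
  have e3 : (j : ℝ) * (1 - 1 / q - 1 / 2) = (j : ℝ) * (1 / 2 - 1 / q) := by ring
  rwa [e1, e2, e3] at h

/-- On `[c λ₀, λ₀]` all weights are at most a constant times `⟨λ₀⟩^{-1/2}`, and `2^j ≥ 1` absorbs
the extra integer in the count. -/
theorem estimates_shifted_dyadic_intervals (a b c : ℝ) (hab : a < b) (hc : 0 < c)
    (ε : ℝ) (hε : 0 < ε) (hε' : ε < 1 / 10) :
    ∃ C : ℝ, 0 < C ∧
      ∀ q : ℝ, 4 ≤ q → ∀ T : ℝ, 0 < T → T < 1 →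
      ∀ (l₀ : ℝ) (j : ℕ) (I : Set ℝ), 1 ≤ l₀ →
      I = Set.Icc (l₀ - b * 2 ^ j) (l₀ - a * 2 ^ j) → I ⊆ Set.Icc (c * l₀) l₀ →
      ∀ u : ℝ → L2,
        mixedNorm 4 4 (Set.Icc 0 T) (proj I u) ≤
            ENNReal.ofReal (C * T ^ (ε / 3) * bracket l₀ ^ (-(1 / 2) : ℝ) *
              2 ^ ((j : ℝ) * (1 / 4 - 1 / q + ε))) * xNormΔ (1 / 2) q I u ∧
        mixedNorm ∞ 2 Set.univ (proj I u) ≤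
            ENNReal.ofReal (C * bracket l₀ ^ (-(1 / 2) : ℝ) *
              2 ^ ((j : ℝ) * (1 / 2 - 1 / q))) * xNormΔ (1 / 2) q I u ∧
        mixedNorm ∞ ∞ Set.univ (proj I u) ≤
            ENNReal.ofReal (C * bracket l₀ ^ (-(1 / 2) : ℝ) *
              2 ^ ((j : ℝ) * (1 - 1 / q))) * xNormΔ (1 / 2) q I u := by
  obtain ⟨C, hC, hmain⟩ := exists_interval_estimates hε hε' (κ := b - a + 1)
    (ω := (c / 2) ^ (-(1 / 2) : ℝ)) (by linarith) (by positivity)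
  refine ⟨C, hC, fun q hq T hT hT1 l₀ j I hl₀ hI hIc u => ?_⟩
  have hOC : I.OrdConnected := hI ▸ Set.ordConnected_Icc
  have hvol : volume I = ENNReal.ofReal ((b - a) * 2 ^ j) := by
    rw [hI, Real.volume_Icc]
    congr 1
    ring
  have hj : (1 : ℝ) ≤ 2 ^ j := one_le_pow₀ (by norm_num)
  have hbpos : 0 < bracket l₀ := lt_of_lt_of_le one_pos (one_le_bracket l₀)
  obtain ⟨S, hS⟩ := exists_finset_integers hOC (hvol ▸ ENNReal.ofReal_lt_top)
  have hcard : (S.card : ℝ) ≤ (b - a + 1) * 2 ^ (j : ℝ) := by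
    rw [Real.rpow_natCast]
    have h5 := card_le_of_volume_le hOC (fun k hk => (hS k).1 hk)
      (by nlinarith : (0 : ℝ) ≤ (b - a) * 2 ^ j) hvol.le
    linarith
  have h := hmain q hq T hT hT1 I S hS (2 ^ (j : ℝ)) (bracket l₀ ^ (-(1 / 2) : ℝ)) (by positivity)
    (by positivity) hcard (fun k hk => bracket_rpow_le_of_mul_le hc hl₀
      ((hIc ((hS k).1 hk)).1.trans (le_abs_self _))) u
  have hexp : ∀ τ e : ℝ, τ * (((2 : ℝ) ^ (j : ℝ)) ^ e * bracket l₀ ^ (-(1 / 2) : ℝ)) =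
      τ * bracket l₀ ^ (-(1 / 2) : ℝ) * 2 ^ ((j : ℝ) * e) := by
    intro τ e
    rw [← Real.rpow_mul (by norm_num)]
    ring
  simp only [hexp] at h
  exact ⟨h.1, h.2.1, h.2.2.2⟩

/-- Both the length and the extra integer are bounded by `⟨λ₀⟩`, and the weight contributes
`⟨λ₀⟩^{-1/2}`. -/
theorem estimates_comparable_intervals (c : ℝ) (hc : 0 < c) (ε : ℝ) (hε : 0 < ε)
    (hε' : ε < 1 / 10) :
    ∃ C : ℝ, 0 < C ∧
      ∀ q : ℝ, 4 ≤ q → ∀ T : ℝ, 0 < T → T < 1 →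
      ∀ (l₀ : ℝ) (I : Set ℝ), 1 ≤ l₀ → I.OrdConnected →
      (I ⊆ Set.Icc (c * l₀) l₀ ∨ I ⊆ Set.Icc (-l₀) (-(c * l₀))) →
      ∀ u : ℝ → L2,
        mixedNorm 4 4 (Set.Icc 0 T) (proj I u) ≤
            ENNReal.ofReal (C * T ^ (ε / 3) *
              bracket l₀ ^ (-(1 / 4) - 1 / q + ε)) * xNormΔ (1 / 2) q I u ∧
        mixedNorm ∞ 2 Set.univ (proj I u) ≤
            ENNReal.ofReal (C * bracket l₀ ^ (-(1 / q))) *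
              xNormΔ (1 / 2) q I u ∧
        vNormΔ 2 (proj I u) ≤
            ENNReal.ofReal (C * bracket l₀ ^ (-(1 / q))) *
              xNormΔ (1 / 2) q I u ∧
        mixedNorm ∞ ∞ Set.univ (proj I u) ≤
            ENNReal.ofReal (C * bracket l₀ ^ (1 / 2 - 1 / q)) *
              xNormΔ (1 / 2) q I u := by
  obtain ⟨C, hC, hmain⟩ := exists_interval_estimates hε hε' (κ := 2)
    (ω := (c / 2) ^ (-(1 / 2) : ℝ)) (by norm_num) (by positivity)
  refine ⟨C, hC, fun q hq T hT hT1 l₀ I hl₀ hOC hIc u => ?_⟩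
  have hcl : 0 < c * l₀ := by positivity
  have hvol : volume I ≤ ENNReal.ofReal l₀ := by
    rcases hIc with h | h
    · refine (measure_mono h).trans ?_
      rw [Real.volume_Icc]
      exact ENNReal.ofReal_le_ofReal (by linarith)
    · refine (measure_mono h).trans ?_
      rw [Real.volume_Icc]
      exact ENNReal.ofReal_le_ofReal (by linarith)
  have habs : ∀ x ∈ I, c * l₀ ≤ |x| := by
    intro x hx
    rcases hIc with h | h
    · exact (h hx).1.trans (le_abs_self _)
    · have := (h hx).2
      exact le_trans (by linarith) (neg_le_abs x)
  have hbpos : 0 < bracket l₀ := lt_of_lt_of_le one_pos (one_le_bracket l₀)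
  have hlb : l₀ ≤ bracket l₀ := (le_abs_self _).trans (abs_le_bracket l₀)
  obtain ⟨S, hS⟩ := exists_finset_integers hOC (hvol.trans_lt ENNReal.ofReal_lt_top)
  have hcard : (S.card : ℝ) ≤ 2 * bracket l₀ := by
    have h5 := card_le_of_volume_le hOC (fun k hk => (hS k).1 hk)
      (by linarith : (0 : ℝ) ≤ l₀) hvol
    linarith
  have h := hmain q hq T hT hT1 I S hS (bracket l₀) (bracket l₀ ^ (-(1 / 2) : ℝ)) hbpos
    (by positivity) hcard (fun k hk => bracket_rpow_le_of_mul_le hc hl₀ (habs _ ((hS k).1 hk))) u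
  simp only [← Real.rpow_add hbpos] at h
  have e1 : 1 / 4 - 1 / q + ε + -(1 / 2) = -(1 / 4) - 1 / q + ε := by ring
  have e2 : 1 / 2 - 1 / q + -(1 / 2) = -(1 / q) := by ring
  have e3 : 1 - 1 / q + -(1 / 2) = 1 / 2 - 1 / q := by ring
  rwa [e1, e2, e3] at h

end DNLS

end

theorem mainTheorem6 :
    ∃ ε₀ : ℝ, 0 < ε₀ ∧
      -- intervals `I` with `1 ≲ |I| < ∞`
      (∀ c₀ : ℝ, 0 < c₀ → ∀ ε : ℝ, 0 < ε → ε < ε₀ → ∃ C : ℝ, 0 < C ∧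
        ∀ q : ℝ, 4 ≤ q → ∀ T : ℝ, 0 < T → T < 1 →
        ∀ I : Set ℝ, I.OrdConnected → ENNReal.ofReal c₀ ≤ volume I → volume I < ∞ →
        ∀ u : ℝ → DNLS.L2,
          DNLS.mixedNorm 4 4 (Set.Icc 0 T) (DNLS.proj I u) ≤
              ENNReal.ofReal (C * T ^ (ε / 3)) * volume I ^ (1 / 4 - 1 / q + ε) *
                DNLS.maxWeight I * DNLS.xNormΔ (1 / 2) q I u ∧
          DNLS.mixedNorm ∞ 2 Set.univ (DNLS.proj I u) ≤
              ENNReal.ofReal C * volume I ^ (1 / 2 - 1 / q) *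
                DNLS.maxWeight I * DNLS.xNormΔ (1 / 2) q I u ∧
          DNLS.vNormΔ 2 (DNLS.proj I u) ≤
              ENNReal.ofReal C * volume I ^ (1 / 2 - 1 / q) *
                DNLS.maxWeight I * DNLS.xNormΔ (1 / 2) q I u ∧
          DNLS.mixedNorm ∞ ∞ Set.univ (DNLS.proj I u) ≤
              ENNReal.ofReal C * volume I ^ (1 - 1 / q) *
                DNLS.maxWeight I * DNLS.xNormΔ (1 / 2) q I u) ∧
      -- dyadic intervals `I_j = [a 2^j, b 2^j]`
      (∀ a b : ℝ, 0 < a → a < b → ∀ ε : ℝ, 0 < ε → ε < ε₀ → ∃ C : ℝ, 0 < C ∧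
        ∀ q : ℝ, 4 ≤ q → ∀ T : ℝ, 0 < T → T < 1 →
        ∀ (j : ℤ) (I : Set ℝ), I = Set.Icc (a * 2 ^ j) (b * 2 ^ j) →
        ∀ u : ℝ → DNLS.L2,
          DNLS.mixedNorm 4 4 (Set.Icc 0 T) (DNLS.proj I u) ≤
              ENNReal.ofReal (C * T ^ (ε / 3) * 2 ^ ((j : ℝ) * (-(1 / 4) - 1 / q + ε))) *
                DNLS.xNormΔ (1 / 2) q I u ∧
          DNLS.mixedNorm ∞ 2 Set.univ (DNLS.proj I u) ≤
              ENNReal.ofReal (C * 2 ^ (-(j : ℝ) / q)) * DNLS.xNormΔ (1 / 2) q I u ∧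
          DNLS.vNormΔ 2 (DNLS.proj I u) ≤
              ENNReal.ofReal (C * 2 ^ (-(j : ℝ) / q)) * DNLS.xNormΔ (1 / 2) q I u ∧
          DNLS.mixedNorm ∞ ∞ Set.univ (DNLS.proj I u) ≤
              ENNReal.ofReal (C * 2 ^ ((j : ℝ) * (1 / 2 - 1 / q))) *
                DNLS.xNormΔ (1 / 2) q I u) ∧
      -- dyadic intervals below `λ₀`: `I_j = λ₀ - [a 2^j, b 2^j] ⊆ [c λ₀, λ₀]`
      (∀ a b c : ℝ, 0 < a → a < b → 0 < c → c < 1 → ∀ ε : ℝ, 0 < ε → ε < ε₀ →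
        ∃ C : ℝ, 0 < C ∧
        ∀ q : ℝ, 4 ≤ q → ∀ T : ℝ, 0 < T → T < 1 →
        ∀ (l₀ : ℝ) (j : ℕ) (I : Set ℝ), 1 ≤ l₀ →
        I = Set.Icc (l₀ - b * 2 ^ j) (l₀ - a * 2 ^ j) → I ⊆ Set.Icc (c * l₀) l₀ →
        ∀ u : ℝ → DNLS.L2,
          DNLS.mixedNorm 4 4 (Set.Icc 0 T) (DNLS.proj I u) ≤
              ENNReal.ofReal (C * T ^ (ε / 3) * DNLS.bracket l₀ ^ (-(1 / 2) : ℝ) *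
                2 ^ ((j : ℝ) * (1 / 4 - 1 / q + ε))) * DNLS.xNormΔ (1 / 2) q I u ∧
          DNLS.mixedNorm ∞ 2 Set.univ (DNLS.proj I u) ≤
              ENNReal.ofReal (C * DNLS.bracket l₀ ^ (-(1 / 2) : ℝ) *
                2 ^ ((j : ℝ) * (1 / 2 - 1 / q))) * DNLS.xNormΔ (1 / 2) q I u ∧
          DNLS.mixedNorm ∞ ∞ Set.univ (DNLS.proj I u) ≤
              ENNReal.ofReal (C * DNLS.bracket l₀ ^ (-(1 / 2) : ℝ) *
                2 ^ ((j : ℝ) * (1 - 1 / q))) * DNLS.xNormΔ (1 / 2) q I u) ∧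
      -- intervals `I ⊆ [c λ₀, λ₀]` or `I ⊆ [-λ₀, -c λ₀]`
      (∀ c : ℝ, 0 < c → c < 1 → ∀ ε : ℝ, 0 < ε → ε < ε₀ → ∃ C : ℝ, 0 < C ∧
        ∀ q : ℝ, 4 ≤ q → ∀ T : ℝ, 0 < T → T < 1 →
        ∀ (l₀ : ℝ) (I : Set ℝ), 1 ≤ l₀ → I.OrdConnected →
        (I ⊆ Set.Icc (c * l₀) l₀ ∨ I ⊆ Set.Icc (-l₀) (-(c * l₀))) →
        ∀ u : ℝ → DNLS.L2,
          DNLS.mixedNorm 4 4 (Set.Icc 0 T) (DNLS.proj I u) ≤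
              ENNReal.ofReal (C * T ^ (ε / 3) *
                DNLS.bracket l₀ ^ (-(1 / 4) - 1 / q + ε)) * DNLS.xNormΔ (1 / 2) q I u ∧
          DNLS.mixedNorm ∞ 2 Set.univ (DNLS.proj I u) ≤
              ENNReal.ofReal (C * DNLS.bracket l₀ ^ (-(1 / q))) *
                DNLS.xNormΔ (1 / 2) q I u ∧
          DNLS.vNormΔ 2 (DNLS.proj I u) ≤
              ENNReal.ofReal (C * DNLS.bracket l₀ ^ (-(1 / q))) *
                DNLS.xNormΔ (1 / 2) q I u ∧
          DNLS.mixedNorm ∞ ∞ Set.univ (DNLS.proj I u) ≤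
              ENNReal.ofReal (C * DNLS.bracket l₀ ^ (1 / 2 - 1 / q)) *
                DNLS.xNormΔ (1 / 2) q I u) := by
  -- `1/10` is a convenient choice: it ensures `4ε/3 ≤ 1/2`, `p ≥ 2` and `1/4 - 1/q + ε ≤ 1`.
  refine ⟨1 / 10, by norm_num, DNLS.estimates_long_intervals, DNLS.estimates_dyadic_intervals,
    ?_, ?_⟩
  · intro a b c _ hab hc _ ε hε hε'
    exact DNLS.estimates_shifted_dyadic_intervals a b c hab hc ε hε hε'
  · intro c hc _ ε hε hε'
    exact DNLS.estimates_comparable_intervals c hc ε hε hε'
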